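/- Let $N\ge 2$, and let $\chi,\varphi\in C^\infty(\mathbb R^N;\mathbb R)$ satisfy $\operatorname{Supp}\chi\subset\{|\xi|\le \frac43\}$, $\operatorname{Supp}\varphi\subset\{\frac34\le|\xi|\le\frac83\}$, $\chi(\xi)+\sum_{q\ge0}\varphi(2^{-q}\xi)=1$ for all $\xi$, and $\sum_{q\in\mathbb Z}\varphi(2^{-q}\xi)=1$ for $\xi\ne0$. Put $\dot\Delta_q=\varphi(2^{-q}D)$ and $\dot S_q=\chi(2^{-q}D)$. Let $\mathcal S'_h$ be the set of tempered distributions $f$ on $\mathbb R^N$ with $\lim_{q\to-\infty}\|\dot S_qf\|_{L^\infty}=0$; for $f\in\mathcal S'_h$ put $f_L=\sum_{q<1}\dot\Delta_qf$ and $f_H=f-f_L=\sum_{q\ge1}\dot\Delta_qf$. For $\sigma\in\mathbb R$, $\dot B^\sigma_{2,1}$ is the set of $f\in\mathcal S'_h$ with $\|f\|_{\dot B^\sigma_{2,1}}=\sum_{q\in\mathbb Z}2^{q\sigma}\|\dot\Delta_qf\|_{L^2}<\infty$. For $T\in(0,\infty)$ and $r\in[1,\infty]$, $\widetilde L^r_T(\dot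 B^\sigma_{2,1})$ is the space of ($\mathcal S'_h$-valued, measurable in time) $f$ on $(0,T)$ with $$\|f\|_{\widetilde L^r_T(\dot B^\sigma_{2,1})}=\sum_{q\in\mathbb Z}2^{q\sigma}\big\|\,\|\dot\Delta_qf(t)\|_{L^2}\big\|_{L^r(0,T)}<\infty .$$ Let $s\ge0$ and let $K:\mathbb R\to\mathbb R$ be smooth with $K(0)=0$. Then there is a nondecreasing function $C:[0,\infty)\to[0,\infty)$, depending only on $N$, $\chi$, $\varphi$, $s$ and $K'$, such that the following holds for all $r\in[1,\infty]$ and $T\in(0,\infty)$. Let $u$ be a real-valued measurable function on $(0,T)\times\mathbb R^N$ with $u\in L^\infty_T(\dot B^{N/2}_{2,1})$, $u_L\in\widetilde L^r_T(\dot B^{N/2+s}_{2,1})$ and $u_H\in\widetilde L^r_T(\dot B^{N/2}_{2,1})$. Then $u\in L^\infty_T(L^\infty)$, $K(u(t))\in\mathcal S'_h$ for almost every $t\in(0,T)$, $K(u)_L\in\widetilde L^r_T(\dot B^{N/2+s}_{2,1})$, $K(u)_H\in\widetilde L^r_T(\dot B^{N/2}_{2,1})$, and $$\|K(u)_L\|_{\widetilde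 L^r_T(\dot B^{N/2+s}_{2,1})}\le C\big(\|u\|_{L^\infty_T(L^\infty)}\big)\Big(\|u_L\|_{\widetilde L^r_T(\dot B^{N/2+s}_{2,1})}+\|u_H\|_{\widetilde L^r_T(\dot B^{N/2}_{2,1})}\Big),$$ $$\|K(u)_H\|_{\widetilde L^r_T(\dot B^{N/2}_{2,1})}\le C\big(\|u\|_{L^\infty_T(L^\infty)}\big)\Big(\|u_L\|_{\widetilde L^r_T(\dot B^{N/2+s}_{2,1})}+\|u_H\|_{\widetilde L^r_T(\dot B^{N/2}_{2,1})}\Big).$$ -/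

import Mathlib

open MeasureTheory Filter Topology Set
open scoped ENNReal NNReal SchwartzMap ContDiff

noncomputable section

namespace HybridBesov

/-- The space `ℝ^N` with its Euclidean norm. -/
abbrev E (N : ℕ) : Type := EuclideanSpace ℝ (Fin N)

/-- A Littlewood–Paley couple `(χ, φ)` on `ℝ^N`: a smooth dyadic partition of unity.
(The sums over `q` have only finitely many nonzero terms at each `ξ`.) -/
structure LPCouple (N : ℕ) where
  χ : E N → ℝ
  φ : E N → ℝ
  smooth_χ : ContDiff ℝ ∞ χ
  smooth_φ : ContDiff ℝ ∞ φ
  supp_χ : tsupport χ ⊆ {ξ | ‖ξ‖ ≤ 4 / 3}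
  supp_φ : tsupport φ ⊆ {ξ | 3 / 4 ≤ ‖ξ‖ ∧ ‖ξ‖ ≤ 8 / 3}
  inhom : ∀ ξ : E N, HasSum (fun q : ℕ => φ ((2 : ℝ) ^ (-(q : ℤ)) • ξ)) (1 - χ ξ)
  hom : ∀ ξ : E N, ξ ≠ 0 → HasSum (fun q : ℤ => φ ((2 : ℝ) ^ (-q) • ξ)) 1

variable {N : ℕ}

/-- The Fourier multiplier `m(D)`, `D = -i∇`, on tempered distributions. Mathlib's Fourier
transform has the kernel `exp(-2πi x·ξ)`, so that `D` has the symbol `2πξ`. -/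
def multiplier (m : E N → ℝ) : 𝓢'(E N, ℂ) →L[ℂ] 𝓢'(E N, ℂ) :=
  TemperedDistribution.fourierMultiplierCLM ℂ (fun ξ : E N => ((m ((2 * Real.pi) • ξ) : ℝ) : ℂ))

/-- The dyadic block `Δ_q = φ(2^{-q} D)`. -/
def block (P : LPCouple N) (q : ℤ) : 𝓢'(E N, ℂ) →L[ℂ] 𝓢'(E N, ℂ) :=
  multiplier (fun ξ => P.φ ((2 : ℝ) ^ (-q) • ξ))

/-- The low-frequency cut-off `S_q = χ(2^{-q} D)`. -/
def cutoff (P : LPCouple N) (q : ℤ) : 𝓢'(E N, ℂ) →L[ℂ] 𝓢'(E N, ℂ) :=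
  multiplier (fun ξ => P.χ ((2 : ℝ) ^ (-q) • ξ))

/-- The `L^p` norm of a tempered distribution; it is `∞` if the distribution is not (given by)
a function in `L^p`. -/
def distNorm (p : ℝ≥0∞) [Fact (1 ≤ p)] (f : 𝓢'(E N, ℂ)) : ℝ≥0∞ :=
  ⨅ (g : Lp ℂ p (volume : Measure (E N))) (_ : (g : 𝓢'(E N, ℂ)) = f), ‖g‖ₑ

/-- The class `𝓢'_h`: tempered distributions `f` with `‖S_q f‖_{L^∞} → 0` as `q → -∞`. -/
def MemSh (P : LPCouple N) (f : 𝓢'(E N, ℂ)) : Prop :=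
  Tendsto (fun q : ℤ => distNorm ⊤ (cutoff P q f)) atBot (𝓝 0)

/-- `f_L = ∑_{q < 1} Δ_q f`, the limit in `𝓢'` of the sums over `-m < q ≤ 0`
(it exists for every `f` in `𝓢'_h`). -/
def lowPart (P : LPCouple N) (f : 𝓢'(E N, ℂ)) : 𝓢'(E N, ℂ) :=
  limUnder atTop (fun m : ℕ => ∑ q ∈ Finset.Ioc (-(m : ℤ)) 0, block P q f)

/-- `f_H = f - f_L`, which is `∑_{q ≥ 1} Δ_q f` for `f` in `𝓢'_h`. -/
def highPart (P : LPCouple N) (f : 𝓢'(E N, ℂ)) : 𝓢'(E N, ℂ) :=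
  f - lowPart P f

/-- The norm of the homogeneous Besov space with indices `s, 2, 1`. -/
def besovNorm (P : LPCouple N) (s : ℝ) (f : 𝓢'(E N, ℂ)) : ℝ≥0∞ :=
  ∑' q : ℤ, (2 : ℝ≥0∞) ^ ((q : ℝ) * s) * distNorm 2 (block P q f)

/-- Lebesgue measure on the time interval `(0, T)`. -/
abbrev timeMeasure (T : ℝ) : Measure ℝ := volume.restrict (Ioo 0 T)

/-- `u` is in `L^∞(0, T; B)` with `B` the homogeneous Besov space with indices `s, 2, 1`.
As `B` is separable, measurability in time is that of the pairings with test functions. -/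
structure MemLinftyBesov (P : LPCouple N) (T s : ℝ) (u : ℝ → 𝓢'(E N, ℂ)) : Prop where
  meas : ∀ g : 𝓢(E N, ℂ), AEStronglyMeasurable (fun t => u t g) (timeMeasure T)
  mem : ∀ᵐ t ∂timeMeasure T, MemSh P (u t) ∧ besovNorm P s (u t) < ⊤
  bound : eLpNorm (fun t => besovNorm P s (u t)) ⊤ (timeMeasure T) < ⊤

/-- The Chemin–Lerner norm: the time norm is taken before the sum over the dyadic blocks. -/
def clNorm (P : LPCouple N) (T : ℝ) (r : ℝ≥0∞) (s : ℝ) (u : ℝ → 𝓢'(E N, ℂ)) : ℝ≥0∞ :=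
  ∑' q : ℤ, (2 : ℝ≥0∞) ^ ((q : ℝ) * s) *
    eLpNorm (fun t => distNorm 2 (block P q (u t))) r (timeMeasure T)

/-- `u` is in the Chemin–Lerner space with time exponent `r` and Besov indices `s, 2, 1`. -/
structure MemCL (P : LPCouple N) (T : ℝ) (r : ℝ≥0∞) (s : ℝ) (u : ℝ → 𝓢'(E N, ℂ)) : Prop where
  meas : ∀ g : 𝓢(E N, ℂ), AEStronglyMeasurable (fun t => u t g) (timeMeasure T)
  mem : ∀ᵐ t ∂timeMeasure T, MemSh P (u t)
  bound : clNorm P T r s u < ⊤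

/-- The tempered distribution `f` is given by the real function `v`. -/
def IsGivenBy (f : 𝓢'(E N, ℂ)) (v : E N → ℝ) : Prop :=
  ∀ g : 𝓢(E N, ℂ), Integrable (fun x => g x * (v x : ℂ)) ∧ f g = ∫ x, g x * (v x : ℂ)

/-- The norm of `L^∞(0, T; L^∞(ℝ^N))`. -/
def supNorm (T : ℝ) (v : ℝ → E N → ℝ) : ℝ≥0∞ :=
  eLpNorm (fun t => eLpNorm (v t) ⊤ volume) ⊤ (timeMeasure T)

end HybridBesov

end

/-! ### Convolution with dilated Schwartz kernels: Young, Bernstein and smoothness -/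

open MeasureTheory Filter Topology Set
open scoped ENNReal NNReal SchwartzMap ContDiff

noncomputable section

namespace HybridBesov

variable {N : ℕ}

/-! The proof is Meyer's first linearization. For almost every time, `S_n u → u` and `S_{-n} u → 0`
almost everywhere (`IsGivenBy.bounded`), so `K(0) = 0` gives the telescoping sum `K(u) = ∑_j F_j`
with `F_j = K(S_{j+1} u) - K(S_j u)`. The symbols need not be even, so the cut-offs of a real
function may be complex; real parts are taken inside `K`.

The difference quotient `G` of `K`, an average of `K'`, turns each increment into `F_j = G(S_j u,
S_{j+1} u) Δ_j u`. The arguments of `G` are bounded in terms of `‖u‖_∞` and each derivative of them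
costs a factor `2^j`. Hence the `k`-th derivative of `F_j` is bounded in `L²` by `C 2^{jk} ‖Δ_j
u‖_{L²}`, where `C` depends on `u` only through a bound for its supremum. A symbol supported in an
annulus can be divided by `ξ`, so `‖Δ_q F_j‖_{L²} ≤ C 2^{(j-q)k} ‖Δ_j u‖_{L²}` for every `k`
(`eLpNorm_dyadConv_compDiff_le`).

Both parts of the norm are governed by the single weight `2^{qN/2 + min(q,0)s}`. Its exponent
increases in `q` with slope at least `N/2 ≥ 1` and at most `N/2 + s`. For `q ≤ j` the growth of the
weight makes the case `k = 0` sufficient; for `q > j` a large `k` is used. Either way the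
interaction of `q` and `j` decays like `2^{-|q-j|}`, and Schur's test with Minkowski's inequality in
time sums it in `ℓ¹ L^r` (`tsum_eLpNorm_le_of_decay`).

Passing between the weighted sum and the two parts uses that `f_L = S_1 f` on `𝓢'_h`
(`MemSh.lowPart_eq`): `f_L` has only blocks with `q ≤ 1`, `f_H` only blocks with `q ≥ 0`, and on the
overlap the two weights are comparable. Membership of `K(u)` in `𝓢'_h` follows from the same
telescoping by dominated convergence (`memSh_comp`). -/

theorem finrank_E : Module.finrank ℝ (E N) = N := by simp

theorem lintegral_comp_scaled (f : E N → ℝ≥0∞) {l : ℝ} (hl : 0 < l) (x : E N) :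
    ENNReal.ofReal l ^ N * ∫⁻ y, f (l • (x - y)) = ∫⁻ y, f y := by
  rw [lintegral_sub_left_eq_self (fun y => f (l • y)) x]
  have h1 : ∫⁻ y, f (l • y) = ∫⁻ y, f y ∂(Measure.map (fun y : E N => l • y) volume) :=
    (lintegral_map_equiv f (Homeomorph.smulOfNeZero l hl.ne').toMeasurableEquiv).symm
  rw [h1, Measure.map_addHaar_smul _ hl.ne', lintegral_smul_measure, smul_eq_mul, ← mul_assoc,
    finrank_E, ← ENNReal.ofReal_pow hl.le, ← ENNReal.ofReal_mul (by positivity),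
    abs_of_pos (by positivity), mul_inv_cancel₀ (by positivity)]
  simp

theorem lintegral_comp_scaled' (f : E N → ℝ≥0∞) {l : ℝ} (hl : 0 < l) (y : E N) :
    ENNReal.ofReal l ^ N * ∫⁻ x, f (l • (x - y)) = ∫⁻ x, f x := by
  rw [lintegral_sub_right_eq_self (fun x => f (l • x)) y]
  have := lintegral_comp_scaled f hl (0 : E N)
  rw [← this]
  congr 1
  rw [← lintegral_neg_eq_self (fun x : E N => f (l • x))]
  simp

/-- Convolution of nonnegative functions with the kernel `l ^ N * κ (l •)`. -/
def lconv (l : ℝ) (κ V : E N → ℝ≥0∞) (x : E N) : ℝ≥0∞ :=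
  ENNReal.ofReal l ^ N * ∫⁻ y, V y * κ (l • (x - y))

theorem lconv_le_of_ae_le {l : ℝ} (hl : 0 < l) {κ V : E N → ℝ≥0∞} (hκ : Measurable κ) {R : ℝ≥0∞}
    (hV : ∀ᵐ y, V y ≤ R) (x : E N) : lconv l κ V x ≤ R * ∫⁻ y, κ y := by
  unfold lconv
  rw [← lintegral_comp_scaled κ hl x, mul_left_comm]
  gcongr
  rw [← lintegral_const_mul _ (by fun_prop)]
  refine lintegral_mono_ae ?_
  filter_upwards [hV] with y hy
  gcongr

theorem eLpNorm_two_sq {α : Type*} [MeasurableSpace α] (μ : Measure α) {F : Type*} [ENorm F]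
    (f : α → F) : eLpNorm f 2 μ ^ 2 = ∫⁻ x, ‖f x‖ₑ ^ 2 ∂μ := by
  rw [eLpNorm_eq_lintegral_rpow_enorm_toReal (by simp) (by simp)]
  simp only [ENNReal.toReal_ofNat, ENNReal.rpow_ofNat]
  rw [← ENNReal.rpow_natCast, ← ENNReal.rpow_mul]
  simp

theorem le_of_sq_le_sq {a b : ℝ≥0∞} (h : a ^ 2 ≤ b ^ 2) : a ≤ b :=
  (ENNReal.pow_le_pow_left_iff (by simp)).1 h

theorem lintegral_mul_sq_le {α : Type*} [MeasurableSpace α] (μ : Measure α) {f g : α → ℝ≥0∞}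
    (hf : AEMeasurable f μ) (hg : AEMeasurable g μ) :
    (∫⁻ x, f x * g x ∂μ) ^ 2 ≤ (∫⁻ x, f x ^ 2 ∂μ) * ∫⁻ x, g x ^ 2 ∂μ := by
  have h := ENNReal.lintegral_mul_le_Lp_mul_Lq μ Real.HolderConjugate.two_two hf hg
  calc (∫⁻ x, f x * g x ∂μ) ^ 2 ≤ ((∫⁻ (a : α), f a ^ (2 : ℝ) ∂μ) ^ (1 / (2 : ℝ)) *
        (∫⁻ (a : α), g a ^ (2 : ℝ) ∂μ) ^ (1 / (2 : ℝ))) ^ 2 := by gcongr; exact h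
    _ = _ := by
      rw [mul_pow, ← ENNReal.rpow_natCast, ← ENNReal.rpow_natCast, ← ENNReal.rpow_mul,
        ← ENNReal.rpow_mul]
      simp

/-- Cauchy–Schwarz after splitting `g = g^{1/2} g^{1/2}`. This weighted form is what gives Young's
inequality with an `L¹` kernel. -/
theorem lintegral_mul_sq_le' {α : Type*} [MeasurableSpace α] (μ : Measure α) {f g : α → ℝ≥0∞}
    (hf : AEMeasurable f μ) (hg : AEMeasurable g μ) :
    (∫⁻ x, f x * g x ∂μ) ^ 2 ≤ (∫⁻ x, f x ^ 2 * g x ∂μ) * ∫⁻ x, g x ∂μ := by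
  have h := lintegral_mul_sq_le μ (hf.mul (hg.pow_const (1 / 2 : ℝ))) (hg.pow_const (1 / 2 : ℝ))
  have e : ∀ x, (g x ^ (1 / 2 : ℝ)) ^ 2 = g x := fun x => by
    rw [← ENNReal.rpow_natCast, ← ENNReal.rpow_mul]; simp
  simp only [Pi.mul_apply, mul_assoc, mul_pow, ← sq, e] at h
  exact h

theorem measurable_scaled (x : E N) (l : ℝ) : Measurable fun y : E N => l • (x - y) := by fun_prop

theorem ae_measurable_prod {κ V : E N → ℝ≥0∞} (hκ : Measurable κ) (hV : AEMeasurable V) (l : ℝ) :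
    AEMeasurable (fun p : E N × E N => V p.2 * κ (l • (p.1 - p.2)))
      ((volume : Measure (E N)).prod volume) :=
  (hV.comp_snd).mul (hκ.comp (by fun_prop)).aemeasurable

/-- Young's inequality `L¹ * L² ⊆ L²`. -/
theorem eLpNorm_lconv_le {l : ℝ} (hl : 0 < l) {κ V : E N → ℝ≥0∞} (hκ : Measurable κ)
    (hV : AEMeasurable V) : eLpNorm (lconv l κ V) 2 volume ≤ (∫⁻ y, κ y) * eLpNorm V 2 volume := by
  apply le_of_sq_le_sq
  rw [mul_pow, eLpNorm_two_sq, eLpNorm_two_sq]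
  simp only [enorm_eq_self]
  set A := ∫⁻ y, κ y with hA
  have h1 : ∀ x, lconv l κ V x ^ 2 ≤
      A * (ENNReal.ofReal l ^ N * ∫⁻ y, V y ^ 2 * κ (l • (x - y))) := by
    intro x
    have hm : AEMeasurable (fun y => κ (l • (x - y))) :=
      (hκ.comp (measurable_scaled x l)).aemeasurable
    have h := lintegral_mul_sq_le' volume hV hm
    unfold lconv
    rw [mul_pow, hA, ← lintegral_comp_scaled κ hl x]
    calc _ ≤ (ENNReal.ofReal l ^ N) ^ 2 * ((∫⁻ y, V y ^ 2 * κ (l • (x - y))) *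
            ∫⁻ y, κ (l • (x - y))) := by gcongr
      _ = _ := by ring
  calc ∫⁻ x, lconv l κ V x ^ 2
      ≤ ∫⁻ x, A * (ENNReal.ofReal l ^ N * ∫⁻ y, V y ^ 2 * κ (l • (x - y))) := lintegral_mono h1
    _ = A * (ENNReal.ofReal l ^ N * ∫⁻ x, ∫⁻ y, V y ^ 2 * κ (l • (x - y))) := by
      have hm := ae_measurable_prod hκ (hV.pow_const 2) l
      rw [lintegral_const_mul'' _ (hm.lintegral_prod_right'.const_mul _),
        lintegral_const_mul'' _ hm.lintegral_prod_right']
    _ = A * (ENNReal.ofReal l ^ N * ∫⁻ y, V y ^ 2 * ∫⁻ x, κ (l • (x - y))) := by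
      rw [lintegral_lintegral_swap (ae_measurable_prod hκ (hV.pow_const 2) l)]
      congr 2
      refine lintegral_congr fun y => ?_
      exact lintegral_const_mul _ (hκ.comp (by fun_prop))
    _ = A * ∫⁻ y, V y ^ 2 * A := by
      rw [← lintegral_const_mul' _ _ (by finiteness)]
      congr 1
      refine lintegral_congr fun y => ?_
      rw [hA, ← lintegral_comp_scaled' κ hl y]
      ring
    _ = _ := by
      rw [lintegral_mul_const'' _ (hV.pow_const 2)]
      ring

/-- Bernstein's inequality `L² * L² ⊆ L^∞` with the scaling factor `l ^ (N / 2)`. -/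
theorem lconv_le_of_eLpNorm_two {l : ℝ} (hl : 0 < l) {κ V : E N → ℝ≥0∞} (hκ : Measurable κ)
    (hV : AEMeasurable V) (x : E N) : lconv l κ V x ≤
      ENNReal.ofReal l ^ ((N : ℝ) / 2) * eLpNorm κ 2 volume * eLpNorm V 2 volume := by
  apply le_of_sq_le_sq
  have hm : AEMeasurable (fun y => κ (l • (x - y))) :=
    (hκ.comp (measurable_scaled x l)).aemeasurable
  have h := lintegral_mul_sq_le volume hV hm
  unfold lconv
  rw [mul_pow, mul_pow, mul_pow, eLpNorm_two_sq, eLpNorm_two_sq]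
  simp only [enorm_eq_self]
  rw [← lintegral_comp_scaled (fun y => κ y ^ 2) hl x,
    ← ENNReal.rpow_natCast (ENNReal.ofReal l ^ ((N : ℝ) / 2)) 2, ← ENNReal.rpow_mul]
  calc _ ≤ (ENNReal.ofReal l ^ N) ^ 2 * ((∫⁻ y, V y ^ 2) * ∫⁻ y, κ (l • (x - y)) ^ 2) := by gcongr
    _ = _ := by
      simp only [Nat.cast_ofNat, ne_eq, OfNat.ofNat_ne_zero, not_false_eq_true, div_mul_cancel₀,
        ENNReal.rpow_natCast]
      ring

/-- The weight `(1 + |y|) ^ (-(N + 1))`. -/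
def wt (y : E N) : ℝ := ((1 + ‖y‖) ^ (N + 1))⁻¹

theorem wt_pos (y : E N) : 0 < wt y := by unfold wt; positivity

theorem wt_le_one (y : E N) : wt y ≤ 1 := by
  unfold wt
  exact inv_le_one_of_one_le₀ (one_le_pow₀ (by linarith [norm_nonneg y]))

theorem continuous_wt : Continuous (wt (N := N)) := by
  unfold wt
  refine Continuous.inv₀ (by fun_prop) fun y => by positivity

theorem integrable_wt : Integrable (wt (N := N)) := by
  have h := integrable_one_add_norm (E := E N) (μ := volume) (r := (N : ℝ) + 1)
    (by rw [finrank_E]; linarith)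
  refine h.congr (Eventually.of_forall fun y => ?_)
  simp only [wt]
  rw [Real.rpow_neg (by positivity)]
  norm_cast

/-- Functions that are integrable against the weight `(1 + |y|) ^ (-(N + 1))`. -/
structure Tame (V : E N → ℂ) : Prop where
  meas : AEStronglyMeasurable V volume
  int : Integrable (fun y => wt y * ‖V y‖)

theorem Tame.of_bound {V : E N → ℂ} (hV : AEStronglyMeasurable V volume) {R : ℝ}
    (h : ∀ᵐ y, ‖V y‖ ≤ R) : Tame V := by
  refine ⟨hV, (integrable_wt.mul_const R).mono'
    (continuous_wt.aestronglyMeasurable.mul hV.norm) ?_⟩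
  filter_upwards [h] with y hy
  rw [norm_mul, norm_norm, Real.norm_of_nonneg (wt_pos y).le]
  exact mul_le_mul_of_nonneg_left hy (wt_pos y).le

theorem Tame.of_memLp_two {V : E N → ℂ} (hV : MemLp V 2 volume) : Tame V := by
  refine ⟨hV.1, (integrable_wt.add hV.norm.integrable_sq).mono'
    (continuous_wt.aestronglyMeasurable.mul hV.1.norm) ?_⟩
  filter_upwards with y
  rw [norm_mul, norm_norm, Real.norm_of_nonneg (wt_pos y).le, Pi.add_apply]
  have := wt_pos y
  have := wt_le_one y
  -- The arithmetic–geometric inequality, with `wt² ≤ wt` because `wt ≤ 1`.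
  nlinarith [sq_nonneg (wt y - ‖V y‖), norm_nonneg (V y)]

variable {F : Type*} [NormedAddCommGroup F] [NormedSpace ℝ F]

theorem schwartz_le_wt (h : 𝓢(E N, F)) : ∃ C : ℝ, 0 ≤ C ∧ ∀ x, ‖h x‖ ≤ C * wt x := by
  refine ⟨2 ^ (N + 1) * ((Finset.Iic (N + 1, 0)).sup fun m => SchwartzMap.seminorm ℝ m.1 m.2) h,
    by positivity, fun x => ?_⟩
  have := SchwartzMap.one_add_le_sup_seminorm_apply (𝕜 := ℝ) (m := (N + 1, 0)) (k := N + 1)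
    (n := 0) le_rfl le_rfl h x
  rw [norm_iteratedFDeriv_zero, mul_comm] at this
  unfold wt
  rw [← div_eq_mul_inv, le_div_iff₀ (by positivity)]
  exact this

/-- Peetre's inequality `1 + |y| ≤ (1 + |x|)(1 + |x - y|)`; the dilation costs a further factor `1 +
l⁻¹`. -/
theorem wt_scaled_le {l : ℝ} (hl : 0 < l) (x y : E N) :
    wt (l • (x - y)) ≤ (1 + ‖x‖) ^ (N + 1) * (1 + l⁻¹) ^ (N + 1) * wt y := by
  unfold wt
  rw [← mul_pow, ← div_eq_mul_inv, le_div_iff₀ (by positivity), inv_mul_le_iff₀ (by positivity),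
    ← mul_pow]
  refine pow_le_pow_left₀ (by positivity) ?_ _
  rw [norm_smul, Real.norm_of_nonneg hl.le]
  have h1 : ‖y‖ ≤ ‖x‖ + ‖x - y‖ := by
    have := norm_sub_le x (x - y); simpa using this
  have h2 : 1 + ‖x - y‖ ≤ (1 + l * ‖x - y‖) * (1 + l⁻¹) := by
    have : l * ‖x - y‖ * l⁻¹ = ‖x - y‖ := by field_simp
    nlinarith [norm_nonneg (x - y), inv_pos.2 hl, mul_nonneg hl.le (norm_nonneg (x - y))]
  calc 1 + ‖y‖ ≤ (1 + ‖x‖) * (1 + ‖x - y‖) := by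
        nlinarith [norm_nonneg x, norm_nonneg (x - y), mul_nonneg (norm_nonneg x)
          (norm_nonneg (x - y))]
    _ ≤ (1 + ‖x‖) * ((1 + l * ‖x - y‖) * (1 + l⁻¹)) := by gcongr
    _ = _ := by ring

/-- Uniformity over a ball in `x` provides the dominating function for differentiating convolutions
under the integral sign. -/
theorem schwartz_scaled_le (h : 𝓢(E N, F)) {l : ℝ} (hl : 0 < l) (x₀ : E N) :
    ∃ C : ℝ, 0 ≤ C ∧ ∀ x ∈ Metric.ball x₀ 1, ∀ y, ‖h (l • (x - y))‖ ≤ C * wt y := by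
  obtain ⟨C, hC, hb⟩ := schwartz_le_wt h
  refine ⟨C * ((1 + (‖x₀‖ + 1)) ^ (N + 1) * (1 + l⁻¹) ^ (N + 1)), by positivity, fun x hx y => ?_⟩
  have h1 : ‖x‖ ≤ ‖x₀‖ + 1 := by
    have : ‖x‖ ≤ ‖x₀‖ + ‖x - x₀‖ := by simpa using norm_add_le x₀ (x - x₀)
    rw [mem_ball_iff_norm] at hx
    linarith
  calc ‖h (l • (x - y))‖ ≤ C * wt (l • (x - y)) := hb _
    _ ≤ C * ((1 + ‖x‖) ^ (N + 1) * (1 + l⁻¹) ^ (N + 1) * wt y) := by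
      gcongr; exact wt_scaled_le hl x y
    _ ≤ C * ((1 + (‖x₀‖ + 1)) ^ (N + 1) * (1 + l⁻¹) ^ (N + 1) * wt y) := by
      have := wt_pos y
      gcongr
    _ = _ := by ring

/-- Integrable convolution kernels. -/
structure GoodKernel (κ : E N → ℝ≥0∞) : Prop where
  meas : Measurable κ
  one : ∫⁻ y, κ y < ⊤

theorem goodKernel_schwartz (h : 𝓢(E N, F)) : GoodKernel fun y => ‖h y‖ₑ where
  meas := h.continuous.enorm.measurable
  one := h.integrable.2

variable [NormedSpace ℂ F]

/-- Convolution with the kernel `l ^ N * h (l •)`. -/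
def scaledConv (l : ℝ) (h : E N → F) (V : E N → ℂ) (x : E N) : F :=
  (l ^ N : ℝ) • ∫ y, V y • h (l • (x - y))

theorem integrable_scaledConv (h : 𝓢(E N, F)) {l : ℝ} (hl : 0 < l) {V : E N → ℂ} (hV : Tame V)
    (x : E N) : Integrable fun y => V y • h (l • (x - y)) := by
  obtain ⟨C, hC, hb⟩ := schwartz_scaled_le h hl x
  refine (hV.int.const_mul C).mono' (hV.meas.smul
    (h.continuous.comp (by fun_prop)).aestronglyMeasurable) (Eventually.of_forall fun y => ?_)
  rw [norm_smul]
  calc ‖V y‖ * ‖h (l • (x - y))‖ ≤ ‖V y‖ * (C * wt y) := by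
        gcongr; exact hb x (Metric.mem_ball_self one_pos) y
    _ = _ := by ring

theorem enorm_scaledConv_le {l : ℝ} (hl : 0 < l) (h : E N → F) (V : E N → ℂ) (x : E N) :
    ‖scaledConv l h V x‖ₑ ≤ lconv l (fun y => ‖h y‖ₑ) (fun y => ‖V y‖ₑ) x := by
  unfold scaledConv lconv
  rw [enorm_smul, Real.enorm_of_nonneg (by positivity), ENNReal.ofReal_pow hl.le]
  gcongr
  refine (enorm_integral_le_lintegral_enorm _).trans (le_of_eq ?_)
  simp only [enorm_smul]

/-- The derivative falls on the kernel and releases one factor `l`. The result is again a dilated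
convolution, with a kernel valued in linear maps; vector-valued kernels are allowed so that this can
be iterated. -/
theorem hasFDerivAt_scaledConv [SMulCommClass ℝ ℂ F] (h : 𝓢(E N, F)) {l : ℝ} (hl : 0 < l)
    {V : E N → ℂ} (hV : Tame V) (x : E N) :
    HasFDerivAt (scaledConv l h V)
      (l • scaledConv l (SchwartzMap.fderivCLM ℝ (E N) F h) V x) x := by
  obtain ⟨C, hC, hb⟩ := schwartz_scaled_le (SchwartzMap.fderivCLM ℝ (E N) F h) hl x
  have key := hasFDerivAt_integral_of_dominated_of_fderiv_le (𝕜 := ℝ) (μ := (volume : Measure (E N)))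
    (F := fun x y => V y • h (l • (x - y)))
    (F' := fun x y => V y • l • SchwartzMap.fderivCLM ℝ (E N) F h (l • (x - y)))
    (x₀ := x) (s := Metric.ball x 1) (bound := fun y => l * C * (wt y * ‖V y‖))
    (Metric.ball_mem_nhds x one_pos)
    (Eventually.of_forall fun x => (integrable_scaledConv h hl hV x).aestronglyMeasurable)
    (integrable_scaledConv h hl hV x)
    (hV.meas.smul ((((SchwartzMap.fderivCLM ℝ (E N) F h).continuous.comp
      (by fun_prop)).const_smul l).aestronglyMeasurable))
    (Eventually.of_forall fun y z hz => by
      rw [norm_smul, norm_smul, Real.norm_of_nonneg hl.le]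
      calc _ ≤ ‖V y‖ * (l * (C * wt y)) := by gcongr; exact hb z hz y
        _ = _ := by ring)
    (hV.int.const_mul _)
    (Eventually.of_forall fun y z _ => by
      refine HasFDerivAt.const_smul ?_ (V y)
      have h1 : HasFDerivAt (fun z : E N => l • (z - y)) (l • ContinuousLinearMap.id ℝ (E N)) z :=
        ((hasFDerivAt_id z).sub_const y).const_smul l
      have h2 := (SchwartzMap.hasFDerivAt h (l • (z - y))).comp z h1
      refine h2.congr_fderiv ?_
      ext w
      simp)
  have := key.const_smul (l ^ N : ℝ)
  refine this.congr_fderiv ?_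
  unfold scaledConv
  rw [smul_comm l]
  congr 1
  rw [← integral_smul]
  congr 1
  ext1 y
  rw [smul_comm]

theorem contDiff_scaledConv {F : Type*} [NormedAddCommGroup F] [NormedSpace ℝ F] [NormedSpace ℂ F]
    [SMulCommClass ℝ ℂ F] {l : ℝ} (hl : 0 < l) {V : E N → ℂ} (hV : Tame V) (k : ℕ)
    (h : 𝓢(E N, F)) : ContDiff ℝ k (scaledConv l h V) := by
  induction k generalizing F with
  | zero =>
    rw [Nat.cast_zero, contDiff_zero, continuous_iff_continuousAt]
    exact fun x => (hasFDerivAt_scaledConv h hl hV x).continuousAt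
  | succ k ih =>
    rw [Nat.cast_succ, contDiff_succ_iff_hasFDerivAt]
    exact ⟨_, (ih (SchwartzMap.fderivCLM ℝ (E N) F h)).const_smul l,
      hasFDerivAt_scaledConv h hl hV⟩

theorem continuous_scaledConv [SMulCommClass ℝ ℂ F] {l : ℝ} (hl : 0 < l) {V : E N → ℂ}
    (hV : Tame V) (h : 𝓢(E N, F)) : Continuous (scaledConv l h V) :=
  (contDiff_scaledConv hl hV 0 h).continuous

/-- The point is that `κ` is chosen before `l`: it is the norm of the `k`-fold derivative of `h`,
and all dependence on the scale sits in `l^k` and in `lconv`. -/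
theorem enorm_iteratedFDeriv_scaledConv_le {F : Type*} [NormedAddCommGroup F] [NormedSpace ℝ F]
    [NormedSpace ℂ F] [SMulCommClass ℝ ℂ F] (k : ℕ) (h : 𝓢(E N, F)) :
    ∃ κ : E N → ℝ≥0∞, GoodKernel κ ∧ ∀ (l : ℝ), 0 < l → ∀ V : E N → ℂ, Tame V → ∀ x,
      ‖iteratedFDeriv ℝ k (scaledConv l h V) x‖ₑ ≤
        ENNReal.ofReal l ^ k * lconv l κ (fun y => ‖V y‖ₑ) x := by
  induction k generalizing F with
  | zero =>
    refine ⟨_, goodKernel_schwartz h, fun l hl V _ x => ?_⟩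
    rw [← ofReal_norm, norm_iteratedFDeriv_zero, ofReal_norm, pow_zero, one_mul]
    exact enorm_scaledConv_le hl h V x
  | succ k ih =>
    obtain ⟨κ, hκ, hb⟩ := ih (SchwartzMap.fderivCLM ℝ (E N) F h)
    refine ⟨κ, hκ, fun l hl V hV x => ?_⟩
    have e : fderiv ℝ (scaledConv l h V) =
        l • scaledConv l (SchwartzMap.fderivCLM ℝ (E N) F h) V :=
      funext fun x => (hasFDerivAt_scaledConv h hl hV x).fderiv
    rw [← ofReal_norm, ← norm_iteratedFDeriv_fderiv, e,
      iteratedFDeriv_const_smul_apply (contDiff_scaledConv hl hV k _).contDiffAt, ofReal_norm,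
      enorm_smul, Real.enorm_of_nonneg hl.le, pow_succ', mul_assoc]
    gcongr
    exact hb l hl V hV x

end HybridBesov

end

/-! ### Tempered distributions with a density, and Fourier multipliers as convolutions -/

open MeasureTheory Filter Topology Set
open scoped ENNReal NNReal SchwartzMap ContDiff

noncomputable section

namespace HybridBesov

open scoped FourierTransform

variable {N : ℕ}

theorem schwartz_mul_le_wt (h : 𝓢(E N, ℂ)) :
    ∃ C : ℝ, 0 ≤ C ∧ ∀ x, (1 + ‖x‖) ^ (N + 1) * ‖h x‖ ≤ C * wt x := by
  refine ⟨2 ^ (2 * N + 2) * ((Finset.Iic (2 * N + 2, 0)).sup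
    fun m => SchwartzMap.seminorm ℝ m.1 m.2) h, by positivity, fun x => ?_⟩
  have := SchwartzMap.one_add_le_sup_seminorm_apply (𝕜 := ℝ) (m := (2 * N + 2, 0))
    (k := 2 * N + 2) (n := 0) le_rfl le_rfl h x
  rw [norm_iteratedFDeriv_zero] at this
  unfold wt
  rw [← div_eq_mul_inv, le_div_iff₀ (by positivity)]
  calc _ = (1 + ‖x‖) ^ (2 * N + 2) * ‖h x‖ := by ring
    _ ≤ _ := this

theorem integrable_schwartz_mul (g : 𝓢(E N, ℂ)) {V : E N → ℂ} (hV : Tame V) :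
    Integrable fun x => g x * V x := by
  obtain ⟨C, hC, hb⟩ := schwartz_le_wt g
  refine (hV.int.const_mul C).mono' (g.continuous.aestronglyMeasurable.mul hV.meas)
    (Eventually.of_forall fun x => ?_)
  rw [norm_mul, ← mul_assoc]
  gcongr
  exact hb x

/-- The tempered distribution `f` is given by the function `V`. -/
structure HasDensity (f : 𝓢'(E N, ℂ)) (V : E N → ℂ) : Prop where
  tame : Tame V
  eq : ∀ g : 𝓢(E N, ℂ), f g = ∫ x, g x * V x

/-- The Fourier multiplier with the dilated symbol `σ (l⁻¹ •)`. -/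
def dilatedMultiplier (l : ℝ) (σ : 𝓢(E N, ℂ)) : 𝓢'(E N, ℂ) →L[ℂ] 𝓢'(E N, ℂ) :=
  TemperedDistribution.fourierMultiplierCLM ℂ (fun ξ : E N => σ (l⁻¹ • ξ))

theorem hasTemperateGrowth_dilated (l : ℝ) (σ : 𝓢(E N, ℂ)) :
    Function.HasTemperateGrowth fun ξ : E N => σ (l⁻¹ • ξ) := by
  have := σ.hasTemperateGrowth
  fun_prop

/-- The convolution kernel of the Fourier multiplier with symbol `σ`. -/
def kernel (σ : 𝓢(E N, ℂ)) : 𝓢(E N, ℂ) := 𝓕⁻ σ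

theorem dilated_kernel (σ : 𝓢(E N, ℂ)) {l : ℝ} (hl : 0 < l) (z : E N) :
    ∫ ξ, Complex.exp ((2 * Real.pi * inner ℝ ξ z : ℝ) * Complex.I) * σ (l⁻¹ • ξ) =
      (l ^ N : ℝ) • kernel σ (l • z) := by
  have h := Measure.integral_comp_smul (volume : Measure (E N))
    (fun ξ : E N => Complex.exp ((2 * Real.pi * inner ℝ ξ (l • z) : ℝ) * Complex.I) * σ ξ) l⁻¹
  have e : kernel σ (l • z) =
      ∫ ξ, Complex.exp ((2 * Real.pi * inner ℝ ξ (l • z) : ℝ) * Complex.I) * σ ξ := by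
    rw [kernel, SchwartzMap.fourierInv_coe, Real.fourierInv_eq']
    simp only [smul_eq_mul]
  rw [e]
  rw [finrank_E, inv_pow, inv_inv, abs_of_pos (by positivity)] at h
  rw [← h]
  congr 1
  ext ξ
  rw [real_inner_smul_left, real_inner_smul_right]
  congr 4
  field_simp

/-- The left side is the transposed multiplier acting on a test function. Since `σ` and `g` are both
integrable, Fubini applies, and the inner integral over `ξ` is the dilated kernel. -/
theorem fourier_smul_fourierInv (σ g : 𝓢(E N, ℂ)) {l : ℝ} (hl : 0 < l) (y : E N) :
    𝓕 (SchwartzMap.smulLeftCLM ℂ (fun ξ : E N => σ (l⁻¹ • ξ)) (𝓕⁻ g)) y =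
      (l ^ N : ℝ) • ∫ x, g x * kernel σ (l • (x - y)) := by
  rw [SchwartzMap.fourier_coe, Real.fourier_eq']
  have hσ : Integrable fun ξ : E N => σ (l⁻¹ • ξ) :=
    (integrable_comp_smul_iff volume σ (inv_ne_zero hl.ne')).2 σ.integrable
  have hI : Integrable (Function.uncurry fun ξ x : E N =>
      Complex.exp ((2 * Real.pi * inner ℝ ξ (x - y) : ℝ) * Complex.I) * (σ (l⁻¹ • ξ) * g x))
      (volume.prod volume) := by
    refine (Integrable.mul_prod hσ g.integrable).norm.mono' ?_ ?_
    · refine Continuous.aestronglyMeasurable ?_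
      have := σ.continuous
      have := g.continuous
      simp only [Function.uncurry_def]
      fun_prop
    · refine Eventually.of_forall fun p => ?_
      simp only [Function.uncurry_def]
      rw [norm_mul, Complex.norm_exp_ofReal_mul_I, one_mul]
  calc _ = ∫ ξ, ∫ x, Complex.exp ((2 * Real.pi * inner ℝ ξ (x - y) : ℝ) * Complex.I) *
          (σ (l⁻¹ • ξ) * g x) := by
        congr 1
        ext ξ
        rw [SchwartzMap.smulLeftCLM_apply_apply (hasTemperateGrowth_dilated l σ),
          SchwartzMap.fourierInv_coe, Real.fourierInv_eq', smul_eq_mul, smul_eq_mul, ← mul_assoc,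
          ← integral_const_mul]
        congr 1
        ext x
        rw [smul_eq_mul, inner_sub_right, real_inner_comm x ξ]
        have : Complex.exp ((2 * Real.pi * (inner ℝ x ξ - inner ℝ ξ y) : ℝ) * Complex.I) =
            Complex.exp ((-2 * Real.pi * inner ℝ ξ y : ℝ) * Complex.I) *
              Complex.exp ((2 * Real.pi * inner ℝ x ξ : ℝ) * Complex.I) := by
          rw [← Complex.exp_add]
          congr 1
          push_cast
          ring
        rw [this]
        ring
    _ = ∫ x, ∫ ξ, Complex.exp ((2 * Real.pi * inner ℝ ξ (x - y) : ℝ) * Complex.I) *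
          (σ (l⁻¹ • ξ) * g x) := integral_integral_swap hI
    _ = ∫ x, (l ^ N : ℝ) • (g x * kernel σ (l • (x - y))) := by
        congr 1
        ext x
        simp only [← mul_assoc]
        rw [integral_mul_const, dilated_kernel σ hl, mul_comm, mul_smul_comm]
    _ = _ := integral_smul _ _

/-- By duality the multiplier falls on the test function, where it is a convolution; Fubini then
moves the kernel onto `V`. The polynomial growth in `x` from Peetre's inequality is absorbed by the
decay of `g`. -/
theorem HasDensity.dilatedMultiplier {f : 𝓢'(E N, ℂ)} {V : E N → ℂ} (hf : HasDensity f V)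
    (σ : 𝓢(E N, ℂ)) {l : ℝ} (hl : 0 < l) (ht : Tame (scaledConv l (kernel σ) V)) :
    HasDensity (dilatedMultiplier l σ f) (scaledConv l (kernel σ) V) := by
  refine ⟨ht, fun g => ?_⟩
  obtain ⟨C, hC, hb⟩ := schwartz_le_wt (kernel σ)
  obtain ⟨D, hD, hg⟩ := schwartz_mul_le_wt g
  have hI : Integrable (Function.uncurry fun x y : E N => g x * (kernel σ (l • (x - y)) * V y))
      (volume.prod volume) := by
    refine (Integrable.mul_prod (integrable_wt.const_mul (C * (1 + l⁻¹) ^ (N + 1) * D))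
      hf.tame.int).mono' ?_ ?_
    · refine (g.continuous.comp continuous_fst).aestronglyMeasurable.mul
        (((kernel σ).continuous.comp (by fun_prop)).aestronglyMeasurable.mul hf.tame.meas.comp_snd)
    · refine Eventually.of_forall fun p => ?_
      simp only [Function.uncurry_def]
      rw [norm_mul, norm_mul]
      have h1 := hb (l • (p.1 - p.2))
      have h2 := wt_scaled_le hl p.1 p.2
      have h3 := hg p.1
      have := wt_pos p.2
      calc ‖g p.1‖ * (‖kernel σ (l • (p.1 - p.2))‖ * ‖V p.2‖)
          ≤ ‖g p.1‖ * (C * ((1 + ‖p.1‖) ^ (N + 1) * (1 + l⁻¹) ^ (N + 1) * wt p.2) * ‖V p.2‖) := by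
            gcongr
            exact h1.trans (by gcongr)
        _ = C * (1 + l⁻¹) ^ (N + 1) * ((1 + ‖p.1‖) ^ (N + 1) * ‖g p.1‖) *
              (wt p.2 * ‖V p.2‖) := by ring
        _ ≤ C * (1 + l⁻¹) ^ (N + 1) * (D * wt p.1) * (wt p.2 * ‖V p.2‖) := by gcongr
        _ = _ := by ring
  unfold HybridBesov.dilatedMultiplier
  rw [TemperedDistribution.fourierMultiplierCLM_apply_apply, hf.eq]
  calc _ = ∫ y, (l ^ N : ℝ) • ∫ x, g x * (kernel σ (l • (x - y)) * V y) := by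
        congr 1
        ext y
        rw [fourier_smul_fourierInv σ g hl y, smul_mul_assoc, ← integral_mul_const]
        simp only [mul_assoc]
    _ = (l ^ N : ℝ) • ∫ x, ∫ y, g x * (kernel σ (l • (x - y)) * V y) := by
        rw [integral_smul, integral_integral_swap hI]
    _ = ∫ x, (l ^ N : ℝ) • ∫ y, g x * (kernel σ (l • (x - y)) * V y) := (integral_smul _ _).symm
    _ = _ := by
        congr 1
        ext x
        unfold scaledConv
        rw [mul_smul_comm, integral_const_mul]
        simp only [smul_eq_mul, mul_comm]

theorem Tame.locallyIntegrable {V : E N → ℂ} (hV : Tame V) : LocallyIntegrable V volume := by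
  rw [locallyIntegrable_iff]
  intro k hk
  have h1 : IntegrableOn (fun y => wt y * ‖V y‖) k := hV.int.integrableOn
  have h2 : IntegrableOn (fun y => (wt y)⁻¹ * (wt y * ‖V y‖)) k :=
    h1.continuousOn_mul (continuous_wt.inv₀ fun y => (wt_pos y).ne').continuousOn hk
  rw [IntegrableOn, ← integrable_norm_iff hV.meas.restrict]
  refine h2.congr (Eventually.of_forall fun y => ?_)
  simp only
  rw [← mul_assoc, inv_mul_cancel₀ (wt_pos y).ne', one_mul]

theorem ae_eq_of_schwartz_integral_eq {V W : E N → ℂ} (hV : LocallyIntegrable V volume)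
    (hW : LocallyIntegrable W volume)
    (h : ∀ g : 𝓢(E N, ℂ), ∫ x, g x * V x = ∫ x, g x * W x) : V =ᵐ[volume] W := by
  refine ae_eq_of_integral_contDiff_smul_eq hV hW fun g g_smooth g_cpt => ?_
  have hg₁ : HasCompactSupport (Complex.ofRealCLM ∘ g) := g_cpt.comp_left rfl
  have hg₂ : ContDiff ℝ ∞ (Complex.ofRealCLM ∘ g) := by fun_prop
  simpa using h (hg₁.toSchwartzMap hg₂)

theorem HasDensity.ae_eq {f : 𝓢'(E N, ℂ)} {V W : E N → ℂ} (hV : HasDensity f V)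
    (hW : HasDensity f W) : V =ᵐ[volume] W :=
  ae_eq_of_schwartz_integral_eq hV.tame.locallyIntegrable hW.tame.locallyIntegrable
    fun g => by rw [← hV.eq, ← hW.eq]

theorem Tame.of_memLp_top {V : E N → ℂ} (hV : MemLp V ⊤ volume) : Tame V := by
  refine Tame.of_bound hV.1 (R := (eLpNorm V ⊤ volume).toReal) ?_
  rw [eLpNorm_exponent_top]
  filter_upwards [ae_le_eLpNormEssSup (f := V) (μ := volume)] with y hy
  rw [← toReal_enorm]
  have := hV.2
  rw [eLpNorm_exponent_top] at this
  exact ENNReal.toReal_mono this.ne hy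

/-- A density is unique up to null sets, so the infimum runs over at most one element. The case
where `V` is not in `L^p` is included: both sides are then infinite. -/
theorem distNorm_eq {p : ℝ≥0∞} [Fact (1 ≤ p)] {f : 𝓢'(E N, ℂ)} {V : E N → ℂ}
    (hf : HasDensity f V) : distNorm p f = eLpNorm V p volume := by
  apply le_antisymm
  · by_cases hV : eLpNorm V p volume = ⊤
    · rw [hV]; exact le_top
    · have hm : MemLp V p volume := ⟨hf.tame.meas, lt_top_iff_ne_top.2 hV⟩
      refine (iInf₂_le hm.toLp ?_).trans (Lp.enorm_toLp hm).le
      ext g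
      rw [Lp.toTemperedDistribution_apply, hf.eq]
      refine integral_congr_ae ?_
      filter_upwards [hm.coeFn_toLp] with x hx
      rw [hx, smul_eq_mul]
  · refine le_iInf₂ fun g hg => ?_
    have : V =ᵐ[volume] g := by
      refine ae_eq_of_schwartz_integral_eq hf.tame.locallyIntegrable
        ((Lp.memLp g).locallyIntegrable Fact.out) fun φ => ?_
      rw [← hf.eq, ← hg, Lp.toTemperedDistribution_apply]
      simp only [smul_eq_mul]
    rw [Lp.enorm_def, eLpNorm_congr_ae this]

theorem exists_density_of_distNorm_lt_top {p : ℝ≥0∞} [Fact (1 ≤ p)] {f : 𝓢'(E N, ℂ)}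
    (ht : ∀ V : E N → ℂ, MemLp V p volume → Tame V) (hf : distNorm p f < ⊤) :
    ∃ V, HasDensity f V ∧ MemLp V p volume := by
  unfold distNorm at hf
  simp only [iInf_lt_iff] at hf
  obtain ⟨g, hg, -⟩ := hf
  refine ⟨g, ⟨ht g (Lp.memLp g), fun φ => ?_⟩, Lp.memLp g⟩
  rw [← hg, Lp.toTemperedDistribution_apply]
  simp only [smul_eq_mul]

end HybridBesov

end

/-! ### The Littlewood–Paley decomposition: supports, telescoping, convergence in `𝓢'` -/

open MeasureTheory Filter Topology Set
open scoped ENNReal NNReal SchwartzMap ContDiff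

noncomputable section

namespace HybridBesov

open scoped FourierTransform

variable {N : ℕ}

/-- At order zero this is the mean value inequality from `σ 0 = 1`, which costs the growth `|x|`. At
order `i ≥ 1` the chain rule gives `ε^i ≤ ε`. -/
theorem norm_iteratedFDeriv_dilated_sub_one_le (σ : 𝓢(E N, ℂ)) (h0 : σ 0 = 1) (n : ℕ) :
    ∃ M : ℝ, 0 ≤ M ∧ ∀ ε : ℝ, 0 < ε → ε ≤ 1 → ∀ i ≤ n, ∀ x,
      ‖iteratedFDeriv ℝ i (fun y => σ (ε • y) - 1) x‖ ≤ ε * (M * (1 + ‖x‖)) := by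
  set m : ℕ → ℝ := fun i => SchwartzMap.seminorm ℝ 0 i σ with hm
  have hm0 : ∀ i, 0 ≤ m i := fun i => apply_nonneg _ _
  have hle : ∀ i ≤ n + 1, m i ≤ ∑ i ∈ Finset.range (n + 2), m i := fun i hi =>
    Finset.single_le_sum (fun j _ => hm0 j) (Finset.mem_range.2 (by omega))
  have hM0 : 0 ≤ ∑ i ∈ Finset.range (n + 2), m i := Finset.sum_nonneg fun i _ => hm0 i
  refine ⟨∑ i ∈ Finset.range (n + 2), m i, hM0, fun ε hε hε1 i hi x => ?_⟩
  rcases i with _ | j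
  · rw [norm_iteratedFDeriv_zero, ← h0]
    have h1 := Convex.norm_image_sub_le_of_norm_fderiv_le (𝕜 := ℝ) (f := σ) (C := m 1)
      (s := univ) (x := 0) (y := ε • x) (fun y _ => σ.differentiableAt)
      (fun y _ => by
        rw [← norm_iteratedFDeriv_one]
        exact SchwartzMap.norm_iteratedFDeriv_le_seminorm ℝ σ 1 y) convex_univ trivial trivial
    rw [sub_zero, norm_smul, Real.norm_of_nonneg hε.le] at h1
    calc _ ≤ _ := h1
      _ = ε * (m 1 * ‖x‖) := by ring
      _ ≤ _ := by
        have := hle 1 (by omega)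
        have := norm_nonneg x
        gcongr
        linarith
  · have e : fderiv ℝ (fun y => σ (ε • y) - 1) = fderiv ℝ (fun y => σ (ε • y)) := by
      ext1 y; rw [fderiv_sub_const]
    rw [← norm_iteratedFDeriv_fderiv, e, norm_iteratedFDeriv_fderiv,
      iteratedFDeriv_comp_const_smul _ (σ.smooth (j + 1)), norm_smul, norm_pow,
      Real.norm_of_nonneg hε.le]
    have h1 : ‖iteratedFDeriv ℝ (j + 1) σ (ε • x)‖ ≤ m (j + 1) :=
      SchwartzMap.norm_iteratedFDeriv_le_seminorm ℝ σ _ _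
    have h2 := hle (j + 1) (by omega)
    have h3 : ε ^ (j + 1) ≤ ε := by
      rw [pow_succ]
      exact mul_le_of_le_one_left hε.le (pow_le_one₀ hε.le hε1)
    have := norm_nonneg x
    have h4 : m (j + 1) ≤ (∑ i ∈ Finset.range (n + 2), m i) * (1 + ‖x‖) := by nlinarith
    exact mul_le_mul h3 (h1.trans h4) (norm_nonneg _) hε.le

/-- Leibniz's rule; the factor `1 + |x|` in the bound for `σ(l⁻¹ ·) - 1` is paid for by the
seminorms of `ψ` with weight `k + 1`. -/
theorem seminorm_dilated_mul_sub_le (σ ψ : 𝓢(E N, ℂ)) (h0 : σ 0 = 1) (k n : ℕ) :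
    ∃ C : ℝ, ∀ l : ℝ, 1 ≤ l → SchwartzMap.seminorm ℂ k n
      (SchwartzMap.smulLeftCLM ℂ (fun ξ : E N => σ (l⁻¹ • ξ)) ψ - ψ) ≤ l⁻¹ * C := by
  obtain ⟨M, hM, hb⟩ := norm_iteratedFDeriv_dilated_sub_one_le σ h0 n
  set B : ℕ → ℝ := fun i => SchwartzMap.seminorm ℝ k i ψ + SchwartzMap.seminorm ℝ (k + 1) i ψ
  have hB0 : ∀ i, 0 ≤ B i := fun i => add_nonneg (apply_nonneg _ _) (apply_nonneg _ _)
  refine ⟨∑ i ∈ Finset.range (n + 1), n.choose i * M * B (n - i), fun l hl => ?_⟩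
  have hl0 : 0 < l := by linarith
  refine SchwartzMap.seminorm_le_bound ℂ k n _
    (mul_nonneg (by positivity) (Finset.sum_nonneg fun i _ => by have := hB0 (n - i); positivity))
    fun x => ?_
  have e : ⇑(SchwartzMap.smulLeftCLM ℂ (fun ξ : E N => σ (l⁻¹ • ξ)) ψ - ψ) =
      fun y => (σ (l⁻¹ • y) - 1) * ψ y := by
    ext y
    rw [sub_apply, SchwartzMap.smulLeftCLM_apply_apply (hasTemperateGrowth_dilated l σ),
      smul_eq_mul]
    ring
  rw [e]
  have hsm : ContDiff ℝ ∞ fun y : E N => σ (l⁻¹ • y) - 1 :=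
    ((σ.smooth ⊤).comp (contDiff_id.const_smul l⁻¹)).sub contDiff_const
  have h1 := norm_iteratedFDeriv_mul_le hsm (ψ.smooth ⊤) x (n := n) (mod_cast le_top)
  calc _ ≤ ‖x‖ ^ k * ∑ i ∈ Finset.range (n + 1), (n.choose i : ℝ) *
          ‖iteratedFDeriv ℝ i (fun y => σ (l⁻¹ • y) - 1) x‖ * ‖iteratedFDeriv ℝ (n - i) ψ x‖ := by
        gcongr
    _ ≤ ∑ i ∈ Finset.range (n + 1), l⁻¹ * (n.choose i * M * B (n - i)) := by
        rw [Finset.mul_sum]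
        refine Finset.sum_le_sum fun i hi => ?_
        have h2 := hb l⁻¹ (by positivity) (inv_le_one_of_one_le₀ hl) i
          (by have := Finset.mem_range.1 hi; omega) x
        have h3 := SchwartzMap.le_seminorm ℝ k (n - i) ψ x
        have h4 := SchwartzMap.le_seminorm ℝ (k + 1) (n - i) ψ x
        calc _ ≤ ‖x‖ ^ k * ((n.choose i : ℝ) * (l⁻¹ * (M * (1 + ‖x‖))) *
                ‖iteratedFDeriv ℝ (n - i) ψ x‖) := by gcongr
          _ = l⁻¹ * (n.choose i * M * (‖x‖ ^ k * ‖iteratedFDeriv ℝ (n - i) ψ x‖ +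
                ‖x‖ ^ (k + 1) * ‖iteratedFDeriv ℝ (n - i) ψ x‖)) := by ring
          _ ≤ _ := by
            have : ‖x‖ ^ k * ‖iteratedFDeriv ℝ (n - i) ψ x‖ +
                ‖x‖ ^ (k + 1) * ‖iteratedFDeriv ℝ (n - i) ψ x‖ ≤ B (n - i) := add_le_add h3 h4
            gcongr
    _ = _ := by rw [Finset.mul_sum]

theorem tendsto_dilatedMultiplier (σ : 𝓢(E N, ℂ)) (h0 : σ 0 = 1) (f : 𝓢'(E N, ℂ)) (g : 𝓢(E N, ℂ))
    {l : ℕ → ℝ} (hl : Tendsto l atTop atTop) :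
    Tendsto (fun n => dilatedMultiplier (l n) σ f g) atTop (𝓝 (f g)) := by
  have h1 : Tendsto (fun n => SchwartzMap.smulLeftCLM ℂ (fun ξ : E N => σ ((l n)⁻¹ • ξ)) (𝓕⁻ g))
      atTop (𝓝 (𝓕⁻ g)) := by
    rw [(schwartz_withSeminorms ℂ (E N) ℂ).tendsto_nhds]
    rintro ⟨k, n⟩ ε hε
    obtain ⟨C, hC⟩ := seminorm_dilated_mul_sub_le σ (𝓕⁻ g) h0 k n
    have h2 : Tendsto (fun n => (l n)⁻¹ * C) atTop (𝓝 0) := by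
      simpa using (tendsto_inv_atTop_zero.comp hl).mul_const C
    filter_upwards [h2.eventually_lt_const hε, hl.eventually_ge_atTop 1] with m hm1 hm2
    exact (hC _ hm2).trans_lt hm1
  have h3 : Continuous fun ψ : 𝓢(E N, ℂ) => f (𝓕 ψ) :=
    (map_continuous f).comp (FourierTransform.fourierCLM ℂ 𝓢(E N, ℂ)).continuous
  have h4 := (h3.tendsto _).comp h1
  rw [FourierTransform.fourier_fourierInv_eq] at h4
  exact h4

namespace LPCouple

variable (P : LPCouple N)

theorem φ_eq_zero {ξ : E N} (h : ‖ξ‖ < 3 / 4 ∨ 8 / 3 < ‖ξ‖) : P.φ ξ = 0 := by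
  refine image_eq_zero_of_notMem_tsupport fun hξ => ?_
  have := P.supp_φ hξ
  rcases h with h | h <;> linarith [this.1, this.2]

theorem χ_eq_zero {ξ : E N} (h : 4 / 3 < ‖ξ‖) : P.χ ξ = 0 := by
  refine image_eq_zero_of_notMem_tsupport fun hξ => ?_
  have := P.supp_χ hξ
  simp only [mem_ofPred_eq] at this
  linarith

theorem χ_eq_one {ξ : E N} (h : ‖ξ‖ < 3 / 4) : P.χ ξ = 1 := by
  have h1 : ∀ q : ℕ, P.φ ((2 : ℝ) ^ (-(q : ℤ)) • ξ) = 0 := fun q => by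
    refine P.φ_eq_zero (Or.inl ?_)
    rw [norm_smul, Real.norm_of_nonneg (by positivity)]
    have : (2 : ℝ) ^ (-(q : ℤ)) ≤ 1 := zpow_le_one_of_nonpos₀ (by norm_num) (by omega)
    nlinarith [norm_nonneg ξ]
  have h2 := P.inhom ξ
  simp only [h1] at h2
  linarith [h2.unique hasSum_zero]

/-- The inhomogeneous partition of unity at `ξ` and at `ξ / 2` consists of the same terms except for
`q = 0`. -/
theorem χ_sub (ξ : E N) : P.χ ((2 : ℝ)⁻¹ • ξ) - P.χ ξ = P.φ ξ := by
  have h1 := P.inhom ξ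
  have h2 := P.inhom ((2 : ℝ)⁻¹ • ξ)
  have h3 : HasSum (fun q : ℕ => P.φ ((2 : ℝ) ^ (-((q + 1 : ℕ) : ℤ)) • ξ))
      (1 - P.χ ((2 : ℝ)⁻¹ • ξ)) := by
    refine h2.congr_fun ?_
    intro q
    rw [smul_smul]
    congr 2
    push_cast
    rw [neg_add, zpow_add₀ two_ne_zero, zpow_neg_one]
  rw [← hasSum_nat_add_iff' 1] at h1
  have h4 := h1.unique h3
  simp at h4
  linarith

/-- The symbol of the cut-off in Mathlib's normalisation of the Fourier transform. -/
def symχ : 𝓢(E N, ℂ) :=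
  HasCompactSupport.toSchwartzMap (f := fun ξ => ((P.χ ((2 * Real.pi) • ξ) : ℝ) : ℂ))
    (((HasCompactSupport.of_support_subset_isCompact (isCompact_closedBall (0 : E N) (4 / 3))
      fun ξ hξ => by
        rw [mem_closedBall_zero_iff]
        by_contra h
        exact hξ (P.χ_eq_zero (not_le.1 h))).comp_smul Real.two_pi_pos.ne').comp_left
          (g := ((↑) : ℝ → ℂ)) rfl)
    (Complex.ofRealCLM.contDiff.comp (P.smooth_χ.comp (contDiff_id.const_smul _)))

/-- The symbol of the dyadic block in Mathlib's normalisation of the Fourier transform. -/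
def symφ : 𝓢(E N, ℂ) :=
  HasCompactSupport.toSchwartzMap (f := fun ξ => ((P.φ ((2 * Real.pi) • ξ) : ℝ) : ℂ))
    (((HasCompactSupport.of_support_subset_isCompact (isCompact_closedBall (0 : E N) (8 / 3))
      fun ξ hξ => by
        rw [mem_closedBall_zero_iff]
        by_contra h
        exact hξ (P.φ_eq_zero (Or.inr (not_le.1 h)))).comp_smul Real.two_pi_pos.ne').comp_left
          (g := ((↑) : ℝ → ℂ)) rfl)
    (Complex.ofRealCLM.contDiff.comp (P.smooth_φ.comp (contDiff_id.const_smul _)))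

theorem symχ_apply (ξ : E N) : P.symχ ξ = ((P.χ ((2 * Real.pi) • ξ) : ℝ) : ℂ) := rfl

theorem symφ_apply (ξ : E N) : P.symφ ξ = ((P.φ ((2 * Real.pi) • ξ) : ℝ) : ℂ) := rfl

end LPCouple

variable (P : LPCouple N)

theorem block_eq (q : ℤ) : block P q = dilatedMultiplier ((2 : ℝ) ^ q) P.symφ := by
  unfold block multiplier dilatedMultiplier
  congr 1
  ext ξ
  rw [P.symφ_apply, smul_comm, zpow_neg]

theorem cutoff_eq (q : ℤ) : cutoff P q = dilatedMultiplier ((2 : ℝ) ^ q) P.symχ := by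
  unfold cutoff multiplier dilatedMultiplier
  congr 1
  ext ξ
  rw [P.symχ_apply, smul_comm, zpow_neg]

theorem symχ_dilated (q : ℤ) (ξ : E N) : P.symχ (((2 : ℝ) ^ q)⁻¹ • ξ) =
    ((P.χ ((2 : ℝ) ^ (-q) • (2 * Real.pi) • ξ) : ℝ) : ℂ) := by
  rw [P.symχ_apply, smul_comm, zpow_neg]

theorem symφ_dilated (q : ℤ) (ξ : E N) : P.symφ (((2 : ℝ) ^ q)⁻¹ • ξ) =
    ((P.φ ((2 : ℝ) ^ (-q) • (2 * Real.pi) • ξ) : ℝ) : ℂ) := by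
  rw [P.symφ_apply, smul_comm, zpow_neg]

theorem dilatedMultiplier_comp (l₁ l₂ : ℝ) (σ₁ σ₂ : 𝓢(E N, ℂ)) (f : 𝓢'(E N, ℂ)) :
    dilatedMultiplier l₂ σ₂ (dilatedMultiplier l₁ σ₁ f) =
      TemperedDistribution.fourierMultiplierCLM ℂ
        (fun ξ : E N => σ₁ (l₁⁻¹ • ξ) * σ₂ (l₂⁻¹ • ξ)) f :=
  TemperedDistribution.fourierMultiplierCLM_fourierMultiplierCLM_apply
    (hasTemperateGrowth_dilated l₁ σ₁) (hasTemperateGrowth_dilated l₂ σ₂) f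

theorem cutoff_block_comm (q j : ℤ) (f : 𝓢'(E N, ℂ)) :
    cutoff P j (block P q f) = block P q (cutoff P j f) := by
  simp only [cutoff_eq, block_eq, dilatedMultiplier_comp, mul_comm]

theorem cutoff_comm (q j : ℤ) (f : 𝓢'(E N, ℂ)) :
    cutoff P j (cutoff P q f) = cutoff P q (cutoff P j f) := by
  simp only [cutoff_eq, dilatedMultiplier_comp, mul_comm]

theorem zpow_neg_mul_le {q j : ℤ} {a : ℝ} (ha : 0 ≤ a) (h : q ≤ j) :
    (2 : ℝ) ^ (-j) * a ≤ (2 : ℝ) ^ (-q) * a := by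
  gcongr
  norm_num

theorem cutoff_block_eq_self {q j : ℤ} (h : q + 2 ≤ j) (f : 𝓢'(E N, ℂ)) :
    cutoff P j (block P q f) = block P q f := by
  rw [cutoff_eq, block_eq, dilatedMultiplier_comp]
  unfold dilatedMultiplier
  congr 2
  ext ξ
  rw [symφ_dilated, symχ_dilated]
  generalize (2 * Real.pi) • ξ = ζ
  by_cases hz : 8 / 3 < ‖(2 : ℝ) ^ (-q) • ζ‖
  · rw [P.φ_eq_zero (Or.inr hz)]; simp
  · rw [P.χ_eq_one]
    · simp
    · rw [norm_smul, Real.norm_of_nonneg (by positivity)] at hz ⊢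
      have := zpow_neg_mul_le (norm_nonneg ζ) h
      -- A gap of two suffices: `8/3 · 1/4 = 2/3 < 3/4`, so `χ` is one on the support of the block.
      rw [neg_add, zpow_add₀ two_ne_zero, show (2 : ℝ) ^ (-2 : ℤ) = 1 / 4 by norm_num] at this
      linarith

theorem cutoff_block_eq_zero {q j : ℤ} (h : j + 1 ≤ q) (f : 𝓢'(E N, ℂ)) :
    cutoff P j (block P q f) = 0 := by
  rw [cutoff_eq, block_eq, dilatedMultiplier_comp]
  have e : (fun ξ : E N => P.symφ (((2 : ℝ) ^ q)⁻¹ • ξ) * P.symχ (((2 : ℝ) ^ j)⁻¹ • ξ)) =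
      fun _ => 0 := by
    ext ξ
    rw [symφ_dilated, symχ_dilated]
    generalize (2 * Real.pi) • ξ = ζ
    by_cases hz : ‖(2 : ℝ) ^ (-q) • ζ‖ < 3 / 4
    · rw [P.φ_eq_zero (Or.inl hz)]; simp
    · rw [P.χ_eq_zero (ξ := (2 : ℝ) ^ (-j) • ζ)]
      · simp
      · rw [norm_smul, Real.norm_of_nonneg (by positivity)] at hz ⊢
        have := zpow_neg_mul_le (norm_nonneg ζ) h
        -- A gap of one suffices here: `2 · 3/4 = 3/2 > 4/3`.
        rw [neg_add, zpow_add₀ two_ne_zero, show (2 : ℝ) ^ (-1 : ℤ) = 1 / 2 by norm_num] at this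
        linarith
  rw [e, TemperedDistribution.fourierMultiplierCLM_const]
  simp

theorem cutoff_succ_sub (q : ℤ) (f : 𝓢'(E N, ℂ)) :
    cutoff P (q + 1) f - cutoff P q f = block P q f := by
  rw [cutoff_eq, cutoff_eq, block_eq]
  ext g
  rw [sub_apply]
  unfold dilatedMultiplier
  simp only [TemperedDistribution.fourierMultiplierCLM_apply_apply]
  rw [← map_sub]
  congr 1
  change FourierTransform.fourierCLM ℂ 𝓢(E N, ℂ) _ - FourierTransform.fourierCLM ℂ 𝓢(E N, ℂ) _ =
    FourierTransform.fourierCLM ℂ 𝓢(E N, ℂ) _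
  rw [← map_sub]
  congr 1
  ext ξ
  rw [sub_apply, SchwartzMap.smulLeftCLM_apply_apply (hasTemperateGrowth_dilated _ _),
    SchwartzMap.smulLeftCLM_apply_apply (hasTemperateGrowth_dilated _ _),
    SchwartzMap.smulLeftCLM_apply_apply (hasTemperateGrowth_dilated _ _), ← sub_smul,
    symχ_dilated, symχ_dilated, symφ_dilated]
  congr 1
  generalize (2 * Real.pi) • ξ = ζ
  rw [← P.χ_sub, neg_add, zpow_add₀ two_ne_zero, zpow_neg_one, mul_comm, mul_smul]
  push_cast
  rfl

theorem sum_block_Ico (f : 𝓢'(E N, ℂ)) (n : ℕ) :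
    ∑ q ∈ Finset.Ico (-(n : ℤ)) n, block P q f = cutoff P n f - cutoff P (-n) f := by
  have := Finset.sum_Ico_int_sub n (fun q => cutoff P q f)
  rw [← neg_sub, ← this, ← Finset.sum_neg_distrib]
  refine Finset.sum_congr rfl fun q _ => ?_
  rw [neg_sub, cutoff_succ_sub]

theorem sum_block_Ioc (f : 𝓢'(E N, ℂ)) (m : ℕ) :
    ∑ q ∈ Finset.Ioc (-(m : ℤ)) 0, block P q f = cutoff P 1 f - cutoff P (-m + 1) f := by
  induction m with
  | zero => simp
  | succ m ih =>
    have : Finset.Ioc (-((m + 1 : ℕ) : ℤ)) 0 = insert (-(m : ℤ)) (Finset.Ioc (-(m : ℤ)) 0) := by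
      ext x; simp only [Finset.mem_Ioc, Finset.mem_insert]; omega
    rw [this, Finset.sum_insert (by simp), ih, ← cutoff_succ_sub]
    push_cast
    rw [show -((m : ℤ) + 1) + 1 = -m by ring]
    abel

theorem enorm_apply_le {f : 𝓢'(E N, ℂ)} (hf : distNorm ⊤ f < ⊤) (g : 𝓢(E N, ℂ)) :
    ‖f g‖ₑ ≤ distNorm ⊤ f * ∫⁻ x, ‖g x‖ₑ := by
  obtain ⟨V, hV, -⟩ := exists_density_of_distNorm_lt_top (fun V => Tame.of_memLp_top) hf
  rw [distNorm_eq hV, hV.eq, eLpNorm_exponent_top, ← lintegral_const_mul _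
    g.continuous.enorm.measurable]
  refine (enorm_integral_le_lintegral_enorm _).trans (lintegral_mono_ae ?_)
  filter_upwards [ae_le_eLpNormEssSup (f := V) (μ := volume)] with x hx
  rw [enorm_mul, mul_comm]
  gcongr

variable {P}

theorem MemSh.tendsto_zero {f : 𝓢'(E N, ℂ)} (hf : MemSh P f) {q : ℕ → ℤ}
    (hq : Tendsto q atTop atBot) (g : 𝓢(E N, ℂ)) :
    Tendsto (fun n => cutoff P (q n) f g) atTop (𝓝 0) := by
  have h1 : Tendsto (fun n => distNorm ⊤ (cutoff P (q n) f)) atTop (𝓝 0) := hf.comp hq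
  rw [tendsto_zero_iff_enorm_tendsto_zero]
  have h2 : Tendsto (fun n => distNorm ⊤ (cutoff P (q n) f) * ∫⁻ x, ‖g x‖ₑ) atTop (𝓝 0) := by
    simpa using ENNReal.Tendsto.mul_const h1 (Or.inr g.integrable.2.ne)
  refine tendsto_of_tendsto_of_tendsto_of_le_of_le' tendsto_const_nhds h2
    (Eventually.of_forall fun _ => zero_le) ?_
  filter_upwards [h1.eventually_lt_const ENNReal.zero_lt_top] with n hn
  exact enorm_apply_le hn g

/-- The partial sums telescope to `S_1 f - S_{-m+1} f`, and the definition of `𝓢'_h` makes the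
second term vanish in the limit. This replaces the limit in the definition of `f_L` by one
multiplier. -/
theorem MemSh.lowPart_eq {f : 𝓢'(E N, ℂ)} (hf : MemSh P f) : lowPart P f = cutoff P 1 f := by
  refine Tendsto.limUnder_eq ?_
  rw [PointwiseConvergenceCLM.tendsto_iff_forall_tendsto]
  intro g
  have hq : Tendsto (fun m : ℕ => -(m : ℤ) + 1) atTop atBot :=
    tendsto_atBot_add_const_right _ _ (tendsto_neg_atTop_atBot.comp tendsto_natCast_atTop_atTop)
  have := (tendsto_const_nhds (x := cutoff P 1 f g)).sub (hf.tendsto_zero hq g)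
  rw [sub_zero] at this
  refine this.congr fun m => ?_
  rw [sum_block_Ioc, sub_apply]

theorem tendsto_cutoff (f : 𝓢'(E N, ℂ)) (g : 𝓢(E N, ℂ)) :
    Tendsto (fun n : ℕ => cutoff P n f g) atTop (𝓝 (f g)) := by
  simp only [cutoff_eq, zpow_natCast]
  refine tendsto_dilatedMultiplier P.symχ ?_ f g (tendsto_pow_atTop_atTop_of_one_lt one_lt_two)
  rw [P.symχ_apply, smul_zero, P.χ_eq_one (by simp)]
  simp

/-- The partial sums are `S_n f - S_{-n} f`. The upper end tends to `f` because `χ 0 = 1`; the lower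
end vanishes in `𝓢'_h`, which rules out a polynomial remainder. -/
theorem MemSh.tendsto_sum_block {f : 𝓢'(E N, ℂ)} (hf : MemSh P f) (g : 𝓢(E N, ℂ)) :
    Tendsto (fun n : ℕ => ∑ q ∈ Finset.Ico (-(n : ℤ)) n, block P q f g) atTop (𝓝 (f g)) := by
  have := (tendsto_cutoff (P := P) f g).sub
    (hf.tendsto_zero (tendsto_neg_atTop_atBot.comp tendsto_natCast_atTop_atTop) g)
  rw [sub_zero] at this
  refine this.congr fun n => ?_
  have h := congrArg (fun F : 𝓢'(E N, ℂ) => F g) (sum_block_Ico P f n)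
  simp only [sub_apply, sum_apply] at h
  exact h.symm

end HybridBesov

end

/-! ### Inverse Bernstein inequality for symbols supported in an annulus -/

open MeasureTheory Filter Topology Set
open scoped ENNReal NNReal SchwartzMap ContDiff

noncomputable section

namespace HybridBesov

open scoped FourierTransform LineDeriv

variable {N : ℕ}

/-- Symbols that are supported in an annulus. -/
structure AnnularSymbol (σ : 𝓢(E N, ℂ)) : Prop where
  compact : HasCompactSupport σ
  zero : ∀ᶠ ξ in 𝓝 0, σ ξ = 0

theorem AnnularSymbol.contDiff_div {σ : 𝓢(E N, ℂ)} (hσ : AnnularSymbol σ) :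
    ContDiff ℝ ∞ fun ξ : E N => (((‖ξ‖ ^ 2)⁻¹ : ℝ) : ℂ) * σ ξ := by
  rw [contDiff_iff_contDiffAt]
  intro ξ
  by_cases h : ξ = 0
  · subst h
    refine (contDiffAt_const (c := (0 : ℂ))).congr_of_eventuallyEq ?_
    filter_upwards [hσ.zero] with ξ hξ
    rw [hξ, mul_zero]
  · refine ContDiffAt.mul ?_ (σ.smooth ⊤).contDiffAt
    refine Complex.ofRealCLM.contDiff.contDiffAt.comp ξ ?_
    refine ContDiffAt.inv (contDiff_norm_sq ℝ).contDiffAt ?_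
    exact pow_ne_zero 2 (norm_ne_zero_iff.2 h)

/-- The symbol divided by `|ξ|²`. -/
def AnnularSymbol.divNormSq {σ : 𝓢(E N, ℂ)} (hσ : AnnularSymbol σ) : 𝓢(E N, ℂ) :=
  HasCompactSupport.toSchwartzMap (hσ.compact.mul_left (f := fun ξ => (((‖ξ‖ ^ 2)⁻¹ : ℝ) : ℂ)))
    hσ.contDiff_div

theorem AnnularSymbol.divNormSq_apply {σ : 𝓢(E N, ℂ)} (hσ : AnnularSymbol σ) (ξ : E N) :
    hσ.divNormSq ξ = (((‖ξ‖ ^ 2)⁻¹ : ℝ) : ℂ) * σ ξ := rfl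

/-- The symbol multiplied by `c * ξ_i / |ξ|²`. -/
def AnnularSymbol.component {σ : 𝓢(E N, ℂ)} (hσ : AnnularSymbol σ) (i : Fin N) : 𝓢(E N, ℂ) :=
  SchwartzMap.smulLeftCLM ℂ (fun ξ : E N => inner ℝ ξ (EuclideanSpace.single i (1 : ℝ)))
    ((2 * Real.pi * Complex.I : ℂ)⁻¹ • hσ.divNormSq)

theorem AnnularSymbol.component_apply {σ : 𝓢(E N, ℂ)} (hσ : AnnularSymbol σ) (i : Fin N)
    (ξ : E N) : hσ.component i ξ =
      ξ i * ((2 * Real.pi * Complex.I)⁻¹ * ((((‖ξ‖ ^ 2)⁻¹ : ℝ) : ℂ) * σ ξ)) := by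
  unfold AnnularSymbol.component
  rw [SchwartzMap.smulLeftCLM_apply_apply (by fun_prop), smul_apply,
    hσ.divNormSq_apply, EuclideanSpace.inner_single_right]
  simp

theorem AnnularSymbol.component_annular {σ : 𝓢(E N, ℂ)} (hσ : AnnularSymbol σ) (i : Fin N) :
    AnnularSymbol (hσ.component i) := by
  constructor
  · refine hσ.compact.mono fun ξ hξ h => hξ ?_
    rw [hσ.component_apply, h]
    simp
  · filter_upwards [hσ.zero] with ξ hξ
    rw [hσ.component_apply, hξ]
    simp

/-- On the Fourier side, `σ = ∑ (2πi ξ_i) σ_i` with `σ_i = ξ_i σ / (2πi |ξ|²)`, which is smooth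
because `σ` vanishes near the origin. So the kernel is a divergence, and its potentials have annular
symbols again. -/
theorem AnnularSymbol.kernel_eq_sum {σ : 𝓢(E N, ℂ)} (hσ : AnnularSymbol σ) :
    kernel σ = ∑ i, ∂_{EuclideanSpace.single i (1 : ℝ)} (kernel (hσ.component i)) := by
  unfold kernel
  simp only [SchwartzMap.lineDerivOp_fourierInv_eq]
  change _ = ∑ i, FourierTransform.fourierInvCLM ℂ 𝓢(E N, ℂ) _
  rw [← map_sum]
  change FourierTransform.fourierInvCLM ℂ 𝓢(E N, ℂ) _ = _
  congr 1
  ext ξ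
  have hI : (2 * Real.pi * Complex.I : ℂ) ≠ 0 := Complex.two_pi_I_ne_zero
  simp only [sum_apply, smul_apply]
  have e : ∀ i, (2 * Real.pi * Complex.I : ℂ) •
      (SchwartzMap.smulLeftCLM ℂ (fun x : E N => inner ℝ x (EuclideanSpace.single i (1 : ℝ))))
        (hσ.component i) ξ = ((ξ i ^ 2 : ℝ) : ℂ) * ((((‖ξ‖ ^ 2)⁻¹ : ℝ) : ℂ) * σ ξ) := by
    intro i
    rw [SchwartzMap.smulLeftCLM_apply_apply (by fun_prop), hσ.component_apply,
      EuclideanSpace.inner_single_right]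
    simp only [one_mul, conj_trivial, smul_eq_mul, Complex.real_smul]
    field_simp
    push_cast
    ring
  simp only [e]
  rw [← Finset.sum_mul, ← mul_assoc, ← Complex.ofReal_sum, ← EuclideanSpace.real_norm_sq_eq,
    ← Complex.ofReal_mul]
  by_cases h : ξ = 0
  · subst h
    rw [hσ.zero.self_of_nhds, mul_zero]
  · rw [mul_inv_cancel₀ (pow_ne_zero 2 (norm_ne_zero_iff.2 h))]
    simp

/-- Integration by parts moves the derivative from the kernel to `F`; the dilation of the kernel
supplies the factor `l`. This is one step of the gain `l^{-k}`. -/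
theorem scaledConv_lineDeriv (g : 𝓢(E N, ℂ)) {l : ℝ} (hl : 0 < l) {F : E N → ℂ}
    (hF : Differentiable ℝ F) (hF0 : Tame F) (e : E N) (hF1 : Tame fun y => fderiv ℝ F y e)
    (x : E N) : (l : ℂ) * scaledConv l (∂_{e} g : 𝓢(E N, ℂ)) F x =
      scaledConv l g (fun y => fderiv ℝ F y e) x := by
  have hd : ∀ y, HasFDerivAt (fun y : E N => g (l • (x - y)))
      ((fderiv ℝ g (l • (x - y))).comp (l • -ContinuousLinearMap.id ℝ (E N))) y := fun y => by
    have h1 : HasFDerivAt (fun y : E N => l • (x - y)) (l • -ContinuousLinearMap.id ℝ (E N)) y :=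
      ((hasFDerivAt_id y).const_sub x).const_smul l
    exact (g.hasFDerivAt (l • (x - y))).comp y h1
  have hd' : ∀ y, fderiv ℝ (fun y : E N => g (l • (x - y))) y e =
      -((l : ℂ) * (∂_{e} g) (l • (x - y))) := fun y => by
    rw [(hd y).fderiv, SchwartzMap.lineDerivOp_apply_eq_fderiv]
    simp
  have h := integral_mul_fderiv_eq_neg_fderiv_mul_of_integrable (μ := (volume : Measure (E N)))
    (f := F) (g := fun y => g (l • (x - y))) (v := e)
    (integrable_scaledConv g hl hF1 x)
    (by
      simp only [hd']
      refine ((integrable_scaledConv (∂_{e} g) hl hF0 x).const_mul (-(l : ℂ))).congr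
        (Eventually.of_forall fun y => ?_)
      simp only [smul_eq_mul]
      ring)
    (integrable_scaledConv g hl hF0 x) (fun y _ => hF y) (fun y _ => (hd y).differentiableAt)
  simp only [hd'] at h
  unfold scaledConv
  simp only [smul_eq_mul]
  rw [mul_smul_comm, ← integral_const_mul]
  congr 1
  calc _ = -∫ y, F y * -((l : ℂ) * (∂_{e} g) (l • (x - y))) := by
        rw [← integral_neg]
        congr 1
        ext y
        ring
    _ = _ := by rw [h, neg_neg]

theorem scaledConv_sum {ι : Type*} (s : Finset ι) (g : ι → 𝓢(E N, ℂ)) {l : ℝ} (hl : 0 < l)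
    {V : E N → ℂ} (hV : Tame V) (x : E N) :
    scaledConv l (∑ i ∈ s, g i : 𝓢(E N, ℂ)) V x = ∑ i ∈ s, scaledConv l (g i) V x := by
  unfold scaledConv
  rw [← Finset.smul_sum, ← integral_finsetSum _ fun i _ => integrable_scaledConv (g i) hl hV x]
  simp only [sum_apply, Finset.smul_sum]

theorem eLpNorm_scaledConv_le (g : 𝓢(E N, ℂ)) {l : ℝ} (hl : 0 < l) {V : E N → ℂ}
    (hV : AEStronglyMeasurable V volume) :
    eLpNorm (scaledConv l g V) 2 volume ≤ (∫⁻ x, ‖g x‖ₑ) * eLpNorm V 2 volume := by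
  calc eLpNorm (scaledConv l g V) 2 volume
      ≤ eLpNorm (lconv l (fun y => ‖g y‖ₑ) (fun y => ‖V y‖ₑ)) 2 volume :=
        eLpNorm_mono_enorm fun x => enorm_scaledConv_le hl _ _ _
    _ ≤ (∫⁻ x, ‖g x‖ₑ) * eLpNorm (fun y => ‖V y‖ₑ) 2 volume :=
        eLpNorm_lconv_le hl (goodKernel_schwartz g).meas hV.enorm
    _ = _ := by rw [eLpNorm_enorm]

/-- A Fourier multiplier with symbol in an annulus of size `l` gains `l ^ (-k)` on functions with
`k` derivatives. -/
theorem AnnularSymbol.eLpNorm_scaledConv_le (k : ℕ) {σ : 𝓢(E N, ℂ)} (hσ : AnnularSymbol σ) :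
    ∃ C : ℝ≥0∞, C < ⊤ ∧ ∀ l : ℝ, 0 < l → ∀ F : E N → ℂ, ContDiff ℝ k F →
      (∀ i ≤ k, ∃ R : ℝ, ∀ x, ‖iteratedFDeriv ℝ i F x‖ ≤ R) →
      ENNReal.ofReal l ^ k * eLpNorm (scaledConv l (kernel σ) F) 2 volume ≤
        C * eLpNorm (iteratedFDeriv ℝ k F) 2 volume := by
  induction k generalizing σ with
  | zero =>
    refine ⟨_, ((kernel σ).integrable (μ := volume)).2, fun l hl F hF _ => ?_⟩
    rw [pow_zero, one_mul]
    refine (HybridBesov.eLpNorm_scaledConv_le (kernel σ) hl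
      hF.continuous.aestronglyMeasurable).trans_eq ?_
    congr 1
    refine eLpNorm_congr_norm_ae (Eventually.of_forall fun x => ?_)
    rw [norm_iteratedFDeriv_zero]
  | succ k ih =>
    -- The induction runs over all annular symbols, since one step replaces `σ` by its components
    -- and `F` by its partial derivatives.
    choose C hC hb using fun i => ih (hσ.component_annular i)
    refine ⟨∑ i, C i, ENNReal.sum_lt_top.2 fun i _ => hC i, fun l hl F hF hR => ?_⟩
    have hF1 : ContDiff ℝ k (fderiv ℝ F) := hF.fderiv_right (by norm_cast)
    have hd : Differentiable ℝ F := hF.differentiable (by simp)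
    have htame : Tame F := by
      obtain ⟨R, h⟩ := hR 0 (by omega)
      refine Tame.of_bound hF.continuous.aestronglyMeasurable (R := R)
        (Eventually.of_forall fun x => ?_)
      simpa using h x
    set e : Fin N → E N := fun i => EuclideanSpace.single i (1 : ℝ) with he
    have hnorm : ∀ i, ‖e i‖ = 1 := fun i => by simp [he]
    have hFi : ∀ i, ContDiff ℝ k fun x => fderiv ℝ F x (e i) := fun i => hF1.clm_apply contDiff_const
    have hDi : ∀ i, ∀ j ≤ k, ∀ x, ‖iteratedFDeriv ℝ j (fun x => fderiv ℝ F x (e i)) x‖ ≤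
        ‖iteratedFDeriv ℝ (j + 1) F x‖ := fun i j hj x => by
      refine (norm_iteratedFDeriv_clm_apply_const (hF1.contDiffAt (x := x))
        (mod_cast hj)).trans_eq ?_
      rw [hnorm, one_mul, norm_iteratedFDeriv_fderiv]
    have htame1 : ∀ i, Tame fun x => fderiv ℝ F x (e i) := fun i => by
      obtain ⟨R, h⟩ := hR 1 (by omega)
      refine Tame.of_bound (hFi i).continuous.aestronglyMeasurable (R := R)
        (Eventually.of_forall fun x => ?_)
      have := (hDi i 0 (by omega) x).trans (h x)
      rwa [norm_iteratedFDeriv_zero] at this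
    have hsum : ∀ x, (l : ℂ) * scaledConv l (kernel σ) F x =
        ∑ i, scaledConv l (kernel (hσ.component i)) (fun y => fderiv ℝ F y (e i)) x := fun x => by
      conv_lhs => rw [hσ.kernel_eq_sum]
      rw [scaledConv_sum _ _ hl htame, Finset.mul_sum]
      exact Finset.sum_congr rfl fun i _ =>
        scaledConv_lineDeriv _ hl hd htame (e i) (htame1 i) x
    have h1 : ENNReal.ofReal l * eLpNorm (scaledConv l (kernel σ) F) 2 volume ≤
        ∑ i, eLpNorm (scaledConv l (kernel (hσ.component i)) fun y => fderiv ℝ F y (e i))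
          2 volume := by
      have h2 : ENNReal.ofReal l * eLpNorm (scaledConv l (kernel σ) F) 2 volume =
          eLpNorm ((l : ℂ) • scaledConv l (kernel σ) F) 2 volume := by
        rw [eLpNorm_const_smul]
        congr 1
        rw [← ofReal_norm, Complex.norm_real, Real.norm_of_nonneg hl.le]
      rw [h2]
      refine le_trans (le_of_eq ?_) (eLpNorm_sum_le (fun i _ =>
        (continuous_scaledConv hl (htame1 i) _).aestronglyMeasurable) one_le_two)
      congr 1
      ext x
      rw [Finset.sum_apply, ← hsum]
      rfl
    rw [pow_succ, mul_assoc, Finset.sum_mul]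
    calc _ ≤ ENNReal.ofReal l ^ k * ∑ i, eLpNorm (scaledConv l (kernel (hσ.component i))
            fun y => fderiv ℝ F y (e i)) 2 volume := by gcongr
      _ ≤ _ := by
        rw [Finset.mul_sum]
        refine Finset.sum_le_sum fun i _ => ?_
        refine (hb i l hl _ (hFi i) fun j hj => ?_).trans ?_
        · obtain ⟨R, h⟩ := hR (j + 1) (by omega)
          exact ⟨R, fun x => (hDi i j hj x).trans (h x)⟩
        · gcongr
          exact eLpNorm_mono fun x => hDi i k le_rfl x

end HybridBesov

end

/-! ### The difference quotient of `K` and derivatives of `K ∘ w₁ - K ∘ w₀` -/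

open MeasureTheory Filter Topology Set
open scoped ENNReal NNReal SchwartzMap ContDiff

noncomputable section

namespace HybridBesov

theorem hasFDerivAt_parametric_integral {H F : Type*} [NormedAddCommGroup H] [NormedSpace ℝ H]
    [ProperSpace H] [NormedAddCommGroup F] [NormedSpace ℝ F] {f : H × ℝ → F}
    (hf : ContDiff ℝ ∞ f) (x : H) :
    HasFDerivAt (fun x => ∫ τ in (0 : ℝ)..1, f (x, τ))
      (∫ τ in (0 : ℝ)..1, (fderiv ℝ f (x, τ)).comp (ContinuousLinearMap.inl ℝ H ℝ)) x := by
  have hc : Continuous fun p : H × ℝ => (fderiv ℝ f p).comp (ContinuousLinearMap.inl ℝ H ℝ) :=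
    (hf.continuous_fderiv (by simp)).clm_comp continuous_const
  obtain ⟨C, hC⟩ := ((isCompact_closedBall x 1).prod isCompact_Icc).exists_bound_of_continuousOn
    (hc.continuousOn (s := Metric.closedBall x 1 ×ˢ Icc (0 : ℝ) 1))
  have hfc := hf.continuous
  refine intervalIntegral.hasFDerivAt_integral_of_dominated_of_fderiv_le
    (F' := fun x τ => (fderiv ℝ f (x, τ)).comp (ContinuousLinearMap.inl ℝ H ℝ))
    (bound := fun _ => C) (Metric.ball_mem_nhds x one_pos) ?_ ?_ ?_ ?_ ?_ ?_
  · exact Eventually.of_forall fun y => (hfc.comp (by fun_prop)).aestronglyMeasurable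
  · exact (hfc.comp (by fun_prop)).intervalIntegrable _ _
  · exact (hc.comp (by fun_prop : Continuous fun τ : ℝ => (x, τ))).aestronglyMeasurable
  · refine Eventually.of_forall fun τ hτ y hy => hC (y, τ) ⟨Metric.ball_subset_closedBall hy, ?_⟩
    rw [uIoc_of_le zero_le_one] at hτ
    exact ⟨hτ.1.le, hτ.2⟩
  · exact intervalIntegrable_const
  · refine Eventually.of_forall fun τ _ y _ => ?_
    have h1 := (hf.differentiable (by simp) (y, τ)).hasFDerivAt
    exact h1.comp y (hasFDerivAt_prodMk_left y τ)

theorem contDiff_parametric_integral {H F : Type} [NormedAddCommGroup H] [NormedSpace ℝ H]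
    [ProperSpace H] [NormedAddCommGroup F] [NormedSpace ℝ F] (k : ℕ) {f : H × ℝ → F}
    (hf : ContDiff ℝ ∞ f) : ContDiff ℝ k fun x => ∫ τ in (0 : ℝ)..1, f (x, τ) := by
  induction k generalizing F with
  | zero =>
    rw [Nat.cast_zero, contDiff_zero, continuous_iff_continuousAt]
    exact fun x => (hasFDerivAt_parametric_integral hf x).continuousAt
  | succ k ih =>
    rw [Nat.cast_succ, contDiff_succ_iff_hasFDerivAt]
    exact ⟨_, ih ((hf.fderiv_right (by simp)).clm_comp contDiff_const),
      hasFDerivAt_parametric_integral hf⟩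

/-- The difference quotient of `K` as a smooth function of its two arguments. -/
def diffQuotient (K : ℝ → ℝ) (p : ℝ × ℝ) : ℝ :=
  ∫ τ in (0 : ℝ)..1, deriv K (p.1 + τ * (p.2 - p.1))

theorem contDiff_diffQuotient {K : ℝ → ℝ} (hK : ContDiff ℝ ∞ K) :
    ContDiff ℝ ∞ (diffQuotient K) := by
  rw [contDiff_infty]
  intro k
  have hK' : ContDiff ℝ ∞ (deriv K) := by
    rw [show ((⊤ : ℕ∞) : WithTop ℕ∞) = (⊤ : ℕ∞) + 1 by rfl, contDiff_succ_iff_deriv] at hK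
    exact hK.2.2
  exact contDiff_parametric_integral k (f := fun q : (ℝ × ℝ) × ℝ =>
    deriv K (q.1.1 + q.2 * (q.1.2 - q.1.1))) (hK'.comp (by fun_prop))

/-- The fundamental theorem of calculus along the segment from `a` to `b`. Unlike the usual
quotient, the integral is smooth across the diagonal. -/
theorem diffQuotient_mul {K : ℝ → ℝ} (hK : ContDiff ℝ ∞ K) (a b : ℝ) :
    diffQuotient K (a, b) * (b - a) = K b - K a := by
  have hd : ∀ τ : ℝ, HasDerivAt (fun τ : ℝ => K (a + τ * (b - a)))
      (deriv K (a + τ * (b - a)) * (b - a)) τ := fun τ => by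
    have h1 : HasDerivAt (fun τ : ℝ => a + τ * (b - a)) (b - a) τ := by
      simpa using ((hasDerivAt_id τ).mul_const (b - a)).const_add a
    exact (hK.differentiable (by simp) _).hasDerivAt.comp τ h1
  have hc : Continuous fun τ : ℝ => deriv K (a + τ * (b - a)) * (b - a) :=
    ((hK.continuous_deriv (by simp)).comp (by fun_prop)).mul continuous_const
  have h := intervalIntegral.integral_eq_sub_of_hasDerivAt (a := 0) (b := 1) (fun τ _ => hd τ)
    (hc.intervalIntegrable _ _)
  unfold diffQuotient
  rw [← intervalIntegral.integral_mul_const]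
  simpa using h

theorem norm_iteratedFDeriv_prodMk_le {E' : Type*} [NormedAddCommGroup E'] [NormedSpace ℝ E']
    {f g : E' → ℝ} (hf : ContDiff ℝ ∞ f) (hg : ContDiff ℝ ∞ g) (i : ℕ) (x : E') {R : ℝ}
    (h1 : ‖iteratedFDeriv ℝ i f x‖ ≤ R) (h2 : ‖iteratedFDeriv ℝ i g x‖ ≤ R) :
    ‖iteratedFDeriv ℝ i (fun y => (f y, g y)) x‖ ≤ R := by
  rw [iteratedFDeriv_prodMk hf.contDiffAt hg.contDiffAt (mod_cast le_top),
    ContinuousMultilinearMap.opNorm_prod]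
  exact max_le h1 h2

/-- Derivatives of `K ∘ w₁ - K ∘ w₀` in terms of those of `w₁ - w₀`. -/
theorem norm_iteratedFDeriv_comp_sub_comp_le {K : ℝ → ℝ} (hK : ContDiff ℝ ∞ K) (k : ℕ)
    {A : ℝ} (hA : 1 ≤ A) :
    ∃ C : ℝ, 0 ≤ C ∧ ∀ {E' : Type} [NormedAddCommGroup E'] [NormedSpace ℝ E'] (l : ℝ), 0 < l →
      ∀ w₀ w₁ : E' → ℝ, ContDiff ℝ ∞ w₀ → ContDiff ℝ ∞ w₁ → ∀ x,
      (∀ i ≤ k, ‖iteratedFDeriv ℝ i w₀ x‖ ≤ A * l ^ i) →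
      (∀ i ≤ k, ‖iteratedFDeriv ℝ i w₁ x‖ ≤ A * l ^ i) → ∀ n ≤ k,
      ‖iteratedFDeriv ℝ n (fun y => K (w₁ y) - K (w₀ y)) x‖ ≤
        C * ∑ i ∈ Finset.range (n + 1), l ^ i *
          ‖iteratedFDeriv ℝ (n - i) (fun y => w₁ y - w₀ y) x‖ := by
  have hG := contDiff_diffQuotient hK
  have hbd : ∀ i, ∃ M : ℝ, ∀ p ∈ Metric.closedBall (0 : ℝ × ℝ) A,
      ‖iteratedFDeriv ℝ i (diffQuotient K) p‖ ≤ M := fun i =>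
    (isCompact_closedBall _ _).exists_bound_of_continuousOn
      (hG.continuous_iteratedFDeriv (mod_cast le_top)).continuousOn
  choose M hM using hbd
  -- A common bound for the derivatives of the difference quotient up to order `k` on a ball of
  -- radius `A`; `K` enters the constant only here, through `K'`.
  set CG := ∑ i ∈ Finset.range (k + 1), |M i| with hCG
  have hCG0 : 0 ≤ CG := Finset.sum_nonneg fun i _ => abs_nonneg _
  refine ⟨2 ^ k * (k.factorial * CG * A ^ k), by positivity,
    fun {E'} _ _ l hl w₀ w₁ h₀ h₁ x b₀ b₁ n hn => ?_⟩
  have hW : ContDiff ℝ ∞ fun y => (w₀ y, w₁ y) := h₀.prodMk h₁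
  have hWx : (w₀ x, w₁ x) ∈ Metric.closedBall (0 : ℝ × ℝ) A := by
    have e0 := b₀ 0 (by omega)
    have e1 := b₁ 0 (by omega)
    rw [norm_iteratedFDeriv_zero, pow_zero, mul_one] at e0 e1
    rw [mem_closedBall_zero_iff]
    exact max_le e0 e1
  have hcomp : ∀ i ≤ n, ‖iteratedFDeriv ℝ i (fun y => diffQuotient K (w₀ y, w₁ y)) x‖ ≤
      i.factorial * CG * (A * l) ^ i := fun i hi => by
    refine norm_iteratedFDeriv_comp_le (g := diffQuotient K) (f := fun y => (w₀ y, w₁ y)) hG hW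
      (mod_cast le_top) x (fun j hj => ?_) (fun j hj1 hj => ?_)
    · refine (hM j _ hWx).trans ((le_abs_self _).trans ?_)
      exact Finset.single_le_sum (f := fun i => |M i|) (fun i _ => abs_nonneg _)
        (Finset.mem_range.2 (by omega))
    -- The bound for composite functions needs the `j`-th derivative of the inner map below the
    -- `j`-th power of one number; this uses `A ≥ 1` and `j ≥ 1`.
    · have : A * l ^ j ≤ (A * l) ^ j := by
        rw [mul_pow]
        gcongr
        exact le_self_pow₀ hA (by omega)
      exact norm_iteratedFDeriv_prodMk_le h₀ h₁ j x ((b₀ j (by omega)).trans this)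
        ((b₁ j (by omega)).trans this)
  have e : (fun y => K (w₁ y) - K (w₀ y)) =
      fun y => diffQuotient K (w₀ y, w₁ y) * (w₁ y - w₀ y) :=
    funext fun y => (diffQuotient_mul hK _ _).symm
  rw [e]
  refine (norm_iteratedFDeriv_mul_le (hG.comp hW) (h₁.sub h₀) x (n := n)
    (mod_cast le_top)).trans ?_
  rw [Finset.mul_sum]
  refine Finset.sum_le_sum fun i hi => ?_
  have hin : i ≤ n := by have := Finset.mem_range.1 hi; omega
  have h1 := hcomp i hin
  have h2 : (n.choose i : ℝ) ≤ 2 ^ k := by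
    have h3 : n.choose i ≤ 2 ^ n := Nat.choose_le_two_pow n i
    have h4 : 2 ^ n ≤ 2 ^ k := Nat.pow_le_pow_right two_pos hn
    exact_mod_cast h3.trans h4
  have h3 : (i.factorial : ℝ) ≤ k.factorial := by
    exact_mod_cast Nat.factorial_le (hin.trans hn)
  have h4 : A ^ i ≤ A ^ k := pow_le_pow_right₀ hA (hin.trans hn)
  calc _ ≤ 2 ^ k * (k.factorial * CG * (A ^ k * l ^ i)) *
        ‖iteratedFDeriv ℝ (n - i) (fun y => w₁ y - w₀ y) x‖ := by
        rw [mul_pow] at h1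
        have h5 := h1.trans (show (i.factorial : ℝ) * CG * (A ^ i * l ^ i) ≤
          k.factorial * CG * (A ^ k * l ^ i) by gcongr)
        gcongr
        exact h5
    _ = _ := by ring

end HybridBesov

end

/-! ### Dyadic blocks as functions; the critical Besov space consists of bounded functions -/

open MeasureTheory Filter Topology Set
open scoped ENNReal NNReal SchwartzMap ContDiff

noncomputable section

namespace HybridBesov

variable {N : ℕ}

theorem tame_of_memLp {p : ℝ≥0∞} (hp : p = 2 ∨ p = ⊤) {V : E N → ℂ} (hV : MemLp V p volume) :
    Tame V := by
  rcases hp with rfl | rfl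
  · exact Tame.of_memLp_two hV
  · exact Tame.of_memLp_top hV

theorem enorm_scaledConv_le_top (g : 𝓢(E N, ℂ)) {l : ℝ} (hl : 0 < l) {V : E N → ℂ} {R : ℝ≥0∞}
    (hV : ∀ᵐ y, ‖V y‖ₑ ≤ R) (x : E N) : ‖scaledConv l g V x‖ₑ ≤ R * ∫⁻ x, ‖g x‖ₑ :=
  (enorm_scaledConv_le hl _ _ _).trans
    (lconv_le_of_ae_le hl (goodKernel_schwartz g).meas hV x)

theorem eLpNorm_scaledConv_le_of {p : ℝ≥0∞} (hp : p = 2 ∨ p = ⊤) (g : 𝓢(E N, ℂ)) {l : ℝ}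
    (hl : 0 < l) {V : E N → ℂ} (hV : AEStronglyMeasurable V volume) :
    eLpNorm (scaledConv l g V) p volume ≤ (∫⁻ x, ‖g x‖ₑ) * eLpNorm V p volume := by
  rcases hp with rfl | rfl
  · exact eLpNorm_scaledConv_le g hl hV
  · simp only [eLpNorm_exponent_top]
    refine eLpNormEssSup_le_of_ae_enorm_bound (Eventually.of_forall fun x => ?_)
    rw [mul_comm]
    exact enorm_scaledConv_le_top g hl ae_le_eLpNormEssSup x

theorem memLp_scaledConv {p : ℝ≥0∞} (hp : p = 2 ∨ p = ⊤) (g : 𝓢(E N, ℂ)) {l : ℝ} (hl : 0 < l)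
    {V : E N → ℂ} (hV : MemLp V p volume) : MemLp (scaledConv l g V) p volume :=
  ⟨(continuous_scaledConv hl (tame_of_memLp hp hV) g).aestronglyMeasurable,
    (eLpNorm_scaledConv_le_of hp g hl hV.1).trans_lt
      (ENNReal.mul_lt_top (g.integrable (μ := volume)).2 hV.2)⟩

theorem HasDensity.dilated {p : ℝ≥0∞} (hp : p = 2 ∨ p = ⊤) {f : 𝓢'(E N, ℂ)} {V : E N → ℂ}
    (hf : HasDensity f V) (hV : MemLp V p volume) (σ : 𝓢(E N, ℂ)) {l : ℝ} (hl : 0 < l) :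
    HasDensity (HybridBesov.dilatedMultiplier l σ f) (scaledConv l (kernel σ) V) :=
  hf.dilatedMultiplier σ hl (tame_of_memLp hp (memLp_scaledConv hp _ hl hV))

/-- The function-level low-frequency cut-off. -/
def lowConv (P : LPCouple N) (j : ℤ) (V : E N → ℂ) : E N → ℂ :=
  scaledConv ((2 : ℝ) ^ j) (kernel P.symχ) V

/-- The function-level dyadic block. -/
def dyadConv (P : LPCouple N) (j : ℤ) (V : E N → ℂ) : E N → ℂ :=
  scaledConv ((2 : ℝ) ^ j) (kernel P.symφ) V

variable {P : LPCouple N}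

theorem two_zpow_pos (j : ℤ) : (0 : ℝ) < 2 ^ j := by positivity

theorem HasDensity.cutoff {p : ℝ≥0∞} (hp : p = 2 ∨ p = ⊤) {f : 𝓢'(E N, ℂ)} {V : E N → ℂ}
    (hf : HasDensity f V) (hV : MemLp V p volume) (j : ℤ) :
    HasDensity (cutoff P j f) (lowConv P j V) := by
  rw [cutoff_eq]
  exact hf.dilated hp hV _ (two_zpow_pos j)

theorem HasDensity.block {p : ℝ≥0∞} (hp : p = 2 ∨ p = ⊤) {f : 𝓢'(E N, ℂ)} {V : E N → ℂ}
    (hf : HasDensity f V) (hV : MemLp V p volume) (j : ℤ) :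
    HasDensity (block P j f) (dyadConv P j V) := by
  rw [block_eq]
  exact hf.dilated hp hV _ (two_zpow_pos j)

theorem Tame.sub {V W : E N → ℂ} (hV : Tame V) (hW : Tame W) : Tame fun x => V x - W x := by
  refine ⟨hV.meas.sub hW.meas, (hV.int.add hW.int).mono'
    (continuous_wt.aestronglyMeasurable.mul (hV.meas.sub hW.meas).norm)
    (Eventually.of_forall fun y => ?_)⟩
  rw [norm_mul, norm_norm, Real.norm_of_nonneg (wt_pos y).le, Pi.add_apply, ← mul_add]
  exact mul_le_mul_of_nonneg_left (norm_sub_le _ _) (wt_pos y).le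

theorem Tame.add {V W : E N → ℂ} (hV : Tame V) (hW : Tame W) : Tame fun x => V x + W x := by
  refine ⟨hV.meas.add hW.meas, (hV.int.add hW.int).mono'
    (continuous_wt.aestronglyMeasurable.mul (hV.meas.add hW.meas).norm)
    (Eventually.of_forall fun y => ?_)⟩
  rw [norm_mul, norm_norm, Real.norm_of_nonneg (wt_pos y).le, Pi.add_apply, ← mul_add]
  exact mul_le_mul_of_nonneg_left (norm_add_le _ _) (wt_pos y).le

theorem HasDensity.sub {f g : 𝓢'(E N, ℂ)} {V W : E N → ℂ} (hf : HasDensity f V)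
    (hg : HasDensity g W) : HasDensity (f - g) fun x => V x - W x := by
  refine ⟨hf.tame.sub hg.tame, fun φ => ?_⟩
  rw [sub_apply, hf.eq, hg.eq, ← integral_sub (integrable_schwartz_mul φ hf.tame)
    (integrable_schwartz_mul φ hg.tame)]
  simp only [mul_sub]

theorem HasDensity.add {f g : 𝓢'(E N, ℂ)} {V W : E N → ℂ} (hf : HasDensity f V)
    (hg : HasDensity g W) : HasDensity (f + g) fun x => V x + W x := by
  refine ⟨hf.tame.add hg.tame, fun φ => ?_⟩
  rw [add_apply, hf.eq, hg.eq, ← integral_add (integrable_schwartz_mul φ hf.tame)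
    (integrable_schwartz_mul φ hg.tame)]
  simp only [mul_add]

theorem HasDensity.zero : HasDensity (0 : 𝓢'(E N, ℂ)) fun _ => 0 :=
  ⟨Tame.of_bound aestronglyMeasurable_const (R := 0) (by simp), fun φ => by simp⟩

theorem HasDensity.sum {ι : Type*} (s : Finset ι) {f : ι → 𝓢'(E N, ℂ)} {V : ι → E N → ℂ}
    (h : ∀ i ∈ s, HasDensity (f i) (V i)) :
    HasDensity (∑ i ∈ s, f i) fun x => ∑ i ∈ s, V i x := by
  classical
  induction s using Finset.induction_on with
  | empty => simpa using HasDensity.zero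
  | insert a s ha ih =>
    simp only [Finset.sum_insert ha]
    exact (h a (by simp)).add (ih fun i hi => h i (by simp [hi]))

theorem HasDensity.congr {f : 𝓢'(E N, ℂ)} {V W : E N → ℂ} (hf : HasDensity f V)
    (h : V =ᵐ[volume] W) : HasDensity f W := by
  refine ⟨⟨hf.tame.meas.congr h, hf.tame.int.congr ?_⟩, fun φ => ?_⟩
  · filter_upwards [h] with x hx
    rw [hx]
  · rw [hf.eq]
    refine integral_congr_ae ?_
    filter_upwards [h] with x hx
    rw [hx]

theorem exists_hasDensity {p : ℝ≥0∞} (hp : p = 2 ∨ p = ⊤) {V : E N → ℂ} (hV : MemLp V p volume) :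
    ∃ f : 𝓢'(E N, ℂ), HasDensity f V := by
  have : Fact (1 ≤ p) := ⟨by rcases hp with rfl | rfl <;> simp⟩
  refine ⟨(hV.toLp : 𝓢'(E N, ℂ)), tame_of_memLp hp hV, fun g => ?_⟩
  rw [Lp.toTemperedDistribution_apply]
  refine integral_congr_ae ?_
  filter_upwards [hV.coeFn_toLp] with x hx
  rw [hx, smul_eq_mul]

theorem continuous_lowConv {V : E N → ℂ} (hV : Tame V) (j : ℤ) : Continuous (lowConv P j V) :=
  continuous_scaledConv (two_zpow_pos j) hV _

theorem continuous_dyadConv {V : E N → ℂ} (hV : Tame V) (j : ℤ) : Continuous (dyadConv P j V) :=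
  continuous_scaledConv (two_zpow_pos j) hV _

theorem memLp_dyadConv {p : ℝ≥0∞} (hp : p = 2 ∨ p = ⊤) {V : E N → ℂ} (hV : MemLp V p volume)
    (j : ℤ) : MemLp (dyadConv P j V) p volume :=
  memLp_scaledConv hp _ (two_zpow_pos j) hV

theorem memLp_lowConv {p : ℝ≥0∞} (hp : p = 2 ∨ p = ⊤) {V : E N → ℂ} (hV : MemLp V p volume)
    (j : ℤ) : MemLp (lowConv P j V) p volume :=
  memLp_scaledConv hp _ (two_zpow_pos j) hV

/-- The identity between distributions gives equality of densities almost everywhere, and continuity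
of both sides upgrades it to every point. -/
theorem lowConv_succ_sub {V : E N → ℂ} (hV : MemLp V ⊤ volume) (j : ℤ) (x : E N) :
    lowConv P (j + 1) V x - lowConv P j V x = dyadConv P j V x := by
  obtain ⟨f, hf⟩ := exists_hasDensity (Or.inr rfl) hV
  have h1 := (hf.cutoff (P := P) (Or.inr rfl) hV (j + 1)).sub (hf.cutoff (P := P) (Or.inr rfl) hV j)
  rw [cutoff_succ_sub] at h1
  have h2 := h1.ae_eq (hf.block (Or.inr rfl) hV j)
  exact congrFun ((Continuous.ae_eq_iff_eq volume ((continuous_lowConv hf.tame _).sub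
    (continuous_lowConv hf.tame _)) (continuous_dyadConv hf.tame _)).1 h2) x

theorem lowConv_dyadConv {V : E N → ℂ} (hV : MemLp V ⊤ volume) (j : ℤ) :
    lowConv P (j + 2) (dyadConv P j V) = dyadConv P j V := by
  obtain ⟨f, hf⟩ := exists_hasDensity (Or.inr rfl) hV
  have h0 := hf.block (P := P) (Or.inr rfl) hV j
  have h1 := h0.cutoff (P := P) (Or.inr rfl) (memLp_dyadConv (Or.inr rfl) hV j) (j + 2)
  rw [cutoff_block_eq_self P le_rfl] at h1
  exact (Continuous.ae_eq_iff_eq volume (continuous_lowConv h0.tame _)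
    (continuous_dyadConv hf.tame _)).1 (h1.ae_eq h0)

theorem sum_dyadConv {V : E N → ℂ} (hV : MemLp V ⊤ volume) (n : ℕ) (x : E N) :
    ∑ q ∈ Finset.Ico (-(n : ℤ)) n, dyadConv P q V x = lowConv P n V x - lowConv P (-n) V x := by
  have := Finset.sum_Ico_int_sub n (fun q => lowConv P q V x)
  rw [← neg_sub, ← this, ← Finset.sum_neg_distrib]
  refine Finset.sum_congr rfl fun q _ => ?_
  rw [neg_sub, lowConv_succ_sub hV]

theorem ofReal_two_zpow (q : ℤ) : ENNReal.ofReal ((2 : ℝ) ^ q) = (2 : ℝ≥0∞) ^ (q : ℝ) := by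
  rw [← Real.rpow_intCast, ← ENNReal.ofReal_rpow_of_pos two_pos]
  simp

/-- Bernstein's inequality for functions that agree with their low-frequency part. -/
theorem enorm_lowConv_le (j : ℤ) {V : E N → ℂ} (hV : AEStronglyMeasurable V volume) (x : E N) :
    ‖lowConv P j V x‖ₑ ≤ (2 : ℝ≥0∞) ^ ((j : ℝ) * (N / 2)) *
      eLpNorm (kernel P.symχ) 2 volume * eLpNorm V 2 volume := by
  refine (enorm_scaledConv_le (two_zpow_pos j) _ _ _).trans
    ((lconv_le_of_eLpNorm_two (two_zpow_pos j) (goodKernel_schwartz _).meas hV.enorm x).trans ?_)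
  rw [eLpNorm_enorm, eLpNorm_enorm, ofReal_two_zpow, ← ENNReal.rpow_mul]

/-- The series converges normally, so its pairing with a test function is the limit of the pairings
of the partial sums; in `𝓢'_h` that limit is `f`. -/
theorem hasDensity_tsum {f : 𝓢'(E N, ℂ)} (hf : MemSh P f) {D : ℤ → E N → ℂ}
    (hD : ∀ q, HasDensity (block P q f) (D q)) {c : ℤ → ℝ≥0∞} (hc : ∀ q x, ‖D q x‖ₑ ≤ c q)
    (hsum : ∑' q, c q < ⊤) :
    (∀ x, Summable fun q => D q x) ∧ HasDensity f (fun x => ∑' q, D q x) ∧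
      ∀ x, ‖∑' q, D q x‖ₑ ≤ ∑' q, c q := by
  have hs : ∀ x, Summable fun q => D q x := fun x => by
    refine Summable.of_enorm (ne_top_of_le_ne_top hsum.ne ?_)
    exact ENNReal.tsum_le_tsum fun q => hc q x
  have hle : ∀ x, ‖∑' q, D q x‖ₑ ≤ ∑' q, c q := fun x =>
    enorm_tsum_le_tsum_enorm.trans (ENNReal.tsum_le_tsum fun q => hc q x)
  have hlim : ∀ x, Tendsto (fun n : ℕ => ∑ q ∈ Finset.Ico (-(n : ℤ)) n, D q x) atTop
      (𝓝 (∑' q, D q x)) := fun x => (hs x).hasSum.comp Finset.tendsto_Ico_neg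
  have hmeas : ∀ n : ℕ, AEStronglyMeasurable
      (fun x => ∑ q ∈ Finset.Ico (-(n : ℤ)) n, D q x) volume := fun n =>
    Finset.aestronglyMeasurable_fun_sum _ fun q _ => (hD q).tame.meas
  have hm : AEStronglyMeasurable (fun x => ∑' q, D q x) volume :=
    aestronglyMeasurable_of_tendsto_ae atTop hmeas (Eventually.of_forall hlim)
  have ht : Tame fun x => ∑' q, D q x := by
    refine Tame.of_bound hm (R := (∑' q, c q).toReal) (Eventually.of_forall fun x => ?_)
    rw [← toReal_enorm]
    exact ENNReal.toReal_mono hsum.ne (hle x)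
  refine ⟨hs, ⟨ht, fun g => ?_⟩, hle⟩
  refine tendsto_nhds_unique (hf.tendsto_sum_block g) ?_
  have h1 : Tendsto (fun n : ℕ => ∫ x, g x * ∑ q ∈ Finset.Ico (-(n : ℤ)) n, D q x) atTop
      (𝓝 (∫ x, g x * ∑' q, D q x)) := by
    refine tendsto_integral_of_dominated_convergence (fun x => ‖g x‖ * (∑' q, c q).toReal)
      (fun n => g.continuous.aestronglyMeasurable.mul (hmeas n))
      (g.integrable.norm.mul_const _) (fun n => Eventually.of_forall fun x => ?_)
      (Eventually.of_forall fun x => (hlim x).const_mul _)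
    rw [norm_mul]
    gcongr
    rw [← toReal_enorm]
    refine ENNReal.toReal_mono hsum.ne ((enorm_sum_le _ _).trans ?_)
    exact (Finset.sum_le_sum fun q _ => hc q x).trans (ENNReal.sum_le_tsum _)
  refine h1.congr fun n => ?_
  have h2 := (HasDensity.sum (Finset.Ico (-(n : ℤ)) n) fun q _ => hD q).eq g
  rw [sum_apply] at h2
  exact h2.symm

theorem IsGivenBy.locallyIntegrable {f : 𝓢'(E N, ℂ)} {v : E N → ℝ} (h : IsGivenBy f v) :
    LocallyIntegrable (fun x => (v x : ℂ)) volume := by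
  intro x
  let φ : ContDiffBump x := ⟨1, 2, one_pos, one_lt_two⟩
  have hg₁ : HasCompactSupport (Complex.ofRealCLM ∘ φ) := φ.hasCompactSupport.comp_left rfl
  have hg₂ : ContDiff ℝ ∞ (Complex.ofRealCLM ∘ φ) := Complex.ofRealCLM.contDiff.comp φ.contDiff
  have h1 := (h (hg₁.toSchwartzMap hg₂)).1
  refine ⟨Metric.closedBall x 1, Metric.closedBall_mem_nhds x one_pos, ?_⟩
  refine (h1.integrableOn (s := Metric.closedBall x 1)).congr_fun (fun y hy => ?_)
    Metric.isClosed_closedBall.measurableSet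
  have : φ y = 1 := φ.one_of_mem_closedBall hy
  simp [this]

/-- Elements of the critical Besov space are bounded functions. -/
theorem IsGivenBy.bounded {f : 𝓢'(E N, ℂ)} {v : E N → ℝ} (h : IsGivenBy f v) (hf : MemSh P f)
    (hB : besovNorm P (N / 2) f < ⊤) :
    MemLp (fun x => (v x : ℂ)) ⊤ volume ∧
    eLpNorm v ⊤ volume ≤ (2 : ℝ≥0∞) ^ (N : ℝ) * eLpNorm (kernel P.symχ) 2 volume *
      besovNorm P (N / 2) f ∧
    (∀ᵐ x, Tendsto (fun n : ℕ => lowConv P n (fun x => (v x : ℂ)) x) atTop (𝓝 (v x))) ∧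
    (∀ᵐ x, Tendsto (fun n : ℕ => lowConv P (-n) (fun x => (v x : ℂ)) x) atTop (𝓝 0)) := by
  have hfin : ∀ q, distNorm 2 (block P q f) < ⊤ := fun q => by
    have h1 := (ENNReal.le_tsum q).trans_lt hB
    have h2 : (2 : ℝ≥0∞) ^ ((q : ℝ) * ((N : ℝ) / 2)) ≠ 0 := by
      simp [ENNReal.rpow_eq_zero_iff]
    exact ENNReal.lt_top_of_mul_ne_top_right h1.ne h2
  choose V hV hV2 using fun q => exists_density_of_distNorm_lt_top (p := 2)
    (fun V => Tame.of_memLp_two) (hfin q)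
  -- Since `S_{q+2} Δ_q = Δ_q`, this is another density of the block, one for which Bernstein's
  -- bound holds at every point. The shift by two accounts for the factor `2^N` in `A`.
  set D : ℤ → E N → ℂ := fun q => lowConv P (q + 2) (V q) with hDdef
  have hD : ∀ q, HasDensity (block P q f) (D q) := fun q => by
    have := (hV q).cutoff (P := P) (Or.inl rfl) (hV2 q) (q + 2)
    rwa [cutoff_block_eq_self P le_rfl] at this
  set A := (2 : ℝ≥0∞) ^ (N : ℝ) * eLpNorm (kernel P.symχ) 2 volume with hA
  have hk : eLpNorm (kernel P.symχ) 2 volume < ⊤ := ((kernel P.symχ).memLp 2 volume).2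
  have h2N : (2 : ℝ≥0∞) ^ (N : ℝ) < ⊤ :=
    ENNReal.rpow_lt_top_of_nonneg (Nat.cast_nonneg N) ENNReal.ofNat_ne_top
  have hAtop : A < ⊤ := ENNReal.mul_lt_top h2N hk
  have hc : ∀ q x, ‖D q x‖ₑ ≤
      A * ((2 : ℝ≥0∞) ^ ((q : ℝ) * ((N : ℝ) / 2)) * distNorm 2 (block P q f)) := fun q x => by
    refine (enorm_lowConv_le (q + 2) (hV2 q).1 x).trans (le_of_eq ?_)
    rw [distNorm_eq (hV q), hA]
    have : (2 : ℝ≥0∞) ^ (((q + 2 : ℤ) : ℝ) * ((N : ℝ) / 2)) =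
        (2 : ℝ≥0∞) ^ (N : ℝ) * (2 : ℝ≥0∞) ^ ((q : ℝ) * ((N : ℝ) / 2)) := by
      rw [← ENNReal.rpow_add _ _ (by simp) (by simp)]
      congr 1
      push_cast
      ring
    rw [this]
    simp only [mul_assoc, mul_left_comm]
  have hsum : ∑' q : ℤ, A * ((2 : ℝ≥0∞) ^ ((q : ℝ) * ((N : ℝ) / 2)) * distNorm 2 (block P q f)) =
      A * besovNorm P (N / 2) f := ENNReal.tsum_mul_left
  obtain ⟨hs, hb, hle⟩ := hasDensity_tsum hf hD hc (by
    rw [hsum]; exact ENNReal.mul_lt_top hAtop hB)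
  rw [hsum] at hle
  have hvb : (fun x => (v x : ℂ)) =ᵐ[volume] fun x => ∑' q, D q x :=
    ae_eq_of_schwartz_integral_eq h.locallyIntegrable hb.tame.locallyIntegrable fun g => by
      rw [← hb.eq, (h g).2]
  have hdens := hb.congr hvb.symm
  have hbd : ∀ᵐ x, ‖(v x : ℂ)‖ₑ ≤ A * besovNorm P (N / 2) f := by
    filter_upwards [hvb] with x hx
    rw [hx]
    exact hle x
  have hmem : MemLp (fun x => (v x : ℂ)) ⊤ volume := by
    refine ⟨hdens.tame.meas, ?_⟩
    rw [eLpNorm_exponent_top]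
    exact (eLpNormEssSup_le_of_ae_enorm_bound hbd).trans_lt (ENNReal.mul_lt_top hAtop hB)
  have hneg : ∀ᵐ x, Tendsto (fun n : ℕ => lowConv P (-n) (fun x => (v x : ℂ)) x) atTop (𝓝 0) := by
    have h1 : Tendsto (fun n : ℕ => distNorm ⊤ (HybridBesov.cutoff P (-n) f)) atTop (𝓝 0) :=
      hf.comp (tendsto_neg_atTop_atBot.comp tendsto_natCast_atTop_atTop)
    have h2 : ∀ᵐ x, ∀ n : ℕ, ‖lowConv P (-n) (fun x => (v x : ℂ)) x‖ₑ ≤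
        distNorm ⊤ (HybridBesov.cutoff P (-n) f) := by
      rw [ae_all_iff]
      intro n
      rw [distNorm_eq (hdens.cutoff (Or.inr rfl) hmem _), eLpNorm_exponent_top]
      exact ae_le_eLpNormEssSup
    filter_upwards [h2] with x hx
    rw [tendsto_zero_iff_enorm_tendsto_zero]
    exact tendsto_of_tendsto_of_tendsto_of_le_of_le tendsto_const_nhds h1 (fun _ => zero_le) hx
  refine ⟨hmem, ?_, ?_, hneg⟩
  · rw [eLpNorm_exponent_top]
    refine eLpNormEssSup_le_of_ae_enorm_bound ?_
    filter_upwards [hbd] with x hx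
    rwa [← ofReal_norm, Complex.norm_real, ofReal_norm] at hx
  -- `S_n v` is the partial sum of the blocks plus `S_{-n} v`; the former tends to `v` and the
  -- latter to zero.
  · have h3 : ∀ᵐ x, ∀ q, dyadConv P q (fun x => (v x : ℂ)) x = D q x := by
      rw [ae_all_iff]
      exact fun q => (hdens.block (Or.inr rfl) hmem q).ae_eq (hD q)
    filter_upwards [hneg, h3, hvb] with x hx1 hx2 hx3
    have h4 : Tendsto (fun n : ℕ => ∑ q ∈ Finset.Ico (-(n : ℤ)) n, D q x) atTop
        (𝓝 (∑' q, D q x)) := (hs x).hasSum.comp Finset.tendsto_Ico_neg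
    rw [← hx3] at h4
    have h5 := h4.add hx1
    rw [add_zero] at h5
    refine h5.congr fun n => ?_
    simp only [← hx2]
    rw [sum_dyadConv hmem, sub_add_cancel]

end HybridBesov

end

/-! ### The telescoping increments of `K(v)` and their frequency localization -/

open MeasureTheory Filter Topology Set
open scoped ENNReal NNReal SchwartzMap ContDiff

noncomputable section

namespace HybridBesov

variable {N : ℕ} {P : LPCouple N}

theorem norm_iteratedFDeriv_scaledConv_le (g : 𝓢(E N, ℂ)) (i : ℕ) :
    ∃ M : ℝ, 0 ≤ M ∧ ∀ l : ℝ, 0 < l → ∀ R : ℝ, 0 ≤ R → ∀ V : E N → ℂ,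
      AEStronglyMeasurable V volume → (∀ᵐ y, ‖V y‖ ≤ R) → ∀ x,
      ‖iteratedFDeriv ℝ i (scaledConv l g V) x‖ ≤ M * R * l ^ i := by
  obtain ⟨κ, hκ, hb⟩ := enorm_iteratedFDeriv_scaledConv_le i g
  refine ⟨(∫⁻ y, κ y).toReal, ENNReal.toReal_nonneg, fun l hl R hR V hV hVR x => ?_⟩
  have h1 := hb l hl V (Tame.of_bound hV hVR) x
  have h2 : lconv l κ (fun y => ‖V y‖ₑ) x ≤ ENNReal.ofReal R * ∫⁻ y, κ y := by
    refine lconv_le_of_ae_le hl hκ.meas ?_ x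
    filter_upwards [hVR] with y hy
    rw [← ofReal_norm]
    exact ENNReal.ofReal_le_ofReal hy
  rw [← toReal_enorm]
  calc _ ≤ (ENNReal.ofReal l ^ i * (ENNReal.ofReal R * ∫⁻ y, κ y)).toReal := by
        refine ENNReal.toReal_mono ?_ (h1.trans (by gcongr))
        have := hκ.one.ne
        finiteness
    _ = _ := by
        rw [ENNReal.toReal_mul, ENNReal.toReal_mul, ENNReal.toReal_pow,
          ENNReal.toReal_ofReal hl.le, ENNReal.toReal_ofReal hR]
        ring

theorem eLpNorm_iteratedFDeriv_scaledConv_le (g : 𝓢(E N, ℂ)) (i : ℕ) :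
    ∃ M : ℝ≥0∞, M < ⊤ ∧ ∀ l : ℝ, 0 < l → ∀ V : E N → ℂ, Tame V →
      eLpNorm (iteratedFDeriv ℝ i (scaledConv l g V)) 2 volume ≤
        ENNReal.ofReal l ^ i * (M * eLpNorm V 2 volume) := by
  obtain ⟨κ, hκ, hb⟩ := enorm_iteratedFDeriv_scaledConv_le i g
  refine ⟨∫⁻ y, κ y, hκ.one, fun l hl V hV => ?_⟩
  have h1 : eLpNorm (iteratedFDeriv ℝ i (scaledConv l g V)) 2 volume ≤
      eLpNorm (fun x => (l ^ i).toNNReal • lconv l κ (fun y => ‖V y‖ₑ) x) 2 volume := by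
    refine eLpNorm_mono_enorm fun x => (hb l hl V hV x).trans (le_of_eq ?_)
    rw [enorm_eq_self, ENNReal.smul_def, smul_eq_mul, ← ENNReal.ofReal_pow hl.le]
    rfl
  refine h1.trans ?_
  have h2 : eLpNorm (fun x => (l ^ i).toNNReal • lconv l κ (fun y => ‖V y‖ₑ) x) 2 volume =
      ENNReal.ofReal l ^ i * eLpNorm (lconv l κ (fun y => ‖V y‖ₑ)) 2 volume := by
    have hsq : ∀ {a b : ℝ≥0∞}, a ^ 2 = b ^ 2 → a = b := fun h =>
      le_antisymm (le_of_sq_le_sq h.le) (le_of_sq_le_sq h.ge)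
    refine hsq ?_
    rw [mul_pow, eLpNorm_two_sq, eLpNorm_two_sq, ← lintegral_const_mul' _ _ (by finiteness)]
    refine lintegral_congr fun x => ?_
    rw [enorm_eq_self, enorm_eq_self, ENNReal.smul_def, smul_eq_mul, mul_pow,
      ← ENNReal.ofReal_pow hl.le]
    rfl
  rw [h2]
  gcongr
  refine (eLpNorm_lconv_le hl hκ.meas hV.meas.enorm).trans_eq ?_
  rw [eLpNorm_enorm]

theorem contDiff_scaledConv_infty (g : 𝓢(E N, ℂ)) {l : ℝ} (hl : 0 < l) {V : E N → ℂ}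
    (hV : Tame V) : ContDiff ℝ ∞ (scaledConv l g V) :=
  contDiff_infty.2 fun k => contDiff_scaledConv hl hV k g

theorem norm_iteratedFDeriv_re_le {f : E N → ℂ} (hf : ContDiff ℝ ∞ f) (i : ℕ) (x : E N) :
    ‖iteratedFDeriv ℝ i (fun y => (f y).re) x‖ ≤ ‖iteratedFDeriv ℝ i f x‖ := by
  have := Complex.reCLM.norm_iteratedFDeriv_comp_left (f := f) (x := x) (N := ∞) (n := i)
    hf.contDiffAt (mod_cast le_top)
  rwa [Complex.reCLM_norm, one_mul] at this

theorem norm_iteratedFDeriv_ofReal {f : E N → ℝ} (hf : ContDiff ℝ ∞ f) (i : ℕ) (x : E N) :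
    ‖iteratedFDeriv ℝ i (fun y => (f y : ℂ)) x‖ = ‖iteratedFDeriv ℝ i f x‖ :=
  Complex.ofRealLI.norm_iteratedFDeriv_comp_left (f := f) hf.contDiffAt (mod_cast le_top)

/-- The increments of `K` along the real parts of the low-frequency cut-offs. -/
def compDiff (P : LPCouple N) (K : ℝ → ℝ) (V : E N → ℂ) (j : ℤ) (x : E N) : ℝ :=
  K (lowConv P (j + 1) V x).re - K (lowConv P j V x).re

theorem re_lowConv_sub {V : E N → ℂ} (hV : MemLp V ⊤ volume) (j : ℤ) (x : E N) :
    (lowConv P (j + 1) V x).re - (lowConv P j V x).re = (dyadConv P j V x).re := by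
  rw [← lowConv_succ_sub hV, Complex.sub_re]

/-- Pointwise bounds for the derivatives of the increments. -/
theorem norm_iteratedFDeriv_compDiff_le (P : LPCouple N) {K : ℝ → ℝ} (hK : ContDiff ℝ ∞ K) (k : ℕ)
    {R : ℝ} (hR : 0 ≤ R) :
    ∃ C : ℝ, 0 ≤ C ∧ ∀ V : E N → ℂ, MemLp V ⊤ volume → (∀ᵐ y, ‖V y‖ ≤ R) → ∀ (j : ℤ) (x : E N),
      ∀ n ≤ k, ‖iteratedFDeriv ℝ n (compDiff P K V j) x‖ ≤
        C * ∑ i ∈ Finset.range (n + 1), ((2 : ℝ) ^ j) ^ i *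
          ‖iteratedFDeriv ℝ (n - i) (dyadConv P j V) x‖ := by
  choose M hM0 hM using norm_iteratedFDeriv_scaledConv_le (kernel P.symχ)
  -- The factor `2^i` lets the scale `2^j` also serve `S_{j+1}`; the summand one ensures `A ≥ 1`.
  set A := 1 + ∑ i ∈ Finset.range (k + 1), M i * R * 2 ^ i with hA
  have hterm : ∀ i, 0 ≤ M i * R * 2 ^ i := fun i => by have := hM0 i; positivity
  have hA1 : 1 ≤ A := by
    have := Finset.sum_nonneg fun i (_ : i ∈ Finset.range (k + 1)) => hterm i
    linarith
  have hle : ∀ i ≤ k, M i * R * 2 ^ i ≤ A := fun i hi => by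
    have := Finset.single_le_sum (fun i (_ : i ∈ Finset.range (k + 1)) => hterm i)
      (Finset.mem_range.2 (by omega : i < k + 1))
    linarith
  obtain ⟨C, hC, hb⟩ := norm_iteratedFDeriv_comp_sub_comp_le hK k hA1
  refine ⟨C, hC, fun V hV hVR j x n hn => ?_⟩
  have ht := Tame.of_memLp_top hV
  have hl := two_zpow_pos j
  have hw : ∀ j : ℤ, ContDiff ℝ ∞ fun y => (lowConv P j V y).re := fun j =>
    Complex.reCLM.contDiff.comp (contDiff_scaledConv_infty _ (two_zpow_pos j) ht)
  have hwb : ∀ j : ℤ, ∀ i, ‖iteratedFDeriv ℝ i (fun y => (lowConv P j V y).re) x‖ ≤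
      M i * R * ((2 : ℝ) ^ j) ^ i := fun j i =>
    (norm_iteratedFDeriv_re_le (contDiff_scaledConv_infty _ (two_zpow_pos j) ht) i x).trans
      (hM i _ (two_zpow_pos j) R hR V hV.1 hVR x)
  have h1 := hb ((2 : ℝ) ^ j) hl _ _ (hw j) (hw (j + 1)) x
    (fun i hi => (hwb j i).trans (by
      have h2 := hle i hi
      have h3 : M i * R ≤ M i * R * 2 ^ i :=
        le_mul_of_one_le_right (mul_nonneg (hM0 i) hR) (one_le_pow₀ one_le_two)
      gcongr
      exact h3.trans h2))
    (fun i hi => (hwb (j + 1) i).trans (by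
      rw [zpow_add_one₀ two_ne_zero, mul_pow]
      have h2 := hle i hi
      calc M i * R * (((2 : ℝ) ^ j) ^ i * 2 ^ i) = M i * R * 2 ^ i * ((2 : ℝ) ^ j) ^ i := by ring
        _ ≤ _ := by gcongr)) n hn
  refine h1.trans ?_
  gcongr with i hi
  simp only [re_lowConv_sub hV]
  exact norm_iteratedFDeriv_re_le (contDiff_scaledConv_infty _ hl ht) _ x

theorem contDiff_compDiff {K : ℝ → ℝ} (hK : ContDiff ℝ ∞ K) {V : E N → ℂ}
    (hV : Tame V) (j : ℤ) : ContDiff ℝ ∞ (compDiff P K V j) := by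
  have hw : ∀ j : ℤ, ContDiff ℝ ∞ fun y => (lowConv P j V y).re := fun j =>
    Complex.reCLM.contDiff.comp (contDiff_scaledConv_infty _ (two_zpow_pos j) hV)
  exact (hK.comp (hw (j + 1))).sub (hK.comp (hw j))

theorem annularSymbol_symφ (P : LPCouple N) : AnnularSymbol P.symφ where
  compact := by
    refine HasCompactSupport.of_support_subset_isCompact (isCompact_closedBall (0 : E N) (8 / 3))
      fun ξ hξ => ?_
    rw [mem_closedBall_zero_iff]
    by_contra h
    refine hξ ?_
    rw [P.symφ_apply, P.φ_eq_zero (Or.inr _), Complex.ofReal_zero]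
    rw [norm_smul, Real.norm_of_nonneg Real.two_pi_pos.le]
    have := Real.pi_gt_three
    push Not at h
    nlinarith [norm_nonneg ξ]
  zero := by
    filter_upwards [Metric.ball_mem_nhds (0 : E N) (show (0 : ℝ) < 3 / 32 by norm_num)] with ξ hξ
    rw [P.symφ_apply, P.φ_eq_zero (Or.inl _), Complex.ofReal_zero]
    rw [norm_smul, Real.norm_of_nonneg Real.two_pi_pos.le]
    rw [mem_ball_zero_iff] at hξ
    have := Real.pi_lt_four
    have := Real.pi_pos
    nlinarith [norm_nonneg ξ]

/-- Dyadic blocks of the increments, with a gain of `2 ^ ((j - q) * k)`. -/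
theorem eLpNorm_dyadConv_compDiff_le (P : LPCouple N) {K : ℝ → ℝ} (hK : ContDiff ℝ ∞ K) (k : ℕ)
    {R : ℝ} (hR : 0 ≤ R) :
    ∃ C : ℝ≥0∞, C < ⊤ ∧ ∀ V : E N → ℂ, MemLp V ⊤ volume → (∀ᵐ y, ‖V y‖ ≤ R) → ∀ q j : ℤ,
      ENNReal.ofReal ((2 : ℝ) ^ q) ^ k *
        eLpNorm (dyadConv P q fun x => (compDiff P K V j x : ℂ)) 2 volume ≤
      C * (ENNReal.ofReal ((2 : ℝ) ^ j) ^ k * eLpNorm (dyadConv P j V) 2 volume) := by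
  obtain ⟨C₁, hC₁, hb₁⟩ := norm_iteratedFDeriv_compDiff_le P hK k hR
  obtain ⟨C₂, hC₂, hb₂⟩ := (annularSymbol_symφ P).eLpNorm_scaledConv_le k
  choose M hM0 hM using norm_iteratedFDeriv_scaledConv_le (kernel P.symφ)
  choose B hB hB2 using eLpNorm_iteratedFDeriv_scaledConv_le (kernel P.symχ)
  refine ⟨C₂ * (ENNReal.ofReal C₁ * ∑ i ∈ Finset.range (k + 1), 4 ^ (k - i) * B (k - i)), ?_,
    fun V hV hVR q j => ?_⟩
  · refine ENNReal.mul_lt_top hC₂ (ENNReal.mul_lt_top ENNReal.ofReal_lt_top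
      (ENNReal.sum_lt_top.2 fun i _ => ENNReal.mul_lt_top ?_ (hB _)))
    exact ENNReal.pow_lt_top ENNReal.ofNat_lt_top
  have ht := Tame.of_memLp_top hV
  have hl := two_zpow_pos j
  have hsm := contDiff_compDiff (P := P) hK ht j
  have hsmC : ContDiff ℝ ∞ fun x => (compDiff P K V j x : ℂ) := Complex.ofRealCLM.contDiff.comp hsm
  have hD : ContDiff ℝ ∞ (dyadConv P j V) := contDiff_scaledConv_infty _ hl ht
  have hcont : ∀ i, Continuous (iteratedFDeriv ℝ i (dyadConv P j V)) := fun i =>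
    hD.continuous_iteratedFDeriv (mod_cast le_top)
  have h1 := hb₂ ((2 : ℝ) ^ q) (two_zpow_pos q) (fun x => (compDiff P K V j x : ℂ))
    (hsmC.of_le (mod_cast le_top)) (fun i hi => by
      refine ⟨C₁ * ∑ m ∈ Finset.range (i + 1), ((2 : ℝ) ^ j) ^ m *
        (M (i - m) * R * ((2 : ℝ) ^ j) ^ (i - m)), fun x => ?_⟩
      rw [norm_iteratedFDeriv_ofReal hsm]
      refine (hb₁ V hV hVR j x i hi).trans ?_
      gcongr with m hm
      exact hM (i - m) _ hl R hR V hV.1 hVR x)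
  refine h1.trans ?_
  rw [mul_assoc C₂]
  gcongr
  have h2 : eLpNorm (iteratedFDeriv ℝ k fun x => (compDiff P K V j x : ℂ)) 2 volume ≤
      eLpNorm (C₁ • ∑ i ∈ Finset.range (k + 1), (((2 : ℝ) ^ j) ^ i) •
        fun x => ‖iteratedFDeriv ℝ (k - i) (dyadConv P j V) x‖) 2 volume := by
    refine eLpNorm_mono_real fun x => ?_
    rw [norm_iteratedFDeriv_ofReal hsm]
    refine (hb₁ V hV hVR j x k le_rfl).trans (le_of_eq ?_)
    simp [Finset.sum_apply]
  refine h2.trans ?_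
  rw [eLpNorm_const_smul, Real.enorm_of_nonneg hC₁, mul_assoc]
  gcongr
  refine (eLpNorm_sum_le (fun i _ => ((hcont _).norm.aestronglyMeasurable.const_smul _))
    one_le_two).trans ?_
  rw [Finset.sum_mul]
  refine Finset.sum_le_sum fun i hi => ?_
  have hik : i ≤ k := by have := Finset.mem_range.1 hi; omega
  rw [eLpNorm_const_smul, eLpNorm_norm, Real.enorm_of_nonneg (by positivity),
    ENNReal.ofReal_pow hl.le]
  -- Bernstein for derivatives is applied to `Δ_j = S_{j+2} Δ_j`, which produces the powers of four.
  have h3 := hB2 (k - i) ((2 : ℝ) ^ (j + 2)) (two_zpow_pos _) (dyadConv P j V)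
    (Tame.of_memLp_top (memLp_dyadConv (Or.inr rfl) hV j))
  have h4 : scaledConv ((2 : ℝ) ^ (j + 2)) (kernel P.symχ) (dyadConv P j V) = dyadConv P j V :=
    lowConv_dyadConv hV j
  rw [h4] at h3
  have h5 : ENNReal.ofReal ((2 : ℝ) ^ (j + 2)) = ENNReal.ofReal ((2 : ℝ) ^ j) * 4 := by
    rw [zpow_add₀ two_ne_zero, ENNReal.ofReal_mul hl.le]
    norm_num
  calc _ ≤ ENNReal.ofReal ((2 : ℝ) ^ j) ^ i * (ENNReal.ofReal ((2 : ℝ) ^ (j + 2)) ^ (k - i) *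
        (B (k - i) * eLpNorm (dyadConv P j V) 2 volume)) := by gcongr
    _ = 4 ^ (k - i) * B (k - i) * (ENNReal.ofReal ((2 : ℝ) ^ j) ^ (i + (k - i)) *
        eLpNorm (dyadConv P j V) 2 volume) := by
      rw [h5, mul_pow, pow_add]
      ring
    _ = _ := by rw [Nat.add_sub_cancel' hik]

/-- The increments are controlled pointwise by the dyadic blocks. -/
theorem exists_norm_compDiff_le (P : LPCouple N) {K : ℝ → ℝ} (hK : ContDiff ℝ ∞ K) {R : ℝ}
    (hR : 0 ≤ R) : ∃ C : ℝ, 0 ≤ C ∧ ∀ V : E N → ℂ, MemLp V ⊤ volume → (∀ᵐ y, ‖V y‖ ≤ R) →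
      ∀ (j : ℤ) (x : E N), ‖(compDiff P K V j x : ℂ)‖ ≤ C * ‖dyadConv P j V x‖ := by
  obtain ⟨C, hC, hb⟩ := norm_iteratedFDeriv_compDiff_le P hK 0 hR
  refine ⟨C, hC, fun V hV hVR j x => ?_⟩
  have := hb V hV hVR j x 0 le_rfl
  rw [Complex.norm_real]
  simpa using this

theorem memLp_compDiff {K : ℝ → ℝ} (hK : ContDiff ℝ ∞ K) {V : E N → ℂ} (hV : MemLp V ⊤ volume)
    {R : ℝ} (hR : 0 ≤ R) (hVR : ∀ᵐ y, ‖V y‖ ≤ R) (j : ℤ) :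
    MemLp (fun x => (compDiff P K V j x : ℂ)) ⊤ volume := by
  obtain ⟨C, hC, hb⟩ := exists_norm_compDiff_le P hK hR
  have ht := Tame.of_memLp_top hV
  exact (memLp_dyadConv (Or.inr rfl) hV j).of_le_mul (Complex.continuous_ofReal.comp
    (contDiff_compDiff hK ht j).continuous).aestronglyMeasurable
    (Eventually.of_forall fun x => hb V hV hVR j x)

theorem sum_compDiff (K : ℝ → ℝ) (V : E N → ℂ) (n : ℕ) (x : E N) :
    ∑ j ∈ Finset.Ico (-(n : ℤ)) n, compDiff P K V j x =
      K (lowConv P n V x).re - K (lowConv P (-n) V x).re := by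
  have := Finset.sum_Ico_int_sub n (fun q => K (lowConv P q V x).re)
  rw [← neg_sub, ← this, ← Finset.sum_neg_distrib]
  refine Finset.sum_congr rfl fun q _ => ?_
  rw [neg_sub]
  rfl

theorem scaledConv_fun_sum {ι : Type*} (s : Finset ι) (g : 𝓢(E N, ℂ)) {l : ℝ} (hl : 0 < l)
    {V : ι → E N → ℂ} (hV : ∀ i ∈ s, Tame (V i)) (x : E N) :
    scaledConv l g (fun y => ∑ i ∈ s, V i y) x = ∑ i ∈ s, scaledConv l g (V i) x := by
  unfold scaledConv
  rw [← Finset.smul_sum, ← integral_finsetSum _ fun i hi => integrable_scaledConv g hl (hV i hi) x]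
  simp only [Finset.sum_smul]

theorem tendsto_scaledConv (g : 𝓢(E N, ℂ)) {l : ℝ} (hl : 0 < l) {V : ℕ → E N → ℂ} {W : E N → ℂ}
    (hV : ∀ n, AEStronglyMeasurable (V n) volume) {R : ℝ} (hVR : ∀ n y, ‖V n y‖ ≤ R)
    (hlim : ∀ᵐ y, Tendsto (fun n => V n y) atTop (𝓝 (W y))) (x : E N) :
    Tendsto (fun n => scaledConv l g (V n) x) atTop (𝓝 (scaledConv l g W x)) := by
  refine Tendsto.const_smul (tendsto_integral_of_dominated_convergence
    (fun y => R * ‖g (l • (x - y))‖) (fun n => (hV n).smul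
      (g.continuous.comp (by fun_prop)).aestronglyMeasurable) ?_
    (fun n => Eventually.of_forall fun y => ?_) ?_) _
  · refine Integrable.const_mul (Integrable.norm ?_) R
    have := integrable_scaledConv g hl (V := fun _ => 1)
      (Tame.of_bound aestronglyMeasurable_const (R := 1) (by simp)) x
    simpa using this
  · change ‖V n y • g (l • (x - y))‖ ≤ _
    rw [norm_smul]
    gcongr
    exact hVR n y
  · filter_upwards [hlim] with y hy
    exact hy.smul_const _

/-- Multipliers applied to `K (v)` are controlled by the sum over the increments. -/
theorem eLpNorm_scaledConv_comp_le {K : ℝ → ℝ} (hK : ContDiff ℝ ∞ K) (hK0 : K 0 = 0) {v : E N → ℝ}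
    (hv : MemLp (fun x => (v x : ℂ)) ⊤ volume)
    (h1 : ∀ᵐ x, Tendsto (fun n : ℕ => lowConv P n (fun x => (v x : ℂ)) x) atTop (𝓝 (v x)))
    (h2 : ∀ᵐ x, Tendsto (fun n : ℕ => lowConv P (-n) (fun x => (v x : ℂ)) x) atTop (𝓝 0))
    (g : 𝓢(E N, ℂ)) {l : ℝ} (hl : 0 < l) {p : ℝ≥0∞} (hp : 1 ≤ p) :
    eLpNorm (scaledConv l g fun x => (K (v x) : ℂ)) p volume ≤
      ∑' j, eLpNorm (scaledConv l g fun x => (compDiff P K (fun x => (v x : ℂ)) j x : ℂ))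
        p volume := by
  set V : E N → ℂ := fun x => (v x : ℂ) with hVdef
  set R := (eLpNorm V ⊤ volume).toReal with hR
  have hVR : ∀ᵐ y, ‖V y‖ ≤ R := by
    filter_upwards [ae_le_eLpNormEssSup (f := V) (μ := volume)] with y hy
    rw [← toReal_enorm, hR]
    exact ENNReal.toReal_mono hv.2.ne (by rwa [eLpNorm_exponent_top])
  have hR0 : 0 ≤ R := ENNReal.toReal_nonneg
  have ht := Tame.of_memLp_top hv
  have htc : ∀ j, Tame fun x => (compDiff P K V j x : ℂ) := fun j =>
    Tame.of_memLp_top (memLp_compDiff hK hv hR0 hVR j)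
  obtain ⟨M, hM0, hM⟩ := norm_iteratedFDeriv_scaledConv_le (kernel P.symχ) 0
  have hw : ∀ (j : ℤ) (x : E N), (lowConv P j V x).re ∈ Metric.closedBall (0 : ℝ) (M * R) :=
    fun j x => by
      have := hM _ (two_zpow_pos j) R hR0 V hv.1 hVR x
      rw [norm_iteratedFDeriv_zero, pow_zero, mul_one] at this
      rw [mem_closedBall_zero_iff]
      exact (Complex.abs_re_le_norm _).trans this
  -- All cut-offs take values in one ball, uniformly in `j`. Hence the telescoped partial sums are
  -- bounded by `B + B`, which permits dominated convergence under the convolution.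
  obtain ⟨B, hB⟩ := (isCompact_closedBall (0 : ℝ) (M * R)).exists_bound_of_continuousOn
    hK.continuous.continuousOn
  have hlim : ∀ x, Tendsto (fun n : ℕ => ∑ j ∈ Finset.Ico (-(n : ℤ)) n,
      scaledConv l g (fun x => (compDiff P K V j x : ℂ)) x) atTop
      (𝓝 (scaledConv l g (fun x => (K (v x) : ℂ)) x)) := by
    intro x
    have := tendsto_scaledConv g hl
      (V := fun (n : ℕ) y => ∑ j ∈ Finset.Ico (-(n : ℤ)) n, (compDiff P K V j y : ℂ))
      (W := fun x => (K (v x) : ℂ)) (R := B + B)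
      (fun n => Finset.aestronglyMeasurable_fun_sum _ fun j _ => (htc j).meas)
      (fun n y => by
        rw [← Complex.ofReal_sum, sum_compDiff, Complex.norm_real]
        exact (norm_sub_le _ _).trans (add_le_add (hB _ (hw _ _)) (hB _ (hw _ _))))
      (by
        filter_upwards [h1, h2] with y hy1 hy2
        simp only [← Complex.ofReal_sum, sum_compDiff]
        refine (Complex.continuous_ofReal.tendsto _).comp ?_
        have e1 := (hK.continuous.tendsto _).comp ((Complex.continuous_re.tendsto _).comp hy1)
        have e2 := (hK.continuous.tendsto _).comp ((Complex.continuous_re.tendsto _).comp hy2)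
        rw [Complex.ofReal_re] at e1
        -- Here `K(0) = 0` removes the lower end of the telescoping sum.
        rw [Complex.zero_re, hK0] at e2
        simpa using e1.sub e2) x
    refine this.congr fun n => ?_
    exact scaledConv_fun_sum _ g hl (fun j _ => htc j) x
  have hm : ∀ j, AEStronglyMeasurable (scaledConv l g fun x => (compDiff P K V j x : ℂ)) volume :=
    fun j => (continuous_scaledConv hl (htc j) g).aestronglyMeasurable
  -- Fatou's lemma: only a bound is needed, so the series need not converge in `L^p`.
  refine Lp.eLpNorm_le_of_ae_tendsto (u := atTop)
    (f := fun (n : ℕ) x => ∑ j ∈ Finset.Ico (-(n : ℤ)) n,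
      scaledConv l g (fun x => (compDiff P K V j x : ℂ)) x)
    (Eventually.of_forall fun n => ?_)
    (fun n => Finset.aestronglyMeasurable_fun_sum _ fun j _ => hm j)
    (Eventually.of_forall hlim)
  refine le_trans ?_ (ENNReal.sum_le_tsum (Finset.Ico (-(n : ℤ)) n))
  refine le_trans (le_of_eq ?_) (eLpNorm_sum_le (fun j _ => hm j) hp)
  congr 1
  ext x
  rw [Finset.sum_apply]

end HybridBesov

end

/-! ### The hybrid weight, almost orthogonality, and composition at a fixed time -/

open MeasureTheory Filter Topology Set
open scoped ENNReal NNReal SchwartzMap ContDiff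

noncomputable section

namespace HybridBesov

variable {N : ℕ} {P : LPCouple N}

theorem two_rpow_ne_zero (a : ℝ) : (2 : ℝ≥0∞) ^ a ≠ 0 := by simp [ENNReal.rpow_eq_zero_iff]

theorem two_rpow_ne_top (a : ℝ) : (2 : ℝ≥0∞) ^ a ≠ ⊤ := by simp [ENNReal.rpow_eq_top_iff]

theorem two_rpow_add (a b : ℝ) : (2 : ℝ≥0∞) ^ (a + b) = 2 ^ a * 2 ^ b :=
  ENNReal.rpow_add _ _ (by simp) (by simp)

theorem two_rpow_le {a b : ℝ} (h : a ≤ b) : (2 : ℝ≥0∞) ^ a ≤ 2 ^ b :=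
  ENNReal.rpow_le_rpow_of_exponent_le (by norm_num) h

/-- The weight of the hybrid norm: `2 ^ (q * (N / 2 + s))` at low frequencies and
`2 ^ (q * N / 2)` at high frequencies. -/
def hybridWeight (N : ℕ) (s : ℝ) (q : ℤ) : ℝ≥0∞ :=
  (2 : ℝ≥0∞) ^ ((q : ℝ) * (N / 2) + min (q : ℝ) 0 * s)

/-- The off-diagonal decay `2 ^ (-|d|)`. -/
def decay (d : ℤ) : ℝ≥0∞ := (2 : ℝ≥0∞) ^ (-|(d : ℝ)|)

theorem tsum_decay_lt_top : ∑' d, decay d < ⊤ := by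
  have h1 : ∀ d, decay d = (((1 / 2 : ℝ≥0) ^ d.natAbs : ℝ≥0) : ℝ≥0∞) := fun d => by
    have h2 : |(d : ℝ)| = (d.natAbs : ℝ) := by
      rw [Nat.cast_natAbs, Int.cast_abs]
    rw [decay, h2, ENNReal.rpow_neg, ENNReal.rpow_natCast, ENNReal.coe_pow, one_div,
      ENNReal.coe_inv two_ne_zero, ENNReal.inv_pow, ENNReal.coe_ofNat]
  have hg : Summable fun n : ℕ => (1 / 2 : ℝ) ^ n := summable_geometric_two
  have hs : Summable fun d : ℤ => (1 / 2 : ℝ) ^ d.natAbs := by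
    refine Summable.of_nat_of_neg ?_ ?_
    · simpa only [Int.natAbs_natCast] using hg
    · simpa only [Int.natAbs_neg, Int.natAbs_natCast] using hg
  rw [tsum_congr h1, lt_top_iff_ne_top]
  refine ENNReal.tsum_coe_ne_top_iff_summable.2 (NNReal.summable_coe.1 ?_)
  simpa only [NNReal.coe_pow, NNReal.coe_div, NNReal.coe_one, NNReal.coe_ofNat] using hs

/-- The exponent of the weight has slope at least `N / 2 ≥ 1`, as `min(q, 0) s` is nondecreasing.
Below the diagonal the weight alone therefore gives the decay. -/
theorem hybridWeight_le_of_le (hN : 2 ≤ N) {s : ℝ} (hs : 0 ≤ s) {q j : ℤ} (h : q ≤ j) :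
    hybridWeight N s q ≤ decay (q - j) * hybridWeight N s j := by
  rw [hybridWeight, hybridWeight, decay, ← two_rpow_add]
  refine two_rpow_le ?_
  have hN' : (2 : ℝ) ≤ N := by exact_mod_cast hN
  have h' : (q : ℝ) ≤ j := by exact_mod_cast h
  have h1 : min (q : ℝ) 0 * s ≤ min (j : ℝ) 0 * s := by gcongr
  push_cast
  rw [abs_of_nonpos (by linarith)]
  nlinarith

/-- The exponent of the weight has slope at most `N / 2 + s`, so `k` derivatives overcome its growth
with at least one power of `2^{q-j}` to spare. -/
theorem hybridWeight_mul_le_of_lt {s : ℝ} (hs : 0 ≤ s) {q j : ℤ} (h : j < q)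
    {k : ℕ} (hk : (N : ℝ) / 2 + s + 1 ≤ k) :
    hybridWeight N s q * (2 : ℝ≥0∞) ^ (((j : ℝ) - q) * k) ≤
      decay (q - j) * hybridWeight N s j := by
  rw [hybridWeight, hybridWeight, decay, ← two_rpow_add, ← two_rpow_add]
  refine two_rpow_le ?_
  have h' : (j : ℝ) < q := by exact_mod_cast h
  have h1 : (min (q : ℝ) 0 - min (j : ℝ) 0) * s ≤ ((q : ℝ) - j) * s := by
    refine mul_le_mul_of_nonneg_right ?_ hs
    rcases le_total (q : ℝ) 0 with h2 | h2 <;> rcases le_total (j : ℝ) 0 with h3 | h3 <;>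
      simp only [h2, h3, min_eq_left, min_eq_right] <;> linarith
  have h2 : ((q : ℝ) - j) * ((N : ℝ) / 2 + s + 1) ≤ ((q : ℝ) - j) * k :=
    mul_le_mul_of_nonneg_left hk (by linarith)
  push_cast
  rw [abs_of_nonneg (by linarith)]
  nlinarith

/-- Almost orthogonality of the dyadic blocks of the increments, in the hybrid norm. -/
theorem hybridWeight_mul_eLpNorm_compDiff_le (hN : 2 ≤ N) (P : LPCouple N) {s : ℝ} (hs : 0 ≤ s)
    {K : ℝ → ℝ} (hK : ContDiff ℝ ∞ K) {R : ℝ} (hR : 0 ≤ R) :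
    ∃ C : ℝ≥0∞, C < ⊤ ∧ ∀ V : E N → ℂ, MemLp V ⊤ volume → (∀ᵐ y, ‖V y‖ ≤ R) → ∀ q j : ℤ,
      hybridWeight N s q *
        eLpNorm (dyadConv P q fun x => (compDiff P K V j x : ℂ)) 2 volume ≤
      C * (decay (q - j) * (hybridWeight N s j * eLpNorm (dyadConv P j V) 2 volume)) := by
  obtain ⟨k, hk⟩ := exists_nat_ge ((N : ℝ) / 2 + s + 1)
  obtain ⟨C₀, hC₀, hb₀⟩ := eLpNorm_dyadConv_compDiff_le P hK 0 hR
  obtain ⟨C₁, hC₁, hb₁⟩ := eLpNorm_dyadConv_compDiff_le P hK k hR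
  refine ⟨max C₀ C₁, max_lt hC₀ hC₁, fun V hV hVR q j => ?_⟩
  rcases le_or_gt q j with h | h
  · have h1 := hb₀ V hV hVR q j
    rw [pow_zero, pow_zero, one_mul, one_mul] at h1
    calc _ ≤ (decay (q - j) * hybridWeight N s j) *
          (C₀ * eLpNorm (dyadConv P j V) 2 volume) :=
        mul_le_mul' (hybridWeight_le_of_le hN hs h) h1
      _ = C₀ * (decay (q - j) * (hybridWeight N s j * eLpNorm (dyadConv P j V) 2 volume)) := by
        ring
      _ ≤ _ := by gcongr; exact le_max_left _ _
  · have h1 := hb₁ V hV hVR q j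
    have e : ∀ i : ℤ, ENNReal.ofReal ((2 : ℝ) ^ i) ^ k = (2 : ℝ≥0∞) ^ ((i : ℝ) * k) := fun i => by
      rw [ofReal_two_zpow, ← ENNReal.rpow_mul_natCast]
    rw [e, e] at h1
    have h2 : ∀ X : ℝ≥0∞, X = (2 : ℝ≥0∞) ^ (-((q : ℝ) * k)) * ((2 : ℝ≥0∞) ^ ((q : ℝ) * k) * X) :=
      fun X => by
        rw [← mul_assoc, ← two_rpow_add, neg_add_cancel, ENNReal.rpow_zero, one_mul]
    rw [h2 (eLpNorm (dyadConv P q fun x => (compDiff P K V j x : ℂ)) 2 volume)]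
    calc _ ≤ hybridWeight N s q * ((2 : ℝ≥0∞) ^ (-((q : ℝ) * k)) *
          (C₁ * ((2 : ℝ≥0∞) ^ ((j : ℝ) * k) * eLpNorm (dyadConv P j V) 2 volume))) := by gcongr
      _ = (hybridWeight N s q * ((2 : ℝ≥0∞) ^ (-((q : ℝ) * k)) * (2 : ℝ≥0∞) ^ ((j : ℝ) * k))) *
          (C₁ * eLpNorm (dyadConv P j V) 2 volume) := by ring
      _ = (hybridWeight N s q * (2 : ℝ≥0∞) ^ (((j : ℝ) - q) * k)) *
          (C₁ * eLpNorm (dyadConv P j V) 2 volume) := by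
        rw [← two_rpow_add]
        congr 3
        ring
      _ ≤ (decay (q - j) * hybridWeight N s j) *
          (C₁ * eLpNorm (dyadConv P j V) 2 volume) := by
        exact mul_le_mul_left (hybridWeight_mul_le_of_lt hs h hk) _
      _ = C₁ * (decay (q - j) * (hybridWeight N s j * eLpNorm (dyadConv P j V) 2 volume)) := by
        ring
      _ ≤ _ := by gcongr; exact le_max_right _ _

theorem IsGivenBy.hasDensity {f : 𝓢'(E N, ℂ)} {v : E N → ℝ} (h : IsGivenBy f v)
    (hv : MemLp (fun x => (v x : ℂ)) ⊤ volume) : HasDensity f fun x => (v x : ℂ) :=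
  ⟨Tame.of_memLp_top hv, fun g => (h g).2⟩

theorem HasDensity.isGivenBy {f : 𝓢'(E N, ℂ)} {v : E N → ℝ} (h : HasDensity f fun x => (v x : ℂ)) :
    IsGivenBy f v :=
  fun g => ⟨integrable_schwartz_mul g h.tame, h.eq g⟩

theorem tendsto_two_rpow_atBot {a : ℝ} (ha : 0 < a) :
    Tendsto (fun q : ℤ => (2 : ℝ≥0∞) ^ ((q : ℝ) * a)) atBot (𝓝 0) := by
  have h1 : Tendsto (fun q : ℤ => (2 : ℝ) ^ ((q : ℝ) * a)) atBot (𝓝 0) := by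
    refine (tendsto_rpow_atBot_of_base_gt_one 2 one_lt_two).comp ?_
    exact (tendsto_intCast_atBot_iff.2 tendsto_id).atBot_mul_const ha
  have h2 := ENNReal.tendsto_ofReal h1
  rw [ENNReal.ofReal_zero] at h2
  refine h2.congr fun q => ?_
  rw [← ENNReal.ofReal_rpow_of_pos two_pos]
  simp

theorem tendsto_tsum_of_dominated {ι α : Type*} {l : Filter α} [l.IsCountablyGenerated]
    {f : α → ι → ℝ≥0∞} {g : ι → ℝ≥0∞} (bound : ι → ℝ≥0∞) (hb : ∀ a i, f a i ≤ bound i)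
    (hfin : ∑' i, bound i ≠ ⊤) (hlim : ∀ i, Tendsto (fun a => f a i) l (𝓝 (g i))) :
    Tendsto (fun a => ∑' i, f a i) l (𝓝 (∑' i, g i)) := by
  let _ : MeasurableSpace ι := ⊤
  simp only [← lintegral_count] at hfin ⊢
  exact tendsto_lintegral_filter_of_dominated_convergence bound
    (Eventually.of_forall fun _ => measurable_from_top)
    (Eventually.of_forall fun a => Eventually.of_forall (hb a)) hfin (Eventually.of_forall hlim)

theorem ae_norm_le_of_memLp_top {v : E N → ℝ} (hv : MemLp (fun x => (v x : ℂ)) ⊤ volume) :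
    ∀ᵐ x, ‖v x‖ ≤ (eLpNorm v ⊤ volume).toReal := by
  have h : eLpNorm v ⊤ volume = eLpNorm (fun x => (v x : ℂ)) ⊤ volume :=
    eLpNorm_congr_norm_ae (Eventually.of_forall fun x => (Complex.norm_real _).symm)
  have h2 := hv.2
  rw [← h] at h2
  filter_upwards [ae_le_eLpNormEssSup (f := v) (μ := volume)] with x hx
  rw [← toReal_enorm]
  exact ENNReal.toReal_mono h2.ne (by rwa [eLpNorm_exponent_top])

theorem memLp_comp {K : ℝ → ℝ} (hK : Continuous K) {v : E N → ℝ}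
    (hv : MemLp (fun x => (v x : ℂ)) ⊤ volume) :
    MemLp (fun x => (K (v x) : ℂ)) ⊤ volume := by
  have hb := ae_norm_le_of_memLp_top hv
  obtain ⟨B, hB⟩ := (isCompact_closedBall (0 : ℝ) (eLpNorm v ⊤ volume).toReal
    ).exists_bound_of_continuousOn hK.continuousOn
  have hvm : AEStronglyMeasurable v volume := by
    simpa using Complex.continuous_re.comp_aestronglyMeasurable hv.1
  refine memLp_top_of_bound ((Complex.continuous_ofReal.comp hK).comp_aestronglyMeasurable hvm) B ?_
  filter_upwards [hb] with x hx
  rw [Complex.norm_real]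
  exact hB _ (mem_closedBall_zero_iff.2 hx)

/-- Composition at a fixed time: `K (v)` is in `𝓢'_h`. -/
theorem memSh_comp (hN : 2 ≤ N) {K : ℝ → ℝ} (hK : ContDiff ℝ ∞ K) (hK0 : K 0 = 0)
    {f w : 𝓢'(E N, ℂ)} {v : E N → ℝ} (h : IsGivenBy f v) (hf : MemSh P f)
    (hB : besovNorm P (N / 2) f < ⊤) (hw : IsGivenBy w fun x => K (v x)) : MemSh P w := by
  obtain ⟨hv, -, h1, h2⟩ := h.bounded hf hB
  have hd := h.hasDensity hv
  have hKv := memLp_comp hK.continuous hv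
  have hwd := hw.hasDensity hKv
  set V : E N → ℂ := fun x => (v x : ℂ) with hVdef
  have hVR : ∀ᵐ y, ‖V y‖ ≤ (eLpNorm v ⊤ volume).toReal := by
    simpa only [hVdef, Complex.norm_real] using ae_norm_le_of_memLp_top hv
  have hR := ENNReal.toReal_nonneg (a := eLpNorm v ⊤ volume)
  obtain ⟨C, hC, hb⟩ := exists_norm_compDiff_le P hK hR
  have hF := memLp_compDiff (P := P) hK hv hR hVR
  have hFb : ∀ j x, ‖(compDiff P K V j x : ℂ)‖ₑ ≤ ENNReal.ofReal C * ‖dyadConv P j V x‖ₑ :=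
    fun j x => by
      rw [← ofReal_norm, ← ofReal_norm, ← ENNReal.ofReal_mul hC]
      exact ENNReal.ofReal_le_ofReal (hb V hv hVR j x)
  have hFp : ∀ j p, eLpNorm (fun x => (compDiff P K V j x : ℂ)) p volume ≤
      ENNReal.ofReal C * eLpNorm (dyadConv P j V) p volume := fun j p =>
    eLpNorm_le_mul_eLpNorm_of_ae_le_mul (Eventually.of_forall fun x => hb V hv hVR j x) p
  set c₁ := ∫⁻ x, ‖kernel P.symχ x‖ₑ
  set c₂ := eLpNorm (kernel P.symχ) 2 volume
  have hc₁ : c₁ < ⊤ := ((kernel P.symχ).integrable (μ := volume)).2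
  have hc₂ : c₂ < ⊤ := ((kernel P.symχ).memLp 2 volume).2
  have hBj : ∀ j, distNorm 2 (block P j f) = eLpNorm (dyadConv P j V) 2 volume := fun j =>
    distNorm_eq (hd.block (Or.inr rfl) hv j)
  have hBfin : ∀ j, eLpNorm (dyadConv P j V) 2 volume < ⊤ := fun j => by
    rw [← hBj]
    exact ENNReal.lt_top_of_mul_ne_top_right ((ENNReal.le_tsum j).trans_lt hB).ne
      (two_rpow_ne_zero _)
  -- Two bounds are combined: this one tends to zero as `q → -∞` for each fixed `j`, while `hdom` is
  -- uniform in `q` and summable in `j`.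
  have hlow : ∀ q j, eLpNorm (lowConv P q fun x => (compDiff P K V j x : ℂ)) ⊤ volume ≤
      (2 : ℝ≥0∞) ^ ((q : ℝ) * ((N : ℝ) / 2)) *
        (c₂ * (ENNReal.ofReal C * eLpNorm (dyadConv P j V) 2 volume)) := fun q j => by
    rw [eLpNorm_exponent_top]
    refine eLpNormEssSup_le_of_ae_enorm_bound (Eventually.of_forall fun x => ?_)
    refine (enorm_lowConv_le q (hF j).1 x).trans ?_
    rw [mul_assoc]
    gcongr
    exact hFp j 2
  have hsup : ∀ j, eLpNorm (dyadConv P j V) ⊤ volume ≤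
      (2 : ℝ≥0∞) ^ (N : ℝ) * c₂ * ((2 : ℝ≥0∞) ^ ((j : ℝ) * ((N : ℝ) / 2)) *
        distNorm 2 (block P j f)) := fun j => by
    rw [eLpNorm_exponent_top]
    refine eLpNormEssSup_le_of_ae_enorm_bound (Eventually.of_forall fun x => ?_)
    rw [← lowConv_dyadConv hv j]
    refine (enorm_lowConv_le (j + 2) (memLp_dyadConv (Or.inr rfl) hv j).1 x).trans (le_of_eq ?_)
    have : (2 : ℝ≥0∞) ^ (((j + 2 : ℤ) : ℝ) * ((N : ℝ) / 2)) =
        (2 : ℝ≥0∞) ^ (N : ℝ) * (2 : ℝ≥0∞) ^ ((j : ℝ) * ((N : ℝ) / 2)) := by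
      rw [← two_rpow_add]
      congr 1
      push_cast
      ring
    rw [this, hBj]
    simp only [mul_assoc, mul_left_comm]
    rfl
  have hdom : ∀ q j, eLpNorm (lowConv P q fun x => (compDiff P K V j x : ℂ)) ⊤ volume ≤
      c₁ * (ENNReal.ofReal C * ((2 : ℝ≥0∞) ^ (N : ℝ) * c₂ *
        ((2 : ℝ≥0∞) ^ ((j : ℝ) * ((N : ℝ) / 2)) * distNorm 2 (block P j f)))) := fun q j =>
    (eLpNorm_scaledConv_le_of (Or.inr rfl) _ (two_zpow_pos q) (hF j).1).trans (by
      gcongr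
      exact (hFp j ⊤).trans (by gcongr; exact hsup j))
  have hlim := tendsto_tsum_of_dominated (l := atBot) (g := fun _ => 0) _ hdom (by
    simp only [ENNReal.tsum_mul_left]
    have : (2 : ℝ≥0∞) ^ (N : ℝ) ≠ ⊤ := two_rpow_ne_top _
    have : besovNorm P (N / 2) f ≠ ⊤ := hB.ne
    exact ENNReal.mul_ne_top hc₁.ne (ENNReal.mul_ne_top ENNReal.ofReal_ne_top
      (ENNReal.mul_ne_top (ENNReal.mul_ne_top (by assumption) hc₂.ne) this)))
    (fun j => by
      have hfin : c₂ * (ENNReal.ofReal C * eLpNorm (dyadConv P j V) 2 volume) ≠ ⊤ :=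
        ENNReal.mul_ne_top hc₂.ne (ENNReal.mul_ne_top ENNReal.ofReal_ne_top (hBfin j).ne)
      have h3 := ENNReal.Tendsto.mul_const (tendsto_two_rpow_atBot (a := (N : ℝ) / 2)
        (by have : (2 : ℝ) ≤ N := by exact_mod_cast hN
            linarith)) (Or.inr hfin)
      rw [zero_mul] at h3
      exact tendsto_of_tendsto_of_tendsto_of_le_of_le tendsto_const_nhds h3 (fun _ => zero_le)
        (fun q => hlow q j))
  rw [tsum_zero] at hlim
  refine tendsto_of_tendsto_of_tendsto_of_le_of_le tendsto_const_nhds hlim (fun _ => zero_le)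
    fun q => ?_
  change distNorm ⊤ (cutoff P q w) ≤ _
  rw [distNorm_eq (hwd.cutoff (Or.inr rfl) hKv q)]
  exact eLpNorm_scaledConv_comp_le hK hK0 hv h1 h2 _ (two_zpow_pos q) le_top

/-- Composition at a fixed time: the dyadic blocks of `K (v)`. -/
theorem hybridWeight_mul_distNorm_comp_le (hN : 2 ≤ N) (P : LPCouple N) {s : ℝ} (hs : 0 ≤ s)
    {K : ℝ → ℝ} (hK : ContDiff ℝ ∞ K) (hK0 : K 0 = 0) {R : ℝ} (hR : 0 ≤ R) :
    ∃ C : ℝ≥0∞, C < ⊤ ∧ ∀ (f w : 𝓢'(E N, ℂ)) (v : E N → ℝ), IsGivenBy f v → MemSh P f →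
      besovNorm P (N / 2) f < ⊤ → (∀ᵐ x, ‖v x‖ ≤ R) → IsGivenBy w (fun x => K (v x)) → ∀ q,
      hybridWeight N s q * distNorm 2 (block P q w) ≤
        C * ∑' j, decay (q - j) * (hybridWeight N s j * distNorm 2 (block P j f)) := by
  obtain ⟨C, hC, hb⟩ := hybridWeight_mul_eLpNorm_compDiff_le hN P hs hK hR
  refine ⟨C, hC, fun f w v h hf hB hvR hw q => ?_⟩
  obtain ⟨hv, -, h1, h2⟩ := h.bounded hf hB
  have hd := h.hasDensity hv
  have hKv := memLp_comp hK.continuous hv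
  have hwd := hw.hasDensity hKv
  rw [distNorm_eq (hwd.block (Or.inr rfl) hKv q)]
  have h3 := eLpNorm_scaledConv_comp_le (P := P) hK hK0 hv h1 h2 (kernel P.symφ) (two_zpow_pos q)
    (p := 2) one_le_two
  calc _ ≤ hybridWeight N s q * _ := mul_le_mul_right h3 _
    _ ≤ _ := by
      rw [← ENNReal.tsum_mul_left, ← ENNReal.tsum_mul_left]
      refine ENNReal.tsum_le_tsum fun j => ?_
      rw [distNorm_eq (hd.block (Or.inr rfl) hv j)]
      exact hb _ hv (by simpa only [Complex.norm_real] using hvR) q j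

end HybridBesov

end

/-! ### Low and high parts compared with the hybrid weight -/

open MeasureTheory Filter Topology Set
open scoped ENNReal NNReal SchwartzMap ContDiff

noncomputable section

namespace HybridBesov

variable {N : ℕ} {P : LPCouple N}

theorem distNorm_zero {p : ℝ≥0∞} [Fact (1 ≤ p)] : distNorm p (0 : 𝓢'(E N, ℂ)) = 0 := by
  rw [distNorm_eq HasDensity.zero]
  exact eLpNorm_zero'

theorem exists_density {p : ℝ≥0∞} [Fact (1 ≤ p)] (hp : p = 2 ∨ p = ⊤) {f : 𝓢'(E N, ℂ)}
    (hf : distNorm p f < ⊤) : ∃ V, HasDensity f V ∧ MemLp V p volume :=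
  exists_density_of_distNorm_lt_top (fun _ => tame_of_memLp hp) hf

theorem distNorm_add_le {p : ℝ≥0∞} [hp1 : Fact (1 ≤ p)] (hp : p = 2 ∨ p = ⊤) (f g : 𝓢'(E N, ℂ)) :
    distNorm p (f + g) ≤ distNorm p f + distNorm p g := by
  rcases eq_top_or_lt_top (distNorm p f) with h | hf
  · rw [h, top_add]; exact le_top
  rcases eq_top_or_lt_top (distNorm p g) with h | hg
  · rw [h, add_top]; exact le_top
  obtain ⟨V, hV, hVm⟩ := exists_density hp hf
  obtain ⟨W, hW, hWm⟩ := exists_density hp hg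
  rw [distNorm_eq hV, distNorm_eq hW, distNorm_eq (hV.add hW)]
  exact eLpNorm_add_le hVm.1 hWm.1 hp1.out

theorem distNorm_sub_le {p : ℝ≥0∞} [hp1 : Fact (1 ≤ p)] (hp : p = 2 ∨ p = ⊤) (f g : 𝓢'(E N, ℂ)) :
    distNorm p (f - g) ≤ distNorm p f + distNorm p g := by
  rcases eq_top_or_lt_top (distNorm p f) with h | hf
  · rw [h, top_add]; exact le_top
  rcases eq_top_or_lt_top (distNorm p g) with h | hg
  · rw [h, add_top]; exact le_top
  obtain ⟨V, hV, hVm⟩ := exists_density hp hf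
  obtain ⟨W, hW, hWm⟩ := exists_density hp hg
  rw [distNorm_eq hV, distNorm_eq hW, distNorm_eq (hV.sub hW)]
  exact eLpNorm_sub_le hVm.1 hWm.1 hp1.out

/-- A bound for the low-frequency cut-offs on `L²` and `L^∞`. -/
def cutoffBound (P : LPCouple N) : ℝ≥0∞ := 1 + ∫⁻ x, ‖kernel P.symχ x‖ₑ

theorem cutoffBound_lt_top (P : LPCouple N) : cutoffBound P < ⊤ :=
  ENNReal.add_lt_top.2 ⟨ENNReal.one_lt_top, ((kernel P.symχ).integrable (μ := volume)).2⟩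

theorem distNorm_cutoff_le {p : ℝ≥0∞} [Fact (1 ≤ p)] (hp : p = 2 ∨ p = ⊤) (q : ℤ)
    (f : 𝓢'(E N, ℂ)) : distNorm p (cutoff P q f) ≤ cutoffBound P * distNorm p f := by
  rcases eq_top_or_lt_top (distNorm p f) with h | hf
  -- The summand one in `cutoffBound` keeps the constant nonzero, so its product with `∞` is `∞`.
  · rw [h, ENNReal.mul_top (by simp [cutoffBound])]; exact le_top
  obtain ⟨V, hV, hVm⟩ := exists_density hp hf
  rw [distNorm_eq hV, distNorm_eq (hV.cutoff hp hVm q)]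
  refine (eLpNorm_scaledConv_le_of hp _ (two_zpow_pos q) hVm.1).trans ?_
  gcongr
  exact le_add_self

theorem MemSh.cutoff {f : 𝓢'(E N, ℂ)} (hf : MemSh P f) (j : ℤ) :
    MemSh P (HybridBesov.cutoff P j f) := by
  have h := ENNReal.Tendsto.const_mul hf (Or.inr (cutoffBound_lt_top P).ne)
  rw [mul_zero] at h
  refine tendsto_of_tendsto_of_tendsto_of_le_of_le tendsto_const_nhds h (fun _ => zero_le)
    fun q => ?_
  change distNorm ⊤ (HybridBesov.cutoff P q (HybridBesov.cutoff P j f)) ≤ _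
  rw [cutoff_comm]
  exact distNorm_cutoff_le (Or.inr rfl) j _

theorem MemSh.sub {f g : 𝓢'(E N, ℂ)} (hf : MemSh P f) (hg : MemSh P g) : MemSh P (f - g) := by
  have h := hf.add hg
  rw [add_zero] at h
  refine tendsto_of_tendsto_of_tendsto_of_le_of_le tendsto_const_nhds h (fun _ => zero_le)
    fun q => ?_
  change distNorm ⊤ (HybridBesov.cutoff P q (f - g)) ≤ _
  rw [map_sub]
  exact distNorm_sub_le (Or.inr rfl) _ _

theorem MemSh.lowPart {f : 𝓢'(E N, ℂ)} (hf : MemSh P f) : MemSh P (lowPart P f) := by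
  rw [hf.lowPart_eq]
  exact hf.cutoff 1

theorem MemSh.highPart {f : 𝓢'(E N, ℂ)} (hf : MemSh P f) : MemSh P (highPart P f) :=
  hf.sub hf.lowPart

theorem lowPart_add_highPart (f : 𝓢'(E N, ℂ)) : lowPart P f + highPart P f = f :=
  add_sub_cancel _ _

theorem MemSh.block_lowPart {f : 𝓢'(E N, ℂ)} (hf : MemSh P f) {q : ℤ} (hq : 2 ≤ q) :
    block P q (HybridBesov.lowPart P f) = 0 := by
  rw [hf.lowPart_eq, ← cutoff_block_comm]
  exact cutoff_block_eq_zero P hq f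

theorem MemSh.block_highPart {f : 𝓢'(E N, ℂ)} (hf : MemSh P f) {q : ℤ} (hq : q ≤ -1) :
    block P q (HybridBesov.highPart P f) = 0 := by
  rw [HybridBesov.highPart, map_sub, hf.lowPart_eq, ← cutoff_block_comm,
    cutoff_block_eq_self P (by omega), sub_self]

theorem MemSh.distNorm_block_lowPart_le {f : 𝓢'(E N, ℂ)} (hf : MemSh P f) (q : ℤ) :
    distNorm 2 (block P q (HybridBesov.lowPart P f)) ≤
      cutoffBound P * distNorm 2 (block P q f) := by
  rw [hf.lowPart_eq, ← cutoff_block_comm]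
  exact distNorm_cutoff_le (Or.inl rfl) 1 _

/-- Only `q ≤ 1` contributes, because `S_1 Δ_q = 0` for `q ≥ 2`. There `q ≤ min(q, 0) + 1`, which
costs the factor `2^s`. -/
theorem MemSh.lowPart_weight_le {f : 𝓢'(E N, ℂ)} (hf : MemSh P f) {s : ℝ} (hs : 0 ≤ s) (q : ℤ) :
    (2 : ℝ≥0∞) ^ ((q : ℝ) * ((N : ℝ) / 2 + s)) *
        distNorm 2 (block P q (HybridBesov.lowPart P f)) ≤
      2 ^ s * cutoffBound P * (hybridWeight N s q * distNorm 2 (block P q f)) := by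
  rcases le_or_gt 2 q with hq | hq
  · rw [hf.block_lowPart hq, distNorm_zero, mul_zero]
    exact zero_le
  · have h1 : (2 : ℝ≥0∞) ^ ((q : ℝ) * ((N : ℝ) / 2 + s)) ≤ 2 ^ s * hybridWeight N s q := by
      rw [hybridWeight, ← two_rpow_add]
      refine two_rpow_le ?_
      have hq' : (q : ℝ) ≤ 1 := by exact_mod_cast (by omega : q ≤ 1)
      have : (q : ℝ) * s ≤ (min (q : ℝ) 0 + 1) * s := by
        gcongr
        rcases le_total (q : ℝ) 0 with h | h <;> simp only [h, min_eq_left, min_eq_right] <;>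
          linarith
      nlinarith
    refine (mul_le_mul' h1 (hf.distNorm_block_lowPart_le q)).trans_eq ?_
    ring

/-- Only `q ≥ 0` contributes, because `S_1 Δ_q = Δ_q` for `q ≤ -1`; on that range the two weights
coincide. -/
theorem MemSh.highPart_weight_le {f : 𝓢'(E N, ℂ)} (hf : MemSh P f) (s : ℝ) (q : ℤ) :
    (2 : ℝ≥0∞) ^ ((q : ℝ) * ((N : ℝ) / 2)) * distNorm 2 (block P q (HybridBesov.highPart P f)) ≤
      (1 + cutoffBound P) * (hybridWeight N s q * distNorm 2 (block P q f)) := by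
  rcases le_or_gt q (-1) with hq | hq
  · rw [hf.block_highPart hq, distNorm_zero, mul_zero]
    exact zero_le
  · have h1 : hybridWeight N s q = (2 : ℝ≥0∞) ^ ((q : ℝ) * ((N : ℝ) / 2)) := by
      have hq' : (0 : ℝ) ≤ q := by exact_mod_cast (by omega : 0 ≤ q)
      rw [hybridWeight, min_eq_right hq', zero_mul, add_zero]
    have h2 : distNorm 2 (block P q (HybridBesov.highPart P f)) ≤
        (1 + cutoffBound P) * distNorm 2 (block P q f) := by
      rw [HybridBesov.highPart, map_sub, add_mul, one_mul]
      exact (distNorm_sub_le (Or.inl rfl) _ _).trans (by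
        gcongr
        exact hf.distNorm_block_lowPart_le q)
    rw [h1, mul_left_comm]
    gcongr

/-- The low weight dominates the hybrid one everywhere; the high weight equals it for `q ≥ 0`, and
for `q ≤ -1` the high part has no block. -/
theorem MemSh.hybridWeight_le {f : 𝓢'(E N, ℂ)} (hf : MemSh P f) {s : ℝ} (hs : 0 ≤ s) (q : ℤ) :
    hybridWeight N s q * distNorm 2 (block P q f) ≤
      (2 : ℝ≥0∞) ^ ((q : ℝ) * ((N : ℝ) / 2 + s)) *
        distNorm 2 (block P q (HybridBesov.lowPart P f)) +
      (2 : ℝ≥0∞) ^ ((q : ℝ) * ((N : ℝ) / 2)) *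
        distNorm 2 (block P q (HybridBesov.highPart P f)) := by
  have h0 : block P q f = block P q (HybridBesov.lowPart P f) +
      block P q (HybridBesov.highPart P f) := by rw [← map_add, lowPart_add_highPart]
  have h1 : hybridWeight N s q ≤ (2 : ℝ≥0∞) ^ ((q : ℝ) * ((N : ℝ) / 2 + s)) := by
    refine two_rpow_le ?_
    have : min (q : ℝ) 0 * s ≤ q * s := by gcongr; exact min_le_left _ _
    linarith
  rcases le_or_gt q (-1) with hq | hq
  · rw [h0, hf.block_highPart hq, add_zero, distNorm_zero, mul_zero, add_zero]
    gcongr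
  · have h2 : hybridWeight N s q = (2 : ℝ≥0∞) ^ ((q : ℝ) * ((N : ℝ) / 2)) := by
      have hq' : (0 : ℝ) ≤ q := by exact_mod_cast (by omega : 0 ≤ q)
      rw [hybridWeight, min_eq_right hq', zero_mul, add_zero]
    calc _ ≤ hybridWeight N s q * (distNorm 2 (block P q (HybridBesov.lowPart P f)) +
          distNorm 2 (block P q (HybridBesov.highPart P f))) := by
          gcongr
          rw [h0]
          exact distNorm_add_le (Or.inl rfl) _ _
      _ ≤ _ := by
        rw [mul_add]
        gcongr
        exact h2.le

/-! ### Norms in time: Minkowski, Schur's test and measurability -/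

section Time

variable {α : Type*} [MeasurableSpace α] {μ : Measure α}

theorem eLpNorm_ennreal_const_mul {c : ℝ≥0∞} (hc : c ≠ ⊤) (f : α → ℝ≥0∞) (p : ℝ≥0∞) :
    eLpNorm (fun t => c * f t) p μ = c * eLpNorm f p μ := by
  rcases eq_or_ne p 0 with rfl | hp0
  · simp
  rcases eq_or_ne p ⊤ with rfl | hp
  · simp only [eLpNorm_exponent_top, eLpNormEssSup, enorm_eq_self]
    exact ENNReal.essSup_const_mul
  · have hr := ENNReal.toReal_pos hp0 hp
    rw [eLpNorm_eq_lintegral_rpow_enorm_toReal hp0 hp, eLpNorm_eq_lintegral_rpow_enorm_toReal hp0 hp]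
    simp only [enorm_eq_self, ENNReal.mul_rpow_of_nonneg _ _ hr.le]
    rw [lintegral_const_mul' _ _ (ENNReal.rpow_ne_top_of_nonneg hr.le hc),
      ENNReal.mul_rpow_of_nonneg _ _ (by positivity), ← ENNReal.rpow_mul,
      mul_one_div_cancel hr.ne', ENNReal.rpow_one]

/-- Minkowski's inequality for countable sums of nonnegative functions. -/
theorem eLpNorm_tsum_int_le {p : ℝ≥0∞} (hp : 1 ≤ p) {f : ℤ → α → ℝ≥0∞}
    (hf : ∀ j, AEMeasurable (f j) μ) :
    eLpNorm (fun t => ∑' j, f j t) p μ ≤ ∑' j, eLpNorm (f j) p μ := by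
  have hp0 : p ≠ 0 := (zero_lt_one.trans_le hp).ne'
  rcases eq_or_ne p ⊤ with rfl | hp'
  · simp only [eLpNorm_exponent_top]
    refine eLpNormEssSup_le_of_ae_enorm_bound ?_
    have h1 : ∀ᵐ t ∂μ, ∀ j, f j t ≤ eLpNormEssSup (f j) μ := by
      rw [ae_all_iff]
      intro j
      simpa only [enorm_eq_self] using ae_le_eLpNormEssSup (f := f j) (μ := μ)
    filter_upwards [h1] with t ht
    rw [enorm_eq_self]
    exact ENNReal.tsum_le_tsum ht
  -- For finite `p`, monotone convergence along the intervals `[-n, n)` reduces to finite sums.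
  · have hr := ENNReal.toReal_pos hp0 hp'
    set F : ℕ → α → ℝ≥0∞ := fun n t => ∑ j ∈ Finset.Ico (-(n : ℤ)) n, f j t with hF
    have hFm : ∀ n, AEMeasurable (F n) μ := fun n =>
      Finset.aemeasurable_fun_sum _ fun j _ => hf j
    have hle : ∀ n, eLpNorm (F n) p μ ≤ ∑' j, eLpNorm (f j) p μ := fun n => by
      have h := eLpNorm_sum_le (s := Finset.Ico (-(n : ℤ)) n) (μ := μ) (p := p)
        (fun j _ => (hf j).aestronglyMeasurable) hp
      refine le_trans (le_of_eq ?_) (h.trans (ENNReal.sum_le_tsum _))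
      congr 1
      ext t
      rw [Finset.sum_apply]
    have hmono : ∀ t, Monotone fun n => F n t := fun t m n hmn =>
      Finset.sum_le_sum_of_subset (Finset.Ico_subset_Ico (by omega) (by omega))
    have h1 := lintegral_tendsto_of_tendsto_of_monotone (μ := μ)
      (f := fun n t => F n t ^ p.toReal) (F := fun t => (∑' j, f j t) ^ p.toReal)
      (fun n => (hFm n).pow_const _)
      (Eventually.of_forall fun t m n hmn => ENNReal.rpow_le_rpow (hmono t hmn) hr.le)
      (Eventually.of_forall fun t => (ENNReal.continuous_rpow_const.tendsto _).comp
        (ENNReal.summable.hasSum.comp Finset.tendsto_Ico_neg))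
    have h2 := ((ENNReal.continuous_rpow_const (y := 1 / p.toReal)).tendsto _).comp h1
    rw [eLpNorm_eq_lintegral_rpow_enorm_toReal hp0 hp']
    simp only [enorm_eq_self]
    refine le_of_tendsto' h2 fun n => ?_
    have h3 := hle n
    rw [eLpNorm_eq_lintegral_rpow_enorm_toReal hp0 hp'] at h3
    simp only [enorm_eq_self] at h3
    exact h3

/-- Schur's test for the kernel `decay (q - j)` in `ℓ¹ L^p`. -/
theorem tsum_eLpNorm_le_of_decay {p : ℝ≥0∞} (hp : 1 ≤ p) {C : ℝ≥0∞} (hC : C ≠ ⊤)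
    {b β : ℤ → α → ℝ≥0∞} (hβ : ∀ j, AEMeasurable (β j) μ)
    (h : ∀ q, ∀ᵐ t ∂μ, b q t ≤ C * ∑' j, decay (q - j) * β j t) :
    ∑' q, eLpNorm (b q) p μ ≤ C * (∑' d, decay d) * ∑' j, eLpNorm (β j) p μ := by
  have hd : ∀ d, decay d ≠ ⊤ := fun d => two_rpow_ne_top _
  calc ∑' q, eLpNorm (b q) p μ
      ≤ ∑' q, C * ∑' j, decay (q - j) * eLpNorm (β j) p μ := by
        refine ENNReal.tsum_le_tsum fun q => ?_
        refine (eLpNorm_mono_enorm_ae (g := fun t => C * ∑' j, decay (q - j) * β j t) ?_).trans ?_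
        · simpa only [enorm_eq_self] using h q
        rw [eLpNorm_ennreal_const_mul hC]
        gcongr
        refine (eLpNorm_tsum_int_le hp fun j => (hβ j).const_mul _).trans
          (ENNReal.tsum_le_tsum fun j => ?_)
        rw [eLpNorm_ennreal_const_mul (hd _)]
    _ = C * ∑' j, ∑' q, decay (q - j) * eLpNorm (β j) p μ := by
        rw [ENNReal.tsum_mul_left, ENNReal.tsum_comm]
    _ = _ := by
        rw [mul_assoc]
        congr 1
        rw [← ENNReal.tsum_mul_left]
        refine tsum_congr fun j => ?_
        rw [ENNReal.tsum_mul_right]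
        congr 1
        -- By translation, the column sums of the kernel do not depend on `j`.
        exact (Equiv.subRight j).tsum_eq decay

theorem stronglyMeasurable_scaledConv {V : α → E N → ℂ}
    (hV : StronglyMeasurable (Function.uncurry V)) (g : 𝓢(E N, ℂ)) (l : ℝ) :
    StronglyMeasurable (Function.uncurry fun t => scaledConv l g (V t)) := by
  have h1 : StronglyMeasurable fun z : (α × E N) × E N => V z.1.1 z.2 • g (l • (z.1.2 - z.2)) :=
    (hV.comp_measurable (measurable_fst.fst.prodMk measurable_snd)).smul
      (g.continuous.stronglyMeasurable.comp_measurable (by fun_prop))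
  exact (h1.integral_prod_right').const_smul _

theorem measurable_eLpNorm_two {W : α → E N → ℂ} (hW : StronglyMeasurable (Function.uncurry W)) :
    Measurable fun t => eLpNorm (W t) 2 volume := by
  simp only [eLpNorm_eq_lintegral_rpow_enorm_toReal two_ne_zero ENNReal.ofNat_ne_top]
  refine Measurable.pow_const (Measurable.lintegral_prod_right' (f := fun z : α × E N =>
    ‖W z.1 z.2‖ₑ ^ (2 : ℝ≥0∞).toReal) ?_) _
  exact hW.enorm.pow_const _

/-- The infimum defining `distNorm` has no evident measurability in time; a jointly measurable
density replaces it by an integral with a parameter. -/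
theorem aemeasurable_distNorm {F : α → 𝓢'(E N, ℂ)} {W : α → E N → ℂ}
    (hW : StronglyMeasurable (Function.uncurry W)) (h : ∀ᵐ t ∂μ, HasDensity (F t) (W t)) :
    AEMeasurable (fun t => distNorm 2 (F t)) μ := by
  refine (measurable_eLpNorm_two hW).aemeasurable.congr ?_
  filter_upwards [h] with t ht
  rw [distNorm_eq ht]

theorem aestronglyMeasurable_apply {F : α → 𝓢'(E N, ℂ)} {W : α → E N → ℂ}
    (hW : StronglyMeasurable (Function.uncurry W)) (h : ∀ᵐ t ∂μ, HasDensity (F t) (W t))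
    (g : 𝓢(E N, ℂ)) : AEStronglyMeasurable (fun t => F t g) μ := by
  have h1 : StronglyMeasurable fun z : α × E N => g z.2 * W z.1 z.2 :=
    (g.continuous.stronglyMeasurable.comp_measurable measurable_snd).mul hW
  refine (h1.integral_prod_right' (ν := volume)).aestronglyMeasurable.congr ?_
  filter_upwards [h] with t ht
  rw [ht.eq]

theorem exists_stronglyMeasurable_family [SFinite μ] {v : α → E N → ℝ}
    (hv : AEStronglyMeasurable (Function.uncurry v) (μ.prod (volume : Measure (E N)))) :
    ∃ v' : α → E N → ℝ, StronglyMeasurable (Function.uncurry v') ∧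
      ∀ᵐ t ∂μ, v t =ᵐ[volume] v' t := by
  refine ⟨fun t x => hv.mk _ (t, x), hv.stronglyMeasurable_mk, ?_⟩
  exact Measure.ae_ae_of_ae_prod hv.ae_eq_mk

end Time

theorem MemSh.lowPart_density {f : 𝓢'(E N, ℂ)} {V : E N → ℂ} (hf : MemSh P f)
    (hV : HasDensity f V) (hVm : MemLp V ⊤ volume) :
    HasDensity (HybridBesov.lowPart P f) (lowConv P 1 V) := by
  rw [hf.lowPart_eq]
  exact hV.cutoff (Or.inr rfl) hVm 1

theorem MemSh.highPart_density {f : 𝓢'(E N, ℂ)} {V : E N → ℂ} (hf : MemSh P f)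
    (hV : HasDensity f V) (hVm : MemLp V ⊤ volume) :
    HasDensity (HybridBesov.highPart P f) (fun x => V x - lowConv P 1 V x) :=
  hV.sub (hf.lowPart_density hV hVm)

end HybridBesov

end

/-! ### The composition estimate in Chemin–Lerner spaces -/

open MeasureTheory Filter Topology Set
open scoped ENNReal NNReal SchwartzMap ContDiff

noncomputable section

namespace HybridBesov

variable {N : ℕ} {P : LPCouple N}

theorem ae_besov_bounded {T : ℝ} {u : ℝ → 𝓢'(E N, ℂ)} {v : ℝ → E N → ℝ}
    (huv : ∀ᵐ t ∂timeMeasure T, IsGivenBy (u t) (v t))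
    (hu : MemLinftyBesov P T ((N : ℝ) / 2) u) :
    ∀ᵐ t ∂timeMeasure T, MemLp (fun x => (v t x : ℂ)) ⊤ volume ∧
      HasDensity (u t) (fun x => (v t x : ℂ)) := by
  filter_upwards [huv, hu.mem] with t h1 h2
  have h3 := (h1.bounded h2.1 h2.2).1
  exact ⟨h3, h1.hasDensity h3⟩

theorem supNorm_lt_top {T : ℝ} {u : ℝ → 𝓢'(E N, ℂ)} {v : ℝ → E N → ℝ}
    (huv : ∀ᵐ t ∂timeMeasure T, IsGivenBy (u t) (v t))
    (hu : MemLinftyBesov P T ((N : ℝ) / 2) u) : supNorm T v < ⊤ := by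
  have hk : (2 : ℝ≥0∞) ^ (N : ℝ) * eLpNorm (kernel P.symχ) 2 volume < ⊤ :=
    ENNReal.mul_lt_top (two_rpow_ne_top _).lt_top ((kernel P.symχ).memLp 2 volume).2
  refine lt_of_le_of_lt ?_ (ENNReal.mul_lt_top hk hu.bound)
  rw [← eLpNorm_ennreal_const_mul hk.ne]
  refine eLpNorm_mono_enorm_ae ?_
  filter_upwards [huv, hu.mem] with t h1 h2
  rw [enorm_eq_self, enorm_eq_self]
  exact (h1.bounded h2.1 h2.2).2.1

theorem ae_norm_le_supNorm {T : ℝ} {v : ℝ → E N → ℝ} (h : supNorm T v < ⊤) :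
    ∀ᵐ t ∂timeMeasure T, ∀ᵐ x, ‖v t x‖ ≤ ((supNorm T v).toNNReal : ℝ) := by
  filter_upwards [ae_le_eLpNormEssSup (f := fun t => eLpNorm (v t) ⊤ volume)
    (μ := timeMeasure T)] with t ht
  filter_upwards [ae_le_eLpNormEssSup (f := v t) (μ := volume)] with x hx
  rw [enorm_eq_self, ← eLpNorm_exponent_top (μ := timeMeasure T)] at ht
  rw [← eLpNorm_exponent_top] at hx
  rw [← toReal_enorm]
  exact ENNReal.toReal_mono h.ne (hx.trans ht)

/-- The sum of the blocks of `u` in the hybrid norm is controlled by its two parts. -/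
theorem tsum_hybrid_le {T : ℝ} {r : ℝ≥0∞} (hr : 1 ≤ r) {s : ℝ} (hs : 0 ≤ s)
    {u : ℝ → 𝓢'(E N, ℂ)} {V : ℝ → E N → ℂ} (hV : StronglyMeasurable (Function.uncurry V))
    (huV : ∀ᵐ t ∂timeMeasure T, HasDensity (u t) (V t) ∧ MemLp (V t) ⊤ volume ∧ MemSh P (u t)) :
    ∑' q, eLpNorm (fun t => hybridWeight N s q * distNorm 2 (block P q (u t))) r (timeMeasure T) ≤
      clNorm P T r ((N : ℝ) / 2 + s) (fun t => lowPart P (u t)) +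
        clNorm P T r ((N : ℝ) / 2) (fun t => highPart P (u t)) := by
  have hlow := stronglyMeasurable_scaledConv hV (kernel P.symχ) ((2 : ℝ) ^ (1 : ℤ))
  have hhigh : StronglyMeasurable (Function.uncurry fun t x => V t x - lowConv P 1 (V t) x) :=
    hV.sub hlow
  -- Measurability of both parts is required by the triangle inequality in `L^r`.
  have hm1 : ∀ q, AEMeasurable (fun t => distNorm 2 (block P q (lowPart P (u t))))
      (timeMeasure T) := fun q => by
    refine aemeasurable_distNorm (stronglyMeasurable_scaledConv hlow (kernel P.symφ)
      ((2 : ℝ) ^ q)) ?_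
    filter_upwards [huV] with t ht
    exact (ht.2.2.lowPart_density ht.1 ht.2.1).block (Or.inr rfl)
      (memLp_lowConv (Or.inr rfl) ht.2.1 1) q
  have hm2 : ∀ q, AEMeasurable (fun t => distNorm 2 (block P q (highPart P (u t))))
      (timeMeasure T) := fun q => by
    refine aemeasurable_distNorm (stronglyMeasurable_scaledConv hhigh (kernel P.symφ)
      ((2 : ℝ) ^ q)) ?_
    filter_upwards [huV] with t ht
    exact (ht.2.2.highPart_density ht.1 ht.2.1).block (Or.inr rfl)
      (ht.2.1.sub (memLp_lowConv (Or.inr rfl) ht.2.1 1)) q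
  unfold clNorm
  rw [← ENNReal.tsum_add]
  refine ENNReal.tsum_le_tsum fun q => ?_
  rw [← eLpNorm_ennreal_const_mul (two_rpow_ne_top _), ← eLpNorm_ennreal_const_mul (two_rpow_ne_top _)]
  refine le_trans ?_ (eLpNorm_add_le ((hm1 q).const_mul _).aestronglyMeasurable
    ((hm2 q).const_mul _).aestronglyMeasurable hr)
  refine eLpNorm_mono_enorm_ae ?_
  filter_upwards [huV] with t ht
  rw [enorm_eq_self, enorm_eq_self]
  exact ht.2.2.hybridWeight_le hs q

theorem clNorm_lowPart_le {T : ℝ} {r : ℝ≥0∞} {s : ℝ} (hs : 0 ≤ s) {w : ℝ → 𝓢'(E N, ℂ)}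
    (hw : ∀ᵐ t ∂timeMeasure T, MemSh P (w t)) :
    clNorm P T r ((N : ℝ) / 2 + s) (fun t => lowPart P (w t)) ≤ 2 ^ s * cutoffBound P *
      ∑' q, eLpNorm (fun t => hybridWeight N s q * distNorm 2 (block P q (w t))) r
        (timeMeasure T) := by
  have hc : 2 ^ s * cutoffBound P ≠ ⊤ :=
    ENNReal.mul_ne_top (two_rpow_ne_top _) (cutoffBound_lt_top P).ne
  unfold clNorm
  rw [← ENNReal.tsum_mul_left]
  refine ENNReal.tsum_le_tsum fun q => ?_
  rw [← eLpNorm_ennreal_const_mul (two_rpow_ne_top _), ← eLpNorm_ennreal_const_mul hc]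
  refine eLpNorm_mono_enorm_ae ?_
  filter_upwards [hw] with t ht
  rw [enorm_eq_self, enorm_eq_self]
  exact ht.lowPart_weight_le hs q

theorem clNorm_highPart_le {T : ℝ} {r : ℝ≥0∞} (s : ℝ) {w : ℝ → 𝓢'(E N, ℂ)}
    (hw : ∀ᵐ t ∂timeMeasure T, MemSh P (w t)) :
    clNorm P T r ((N : ℝ) / 2) (fun t => highPart P (w t)) ≤ (1 + cutoffBound P) *
      ∑' q, eLpNorm (fun t => hybridWeight N s q * distNorm 2 (block P q (w t))) r
        (timeMeasure T) := by
  have hc : 1 + cutoffBound P ≠ ⊤ :=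
    ENNReal.add_ne_top.2 ⟨ENNReal.one_ne_top, (cutoffBound_lt_top P).ne⟩
  unfold clNorm
  rw [← ENNReal.tsum_mul_left]
  refine ENNReal.tsum_le_tsum fun q => ?_
  rw [← eLpNorm_ennreal_const_mul (two_rpow_ne_top _), ← eLpNorm_ennreal_const_mul hc]
  refine eLpNorm_mono_enorm_ae ?_
  filter_upwards [hw] with t ht
  rw [enorm_eq_self, enorm_eq_self]
  exact ht.highPart_weight_le s q

/-- The composition estimate for functions bounded by `R`. -/
theorem exists_clNorm_comp_le (hN : 2 ≤ N) (P : LPCouple N) {s : ℝ} (hs : 0 ≤ s)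
    {K : ℝ → ℝ} (hK : ContDiff ℝ ∞ K) (hK0 : K 0 = 0) {R : ℝ} (hR : 0 ≤ R) :
    ∃ c : ℝ≥0, ∀ (r : ℝ≥0∞), 1 ≤ r → ∀ (T : ℝ) (u w : ℝ → 𝓢'(E N, ℂ)) (v : ℝ → E N → ℝ),
      AEStronglyMeasurable (Function.uncurry v)
        ((timeMeasure T).prod (volume : Measure (E N))) →
      (∀ᵐ t ∂timeMeasure T, IsGivenBy (u t) (v t)) →
      MemLinftyBesov P T ((N : ℝ) / 2) u →
      (∀ᵐ t ∂timeMeasure T, IsGivenBy (w t) (fun x => K (v t x)) ∧ MemSh P (w t)) →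
      (∀ᵐ t ∂timeMeasure T, ∀ᵐ x, ‖v t x‖ ≤ R) →
      clNorm P T r ((N : ℝ) / 2 + s) (fun t => lowPart P (w t)) ≤
        c * (clNorm P T r ((N : ℝ) / 2 + s) (fun t => lowPart P (u t)) +
          clNorm P T r ((N : ℝ) / 2) (fun t => highPart P (u t))) ∧
      clNorm P T r ((N : ℝ) / 2) (fun t => highPart P (w t)) ≤
        c * (clNorm P T r ((N : ℝ) / 2 + s) (fun t => lowPart P (u t)) +
          clNorm P T r ((N : ℝ) / 2) (fun t => highPart P (u t))) := by
  obtain ⟨C, hC, hb⟩ := hybridWeight_mul_distNorm_comp_le hN P hs hK hK0 hR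
  set A : ℝ≥0∞ := (2 ^ s * cutoffBound P + (1 + cutoffBound P)) with hA
  have hAtop : A < ⊤ := ENNReal.add_lt_top.2
    ⟨ENNReal.mul_lt_top (two_rpow_ne_top _).lt_top (cutoffBound_lt_top P),
      ENNReal.add_lt_top.2 ⟨ENNReal.one_lt_top, cutoffBound_lt_top P⟩⟩
  have hfin : A * (C * ∑' d, decay d) < ⊤ :=
    ENNReal.mul_lt_top hAtop (ENNReal.mul_lt_top hC tsum_decay_lt_top)
  refine ⟨(A * (C * ∑' d, decay d)).toNNReal, fun r hr T u w v hv huv hu hw hvR => ?_⟩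
  rw [ENNReal.coe_toNNReal hfin.ne]
  -- A jointly measurable representative; for almost every time it agrees with `v` almost everywhere
  -- in space, so it gives the same distribution.
  obtain ⟨v', hv', hvv⟩ := exists_stronglyMeasurable_family hv
  set V : ℝ → E N → ℂ := fun t x => (v' t x : ℂ) with hVdef
  have hV : StronglyMeasurable (Function.uncurry V) :=
    Complex.continuous_ofReal.comp_stronglyMeasurable hv'
  have huV : ∀ᵐ t ∂timeMeasure T, HasDensity (u t) (V t) ∧ MemLp (V t) ⊤ volume ∧
      MemSh P (u t) := by
    filter_upwards [ae_besov_bounded huv hu, hu.mem, hvv] with t h1 h2 h3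
    have h4 : (fun x => (v t x : ℂ)) =ᵐ[volume] V t := by
      filter_upwards [h3] with x hx
      rw [hx]
    exact ⟨h1.2.congr h4, h1.1.ae_eq h4, h2.1⟩
  have hβ : ∀ q, AEMeasurable (fun t => hybridWeight N s q * distNorm 2 (block P q (u t)))
      (timeMeasure T) := fun q => by
    refine AEMeasurable.const_mul (aemeasurable_distNorm
      (stronglyMeasurable_scaledConv hV (kernel P.symφ) ((2 : ℝ) ^ q)) ?_) _
    filter_upwards [huV] with t ht
    exact ht.1.block (Or.inr rfl) ht.2.1 q
  have hmain := tsum_eLpNorm_le_of_decay (μ := timeMeasure T) hr hC.ne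
    (b := fun q t => hybridWeight N s q * distNorm 2 (block P q (w t))) hβ (fun q => by
      filter_upwards [huv, hu.mem, hvR, hw] with t h1 h2 h3 h4
      exact hb (u t) (w t) (v t) h1 h2.1 h2.2 h3 h4.1 q)
  have hsum := hmain.trans (mul_le_mul_right (tsum_hybrid_le hr hs hV huV) _)
  have hwS : ∀ᵐ t ∂timeMeasure T, MemSh P (w t) := hw.mono fun t ht => ht.2
  constructor
  · refine (clNorm_lowPart_le hs hwS).trans ((mul_le_mul' (b := A) le_self_add hsum).trans_eq ?_)
    rw [mul_assoc A]
  · refine (clNorm_highPart_le s hwS).trans ((mul_le_mul' (b := A) le_add_self hsum).trans_eq ?_)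
    rw [mul_assoc A]

theorem exists_comp_distribution (hN : 2 ≤ N) {K : ℝ → ℝ} (hK : ContDiff ℝ ∞ K)
    (hK0 : K 0 = 0) {T : ℝ} {u : ℝ → 𝓢'(E N, ℂ)} {v : ℝ → E N → ℝ}
    (huv : ∀ᵐ t ∂timeMeasure T, IsGivenBy (u t) (v t))
    (hu : MemLinftyBesov P T ((N : ℝ) / 2) u) :
    ∃ w : ℝ → 𝓢'(E N, ℂ), ∀ᵐ t ∂timeMeasure T,
      IsGivenBy (w t) (fun x => K (v t x)) ∧ MemSh P (w t) := by
  classical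
  -- The default value zero is taken only on a null set of times: for almost every `t`, `K (v t)` is
  -- bounded and so defines a tempered distribution.
  refine ⟨fun t => if h : ∃ f : 𝓢'(E N, ℂ), IsGivenBy f (fun x => K (v t x)) then h.choose else 0,
    ?_⟩
  filter_upwards [ae_besov_bounded huv hu, huv, hu.mem] with t h1 h2 h3
  have h : ∃ f : 𝓢'(E N, ℂ), IsGivenBy f (fun x => K (v t x)) := by
    obtain ⟨f, hf⟩ := exists_hasDensity (Or.inr rfl) (memLp_comp hK.continuous h1.1)
    exact ⟨f, hf.isGivenBy⟩
  rw [dif_pos h]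
  exact ⟨h.choose_spec, memSh_comp hN hK hK0 h2 h3.1 h3.2 h.choose_spec⟩

theorem aestronglyMeasurable_parts {T : ℝ} {w : ℝ → 𝓢'(E N, ℂ)} {v : ℝ → E N → ℝ}
    (hv : AEStronglyMeasurable (Function.uncurry v)
      ((timeMeasure T).prod (volume : Measure (E N))))
    (hwv : ∀ᵐ t ∂timeMeasure T, IsGivenBy (w t) (v t) ∧ MemLp (fun x => (v t x : ℂ)) ⊤ volume ∧
      MemSh P (w t)) (g : 𝓢(E N, ℂ)) :
    AEStronglyMeasurable (fun t => lowPart P (w t) g) (timeMeasure T) ∧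
      AEStronglyMeasurable (fun t => highPart P (w t) g) (timeMeasure T) := by
  obtain ⟨v', hv', hvv⟩ := exists_stronglyMeasurable_family hv
  set V : ℝ → E N → ℂ := fun t x => (v' t x : ℂ) with hVdef
  have hV : StronglyMeasurable (Function.uncurry V) :=
    Complex.continuous_ofReal.comp_stronglyMeasurable hv'
  have hwV : ∀ᵐ t ∂timeMeasure T, HasDensity (w t) (V t) ∧ MemLp (V t) ⊤ volume ∧
      MemSh P (w t) := by
    filter_upwards [hwv, hvv] with t h1 h3
    have h4 : (fun x => (v t x : ℂ)) =ᵐ[volume] V t := by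
      filter_upwards [h3] with x hx
      rw [hx]
    exact ⟨(h1.1.hasDensity h1.2.1).congr h4, h1.2.1.ae_eq h4, h1.2.2⟩
  have hlow := stronglyMeasurable_scaledConv hV (kernel P.symχ) ((2 : ℝ) ^ (1 : ℤ))
  exact ⟨aestronglyMeasurable_apply hlow
      (hwV.mono fun t ht => ht.2.2.lowPart_density ht.1 ht.2.1) g,
    aestronglyMeasurable_apply (hV.sub hlow)
      (hwV.mono fun t ht => ht.2.2.highPart_density ht.1 ht.2.1) g⟩

end HybridBesov

end

theorem lemma7p1 (N : ℕ) (hN : 2 ≤ N) (P : HybridBesov.LPCouple N) (s : ℝ) (hs : 0 ≤ s)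
    (K : ℝ → ℝ) (hK : ContDiff ℝ ∞ K) (hK0 : K 0 = 0) :
    ∃ C : ℝ≥0 → ℝ≥0, Monotone C ∧
      ∀ (r : ℝ≥0∞), 1 ≤ r → ∀ (T : ℝ), 0 < T →
      -- `u t` is the tempered distribution given by the real function `v t`
      ∀ (u : ℝ → 𝓢'(HybridBesov.E N, ℂ)) (v : ℝ → HybridBesov.E N → ℝ),
        AEStronglyMeasurable (Function.uncurry v)
          ((HybridBesov.timeMeasure T).prod (volume : Measure (HybridBesov.E N))) →
        (∀ᵐ t ∂HybridBesov.timeMeasure T, HybridBesov.IsGivenBy (u t) (v t)) →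
        HybridBesov.MemLinftyBesov P T ((N : ℝ) / 2) u →
        HybridBesov.MemCL P T r ((N : ℝ) / 2 + s) (fun t => HybridBesov.lowPart P (u t)) →
        HybridBesov.MemCL P T r ((N : ℝ) / 2) (fun t => HybridBesov.highPart P (u t)) →
        HybridBesov.supNorm T v < ⊤ ∧
        -- `w` is `K(u)` as a tempered distribution
        ∃ w : ℝ → 𝓢'(HybridBesov.E N, ℂ),
          (∀ᵐ t ∂HybridBesov.timeMeasure T,
            HybridBesov.IsGivenBy (w t) (fun x => K (v t x)) ∧ HybridBesov.MemSh P (w t)) ∧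
          HybridBesov.MemCL P T r ((N : ℝ) / 2 + s) (fun t => HybridBesov.lowPart P (w t)) ∧
          HybridBesov.MemCL P T r ((N : ℝ) / 2) (fun t => HybridBesov.highPart P (w t)) ∧
          HybridBesov.clNorm P T r ((N : ℝ) / 2 + s) (fun t => HybridBesov.lowPart P (w t)) ≤
            (C (HybridBesov.supNorm T v).toNNReal : ℝ≥0∞) *
              (HybridBesov.clNorm P T r ((N : ℝ) / 2 + s)
                  (fun t => HybridBesov.lowPart P (u t)) +
                HybridBesov.clNorm P T r ((N : ℝ) / 2)
                  (fun t => HybridBesov.highPart P (u t))) ∧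
          HybridBesov.clNorm P T r ((N : ℝ) / 2) (fun t => HybridBesov.highPart P (w t)) ≤
            (C (HybridBesov.supNorm T v).toNNReal : ℝ≥0∞) *
              (HybridBesov.clNorm P T r ((N : ℝ) / 2 + s)
                  (fun t => HybridBesov.lowPart P (u t)) +
                HybridBesov.clNorm P T r ((N : ℝ) / 2)
                  (fun t => HybridBesov.highPart P (u t))) := by
  choose c hc using fun n : ℕ => HybridBesov.exists_clNorm_comp_le hN P hs hK hK0
    (R := (n : ℝ)) n.cast_nonneg
  -- The constants for integer bounds carry no monotonicity, so they are summed up to `⌈R⌉`. The sum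
  -- is nondecreasing in `R` and dominates the constant for the bound `⌈R⌉ ≥ R`.
  refine ⟨fun R => ∑ i ∈ Finset.range (⌈R⌉₊ + 1), c i, fun a b hab => ?_,
    fun r hr T hT u v hv huv hu hlow hhigh => ?_⟩
  · exact Finset.sum_le_sum_of_subset (Finset.range_mono (by gcongr))
  have hsup := HybridBesov.supNorm_lt_top huv hu
  obtain ⟨w, hw⟩ := HybridBesov.exists_comp_distribution hN hK hK0 huv hu
  set R := (HybridBesov.supNorm T v).toNNReal with hR
  have hvR : ∀ᵐ t ∂HybridBesov.timeMeasure T, ∀ᵐ x, ‖v t x‖ ≤ (⌈R⌉₊ : ℝ) := by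
    filter_upwards [HybridBesov.ae_norm_le_supNorm hsup] with t ht
    filter_upwards [ht] with x hx
    exact hx.trans (by exact_mod_cast Nat.le_ceil R)
  have hcle : (c ⌈R⌉₊ : ℝ≥0∞) ≤
      ((∑ i ∈ Finset.range (⌈R⌉₊ + 1), c i : ℝ≥0) : ℝ≥0∞) := by
    exact_mod_cast Finset.single_le_sum (f := c) (fun i _ => zero_le)
      (Finset.mem_range.2 (Nat.lt_succ_self ⌈R⌉₊))
  obtain ⟨h1, h2⟩ := hc ⌈R⌉₊ r hr T u w v hv huv hu hw hvR
  have h1' := h1.trans (mul_le_mul_left hcle _)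
  have h2' := h2.trans (mul_le_mul_left hcle _)
  have hfin := ENNReal.mul_lt_top (ENNReal.coe_lt_top
    (r := ∑ i ∈ Finset.range (⌈R⌉₊ + 1), c i)) (ENNReal.add_lt_top.2 ⟨hlow.bound, hhigh.bound⟩)
  have hmeas := HybridBesov.aestronglyMeasurable_parts (P := P) (w := w)
    (v := fun t x => K (v t x)) (hK.continuous.comp_aestronglyMeasurable hv) (by
      filter_upwards [hw, HybridBesov.ae_besov_bounded huv hu] with t ht ht'
      exact ⟨ht.1, HybridBesov.memLp_comp hK.continuous ht'.1, ht.2⟩)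
  exact ⟨hsup, w, hw,
    ⟨fun g => (hmeas g).1, hw.mono fun t ht => ht.2.lowPart, h1'.trans_lt hfin⟩,
    ⟨fun g => (hmeas g).2, hw.mono fun t ht => ht.2.highPart, h2'.trans_lt hfin⟩, h1', h2'⟩
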